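/- Fix integers $g\ge 0$ and $n\ge 1$. A fat graph is a finite connected graph with at least one edge and without vertices of valence one, together with a cyclic order on the flags (half-edges) at each vertex. Let $\sigma$ send a flag to the next one at its vertex and let $\alpha$ send a flag to the opposite end of its edge. The boundary components of the fat graph are the orbits of $\sigma\alpha$ on the set of flags, and its genus $g$ is defined by $\#V-\#E+n=2-2g$, where $n$ is the number of boundary components. Let $\mathbb{TM}'^{\,n}_g$ be the category whose objects are the fat graphs of genus $g$ with $n$ boundary components, numbered $1,\dots,n$ (vertices of valence two are allowed). Its morphisms are the finite compositions of isomorphisms of fat graphs, shrinkings of a single edge that is not a loop, and insertions of a two-valent vertex into an edge, all of them compatible with the numbering of the boundary components; two such compositions are equal if the corresponding maps of CW-complexes are homotopic relative to the zero-skeleton of the source. Let $\Lambda$ be Connes' cyclic category. Its objects $[k]$, $k\ge 1$, are the finite nonempty cyclically ordered sets, regarded as oriented polygons; its morphisms are the homotopy classes, relative to the vertices, of monotone maps of degree one that carry vertices to vertices. For $1\le i\le n$ let $\partial_i:\mathbb{TM}'^{\,n}_g\to\Lambda$ be the functor that sends a fat graph to the oriented polygon whose vertices are the corners of the fat graph (pairs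 of consecutive flags at a vertex) lying on the $i$-th boundary component, and whose edges are the edges of the graph along which this component runs. For an object $[k_1]\times\dots\times[k_n]$ of $\Lambda^n$ let $([k_1]\times\dots\times[k_n]\backslash \partial_1\times\dots\times\partial_n)$ be the category whose objects are the pairs of a fat graph $\Gamma\in\mathbb{TM}'^{\,n}_g$ and a morphism $v:[k_1]\times\dots\times[k_n]\to\partial_1(\Gamma)\times\dots\times\partial_n(\Gamma)$ in $\Lambda^n$, and whose morphisms $(\Gamma,v)\to(\Gamma',v')$ are the morphisms $w:\Gamma\to\Gamma'$ with $v'=(\partial_1\times\dots\times\partial_n)(w)\circ v$. Then for every morphism $\psi:[k_1]\times\dots\times[k_n]\to[k'_1]\times\dots\times[k'_n]$ of $\Lambda^n$ the functor $$\psi^*:([k'_1]\times\dots\times[k'_n]\backslash \partial_1\times\dots\times\partial_n)\to([k_1]\times\dots\times[k_n]\backslash \partial_1\times\dots\times\partial_n),\qquad (\Gamma,v)\mapsto(\Gamma,v\circ\psi),$$ is a homotopy equivalence, that is, it induces a homotopy equivalence between the geometric realizations of the nerves. In particular, for fixed $g$ and $n$, the homotopy type of (the realization of the nerve of) $([k_1]\times\dots\times[k_n]\backslash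 \partial_1\times\dots\times\partial_n)$ does not depend on $k_1,\dots,k_n$. -/

import Mathlib

open CategoryTheory

/-! ### Maps between disjoint unions of oriented polygons

A permutation `s` of a finite set `X` is the same thing as a disjoint union of oriented polygons
with vertex set `X`: there is one oriented edge from `x` to `s x` for every `x : X`, which is again
called `x`, and the polygons are the orbits of `s`. -/

/-- `IsWalk t y l z`: starting at the vertex `y` and following the orientation one passes
successively through the oriented edges in the list `l` and arrives at the vertex `z`. -/
def IsWalk {Y : Type} (t : Equiv.Perm Y) : Y → List Y → Y → Prop
  | y, [], z => y = z
  | y, a :: l, z => a = y ∧ IsWalk t (t y) l z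

theorem IsWalk.append {Y : Type} {t : Equiv.Perm Y} {l l' : List Y} {x y z : Y}
    (h : IsWalk t x l y) (h' : IsWalk t y l' z) : IsWalk t x (l ++ l') z := by
  induction l generalizing x with
  | nil => cases h; exact h'
  | cons a l ih => exact ⟨h.1, ih h.2⟩

/-- Any function invariant under the permutation is constant along a walk. -/
theorem IsWalk.const {Y Z : Type} {t : Equiv.Perm Y} {m : Y → Z} (hm : ∀ y, m (t y) = m y)
    {l : List Y} {x y : Y} (h : IsWalk t x l y) : m y = m x ∧ ∀ a ∈ l, m a = m x := by
  induction l generalizing x with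
  | nil => cases h; simp
  | cons a l ih =>
    obtain ⟨rfl, h⟩ := h
    have := ih h
    simp only [hm] at this
    simpa using this

/-- A (homotopy class, relative to the vertices, of a) monotone map of degree one from one disjoint
union of oriented polygons to another one, carrying vertices to vertices: every vertex `x` goes to
the vertex `onVertex x`, every edge `x` goes to the oriented path `path x` (which is constant if the
list is empty), and every oriented edge of the target is covered exactly once. -/
@[ext]
structure PolygonMap {X Y : Type} (s : Equiv.Perm X) (t : Equiv.Perm Y) where
  onVertex : X → Y
  path : X → List Y
  walk : ∀ x, IsWalk t (onVertex x) (path x) (onVertex (s x))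
  nodup : ∀ x, (path x).Nodup
  cover : ∀ y, ∃! x, y ∈ path x

namespace PolygonMap

def id {X : Type} (s : Equiv.Perm X) : PolygonMap s s where
  onVertex x := x
  path x := [x]
  walk x := ⟨rfl, rfl⟩
  nodup x := by simp
  cover y := by simp

theorem walk_flatMap {X Y : Type} {s : Equiv.Perm X} {t : Equiv.Perm Y} (f : PolygonMap s t)
    {l : List X} {x y : X} (h : IsWalk s x l y) :
    IsWalk t (f.onVertex x) (l.flatMap f.path) (f.onVertex y) := by
  induction l generalizing x with
  | nil => cases h; rfl
  | cons a l ih =>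
    obtain ⟨rfl, h⟩ := h
    rw [List.flatMap_cons]
    exact (f.walk a).append (ih h)

/-- Composition (in diagrammatic order). -/
def comp {X Y Z : Type} {s : Equiv.Perm X} {t : Equiv.Perm Y} {u : Equiv.Perm Z}
    (f : PolygonMap s t) (g : PolygonMap t u) : PolygonMap s u where
  onVertex x := g.onVertex (f.onVertex x)
  path x := (f.path x).flatMap g.path
  walk x := g.walk_flatMap (f.walk x)
  nodup x := by
    rw [List.nodup_flatMap]
    refine ⟨fun y _ => g.nodup y, (f.nodup x).imp ?_⟩
    intro a b hab z ha hb
    exact hab ((g.cover z).unique ha hb)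
  cover z := by
    obtain ⟨y, hy, hy'⟩ := g.cover z
    obtain ⟨x, hx, hx'⟩ := f.cover y
    refine ⟨x, List.mem_flatMap.2 ⟨y, hx, hy⟩, fun x' h => ?_⟩
    obtain ⟨y', h1, h2⟩ := List.mem_flatMap.1 h
    obtain rfl := hy' y' h2
    exact hx' x' h1

end PolygonMap

/-! ### The cyclic category -/

/-- A finite nonempty cyclically ordered set, that is, an oriented polygon; `next` is the cyclic
successor. The one with `k` elements is the object `[k]` of the cyclic category. -/
structure CyclicSet where
  carrier : Type
  [finite : Finite carrier]
  [nonempty : Nonempty carrier]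
  next : Equiv.Perm carrier
  transitive : ∀ x y, next.SameCycle x y

/-- Connes' cyclic category `Λ`: a morphism is a homotopy class, relative to the vertices, of
monotone maps of degree one between oriented polygons carrying vertices to vertices. -/
instance CyclicSet.category : Category.{0} CyclicSet where
  Hom A B := PolygonMap A.next B.next
  id A := PolygonMap.id A.next
  comp f g := f.comp g
  id_comp f := by
    refine PolygonMap.ext rfl (funext fun x => ?_)
    simp [PolygonMap.comp, PolygonMap.id]
  comp_id f := by
    refine PolygonMap.ext rfl (funext fun x => ?_)
    simp [PolygonMap.comp, PolygonMap.id]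
  assoc f g h := by
    refine PolygonMap.ext rfl (funext fun x => ?_)
    exact List.flatMap_assoc

/-! ### Fat graphs -/

/-- A finite connected fat graph of genus `g` with `n` boundary components, which are numbered by
`Fin n`, and without vertices of valence one.

The graph is given by its flags (half edges). The vertices are the orbits of `rot`, which sends a
flag to the next one in the cyclic order at its vertex; the edges are the orbits of `opp`, which
sends a flag to the opposite end of its edge. -/
structure FatGraph (g n : ℕ) where
  Flag : Type
  [finite : Finite Flag]
  [nonempty : Nonempty Flag]
  rot : Equiv.Perm Flag
  opp : Equiv.Perm Flag
  opp_opp : ∀ d, opp (opp d) = d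
  opp_ne : ∀ d, opp d ≠ d
  /-- all valences are at least two -/
  rot_ne : ∀ d, rot d ≠ d
  connected : ∀ d e, ∃ w ∈ Subgroup.closure {rot, opp}, w d = e
  /-- the number of the boundary component of the corner between `rot⁻¹ d` and `d` -/
  mark : Flag → Fin n
  mark_surjective : Function.Surjective mark
  /-- The boundary components are the orbits of `d ↦ rot (opp d)`: the boundary component passing
  through the corner between `rot⁻¹ d` and `d` runs along the edge of `d`, and the next corner it
  meets is the one between `opp d` and `rot (opp d)`. -/
  mark_eq_iff : ∀ d e, mark d = mark e ↔ (rot * opp).SameCycle d e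
  /-- vertices minus edges plus boundary components is `2 - 2g` -/
  euler : (Nat.card (Quotient (Equiv.Perm.SameCycle.setoid rot)) : ℤ)
    - Nat.card (Quotient (Equiv.Perm.SameCycle.setoid opp)) + n = 2 - 2 * g

namespace FatGraph

variable {g n : ℕ}

/-- The corners of the fat graph form the vertices of `n` oriented polygons, the boundary
components. The corner between `rot⁻¹ d` and `d` is represented by `d`, and so is the oriented edge
of the polygon that starts there; it runs along the edge of `d`. -/
def boundary (Γ : FatGraph g n) : Equiv.Perm Γ.Flag := Γ.rot * Γ.opp

theorem mark_boundary (Γ : FatGraph g n) (d : Γ.Flag) : Γ.mark (Γ.boundary d) = Γ.mark d :=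
  (Γ.mark_eq_iff _ _).2 (Equiv.Perm.sameCycle_apply_left.2 (Equiv.Perm.SameCycle.refl _ _))

/-- A cellular map of marked fat graphs, up to homotopy relative to the vertices. The flag `d`,
regarded as the edge oriented away from the vertex of `d`, is sent to the edge path `path d`, and
the corner `d` is sent to the corner `onVertex d`.  -/
@[ext]
structure CellMap (Γ Δ : FatGraph g n) extends PolygonMap Γ.boundary Δ.boundary where
  /-- the reversed edge goes to the reversed path -/
  path_opp : ∀ d, path (Γ.opp d) = ((path d).map Δ.opp).reverse
  /-- vertices are sent to vertices -/
  onVertex_rot : ∀ d, Δ.rot.SameCycle (onVertex d) (onVertex (Γ.rot d))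
  /-- the numbering of the boundary components is preserved -/
  mark_onVertex : ∀ d, Δ.mark (onVertex d) = Γ.mark d

namespace CellMap

def id (Γ : FatGraph g n) : CellMap Γ Γ where
  toPolygonMap := PolygonMap.id _
  path_opp d := by simp [PolygonMap.id]
  onVertex_rot d := Equiv.Perm.sameCycle_apply_right.2 (Equiv.Perm.SameCycle.refl _ _)
  mark_onVertex d := rfl

theorem sameCycle {Γ Δ : FatGraph g n} (f : CellMap Γ Δ) {d e : Γ.Flag}
    (h : Γ.rot.SameCycle d e) : Δ.rot.SameCycle (f.onVertex d) (f.onVertex e) := by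
  obtain ⟨i, rfl⟩ := h
  induction i using Int.induction_on with
  | zero => exact Equiv.Perm.SameCycle.refl _ _
  | succ i ih =>
    rw [add_comm, zpow_add, zpow_one, Equiv.Perm.mul_apply]
    exact ih.trans (f.onVertex_rot _)
  | pred i ih =>
    refine ih.trans (Equiv.Perm.SameCycle.symm ?_)
    have := f.onVertex_rot ((Γ.rot ^ (-(i : ℤ) - 1)) d)
    rwa [← Equiv.Perm.mul_apply, ← zpow_one_add, add_sub_cancel] at this

def comp {Γ Δ Θ : FatGraph g n} (f : CellMap Γ Δ) (h : CellMap Δ Θ) : CellMap Γ Θ where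
  toPolygonMap := f.toPolygonMap.comp h.toPolygonMap
  path_opp d := by
    simp only [PolygonMap.comp, f.path_opp, List.map_flatMap, List.reverse_flatMap,
      ← List.map_reverse, List.flatMap_map]
    congr 1
    funext e
    simp [h.path_opp]
  onVertex_rot d := h.sameCycle (f.onVertex_rot d)
  mark_onVertex d := (h.mark_onVertex _).trans (f.mark_onVertex d)

/-- The cellular maps that are finite compositions of
* isomorphisms of marked fat graphs,
* shrinkings of one edge which is not a loop,
* insertions of one vertex of valence two into one edge. -/
inductive IsGenerated : ∀ {Γ Δ : FatGraph g n}, CellMap Γ Δ → Prop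
  | iso {Γ Δ : FatGraph g n} (f : CellMap Γ Δ) (h : ∀ d, (f.path d).length = 1) : IsGenerated f
  | shrink {Γ Δ : FatGraph g n} (f : CellMap Γ Δ) (e : Γ.Flag)
      (hloop : ¬ Γ.rot.SameCycle e (Γ.opp e)) (he : (f.path e).length = 0)
      (h : ∀ d, d ≠ e → d ≠ Γ.opp e → (f.path d).length = 1) : IsGenerated f
  | insert {Γ Δ : FatGraph g n} (f : CellMap Γ Δ) (e : Γ.Flag) (he : (f.path e).length = 2)
      (h : ∀ d, d ≠ e → d ≠ Γ.opp e → (f.path d).length = 1) : IsGenerated f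
  | comp {Γ Δ Θ : FatGraph g n} (f : CellMap Γ Δ) (f' : CellMap Δ Θ) (hf : IsGenerated f)
      (hf' : IsGenerated f') : IsGenerated (f.comp f')

end CellMap

/-- The category of fat graphs of genus `g` with `n` boundary components, vertices of valence two
being allowed. Its morphisms are generated by isomorphisms, shrinkings of edges and insertions of
vertices; two of them are equal if they are homotopic relative to the vertices. -/
instance category : Category.{0} (FatGraph g n) where
  Hom Γ Δ := {f : CellMap Γ Δ // f.IsGenerated}
  id Γ := ⟨CellMap.id Γ, .iso _ fun _ => rfl⟩
  comp f h := ⟨f.1.comp h.1, .comp _ _ f.2 h.2⟩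
  id_comp f := by
    refine Subtype.ext (CellMap.ext rfl (funext fun x => ?_))
    simp [CellMap.comp, PolygonMap.comp, PolygonMap.id, CellMap.id]
  comp_id f := by
    refine Subtype.ext (CellMap.ext rfl (funext fun x => ?_))
    simp [CellMap.comp, PolygonMap.comp, PolygonMap.id, CellMap.id]
  assoc f h k := by
    refine Subtype.ext (CellMap.ext rfl (funext fun x => ?_))
    exact List.flatMap_assoc

/-! ### The boundary functors -/

/-- The `i`-th boundary component of a fat graph, as an oriented polygon. -/
def boundaryPolygon (Γ : FatGraph g n) (i : Fin n) : CyclicSet where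
  carrier := {d : Γ.Flag // Γ.mark d = i}
  finite := haveI := Γ.finite; inferInstance
  nonempty := let ⟨d, hd⟩ := Γ.mark_surjective i; ⟨⟨d, hd⟩⟩
  next := Γ.boundary.subtypePerm fun d => by rw [Γ.mark_boundary]
  transitive x y := by
    rw [Equiv.Perm.sameCycle_subtypePerm]
    exact (Γ.mark_eq_iff _ _).1 (x.2.trans y.2.symm)

theorem CellMap.mark_path {Γ Δ : FatGraph g n} (f : CellMap Γ Δ) {d : Γ.Flag} {e : Δ.Flag}
    (h : e ∈ f.path d) : Δ.mark e = Γ.mark d :=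
  (((f.walk d).const Δ.mark_boundary).2 e h).trans (f.mark_onVertex d)

theorem isWalk_attachWith {Γ : FatGraph g n} {i : Fin n} {l : List Γ.Flag}
    (hl : ∀ e ∈ l, Γ.mark e = i) {x y : (Γ.boundaryPolygon i).carrier}
    (h : IsWalk Γ.boundary x.1 l y.1) :
    IsWalk (Γ.boundaryPolygon i).next x (l.attachWith (fun e => Γ.mark e = i) hl) y := by
  induction l generalizing x with
  | nil => exact Subtype.ext h
  | cons a l ih => exact ⟨Subtype.ext h.1, ih _ h.2⟩

theorem attachWith_flatMap {X Y : Type} {P : X → Prop} {Q : Y → Prop} (l : List X)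
    (hl : ∀ x ∈ l, P x) (p : X → List Y) (q : {x // P x} → List {y // Q y})
    (hp : ∀ y ∈ l.flatMap p, Q y) (hq : ∀ x, (q x).map Subtype.val = p x.1) :
    (l.flatMap p).attachWith Q hp = (l.attachWith P hl).flatMap q := by
  refine List.map_injective_iff.2 Subtype.val_injective ?_
  rw [List.attachWith_map_subtype_val, List.map_flatMap]
  simp only [hq]
  rw [← List.flatMap_map Subtype.val p, List.attachWith_map_subtype_val]

/-- The restriction of a cellular map to the `i`-th boundary components. -/
def CellMap.onBoundary {Γ Δ : FatGraph g n} (f : CellMap Γ Δ) (i : Fin n) :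
    PolygonMap (Γ.boundaryPolygon i).next (Δ.boundaryPolygon i).next where
  onVertex x := ⟨f.onVertex x.1, (f.mark_onVertex x.1).trans x.2⟩
  path x := (f.path x.1).attachWith (fun e => Δ.mark e = i) fun _ h => (f.mark_path h).trans x.2
  walk x := isWalk_attachWith _ (f.walk x.1)
  nodup x := by
    refine List.Nodup.of_map Subtype.val ?_
    rw [List.attachWith_map_subtype_val]
    exact f.nodup x.1
  cover y := by
    obtain ⟨x, hx, hx'⟩ := f.cover y.1
    exact ⟨⟨x, (f.mark_path hx).symm.trans y.2⟩, (List.mem_attachWith ..).2 hx,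
      fun x' h => Subtype.ext (hx' x'.1 ((List.mem_attachWith ..).1 h))⟩

/-- The boundary functor `∂ᵢ` from fat graphs to the cyclic category. -/
def boundaryFunctor (g n : ℕ) (i : Fin n) : FatGraph g n ⥤ CyclicSet where
  obj Γ := Γ.boundaryPolygon i
  map f := f.1.onBoundary i
  map_id Γ := by
    refine PolygonMap.ext rfl (funext fun x => ?_)
    rfl
  map_comp {Γ Δ Θ} f h := by
    refine PolygonMap.ext rfl (funext fun x => ?_)
    exact attachWith_flatMap _ _ _ _ _ fun _ => List.attachWith_map_subtype_val _

/-- The functor `∂₁ × ⋯ × ∂ₙ` from fat graphs to the `n`-fold product of the cyclic category. -/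
def boundaries (g n : ℕ) : FatGraph g n ⥤ (Fin n → CyclicSet) :=
  Functor.pi' (boundaryFunctor g n)

end FatGraph

/-! ### Homotopy equivalences of categories -/

universe u v

/-- The geometric realization of the nerve of a category. -/
noncomputable abbrev realizedNerve (C : Type u) [Category.{v} C] : TopCat.{max u v} :=
  SSet.toTop.obj (nerve C)

/-- A functor is a homotopy equivalence if the map that it induces between the geometric
realizations of the nerves is a homotopy equivalence of topological spaces. -/
def IsHomotopyEquivalence {C D : Type u} [Category.{v} C] [Category.{v} D] (F : C ⥤ D) : Prop :=
  ∃ h : ContinuousMap.HomotopyEquiv (realizedNerve C) (realizedNerve D),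
    h.toFun = (SSet.toTop.map (nerveMap F)).hom

/-! Let `P` be a disjoint union of `n` oriented polygons. The comma category over `P` is equivalent
to the category `Filling P g` of fat graphs with a map from `P` to the boundary. Every `P` maps to
the system with one vertex on each polygon, so by two out of three it suffices to treat maps to that
system (`Hom.isHomotopyEquivalence`). Such a map is a composition of collapses of single edges `x`
and an isomorphism. Pulling back along a collapse identifies the fillings of the smaller system with
the full subcategory of the fillings whose path `x` is constant. The point is therefore that the
inclusion of this subcategory is a homotopy equivalence (`isHomotopyEquivalence_pathConstant`).

Unmarked bivalent vertices can be removed (`exists_minimal`), so the minimal fillings, in which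
every bivalent vertex has a marked corner, form a coreflective subcategory. A morphism between
minimal fillings never subdivides an edge; it only shrinks edges, and the coslices of this category
are thin.

Call a filling free if the path `x` is not constant and ends at a bivalent vertex without any other
marked corner. If the path `x` is not constant and the filling is not free, one slides the end of
the path back into the middle of its last edge and obtains a free filling over the given one
(`exists_cover`). The number `rank` ignores the additional edge and does not increase along
morphisms. Now add the fillings with nonconstant path in the order of their rank. A new object of
rank `k` receives exactly one morphism from exactly one representative `b` of the free fillings of
rank `k`. Hence the nerve grows by gluing in, for every such `b`, the nerve of the coslice under `b`
along its part of lower rank (`TrivialExtension.of_under`).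

The coslice is contractible, and so is its part of lower rank (`trivialExtension_coslice`). This
part is the union of `Z`, where the last edge of the path is shrunk, and `Q`, where some edge away
from the free vertex is shrunk. `Z` has a least element. A member of `Q` outside `Z` can be lowered
until neither edge at the free vertex is shrunk and then raised into `Z` by shrinking the last edge;
so `Z ∩ Q` and `Q` are equivalent, and `Z ∪ Q` is contractible with `Z`.

The homotopy theory is done with `trivialCofibrations`, the maps with the left lifting property
against restriction maps between mapping spaces to Kan complexes. They contain the anodyne maps, are
stable under pushouts, and allow cancellation (`trivialCofibrations_of_precomp`). Their realizations
are homotopy equivalences, because singular simplicial sets are Kan complexes and simplicial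
homotopies can be turned into topological ones (`homotopic_of_cylinder`). -/

set_option autoImplicit false

/-! ### Trivial cofibrations of simplicial sets -/

namespace SSet

open Simplicial HomotopicalAlgebra MonoidalCategory Limits modelCategoryQuillen Opposite

universe w

/-- The restriction maps between the mapping spaces to Kan complexes along monomorphisms. -/
inductive kanPowers : MorphismProperty SSet.{w} where
  | mk {K L : SSet.{w}} (i : K ⟶ L) [Mono i] (X : SSet.{w}) [KanComplex X] :
      kanPowers ((MonoidalClosed.pre i).app X)

/-- The maps with the left lifting property against all restriction maps between mapping spaces
to Kan complexes. -/
def trivialCofibrations : MorphismProperty SSet.{w} := kanPowers.llp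
deriving MorphismProperty.IsMultiplicative, MorphismProperty.RespectsIso,
  MorphismProperty.IsStableUnderCobaseChange

/-- Restriction of maps to a Kan complex along a monomorphism is a Kan fibration. -/
theorem anodyneExtensions_le_trivialCofibrations :
    anodyneExtensions.{w} ≤ trivialCofibrations := by
  intro A B j hj _ _ _ h
  obtain ⟨i, X⟩ := h
  exact hj _ (by rw [← HomotopicalAlgebra.fibration_iff]; infer_instance)

/-- Both lifting problems are adjoint to extending maps to `X` from the pushout of `K ⊗ B` and `L ⊗
A` over `K ⊗ A` to `L ⊗ B`; the braiding exchanges the two factors. -/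
theorem hasLiftingProperty_pre_swap {A B K L X : SSet.{w}} (i : K ⟶ L) (j : A ⟶ B)
    (h : HasLiftingProperty j ((MonoidalClosed.pre i).app X)) :
    HasLiftingProperty i ((MonoidalClosed.pre j).app X) := by
  let sq := Functor.PushoutObjObj.ofHasPushout (curriedTensor SSet.{w}) i j
  have h₁ := (MonoidalClosed.internalHomAdjunction₂.hasLiftingProperty_iff sq
    (Functor.PullbackObjObj.ofIsTerminal MonoidalClosed.internalHom i (terminal.from X)
      terminalIsTerminal)).2 h
  refine (MonoidalClosed.internalHomAdjunction₂.hasLiftingProperty_iff sq.flipTensor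
    (Functor.PullbackObjObj.ofIsTerminal MonoidalClosed.internalHom j (terminal.from X)
      terminalIsTerminal)).1 ?_
  exact (HasLiftingProperty.iff_of_arrow_iso_left
    (show Arrow.mk sq.ι ≅ Arrow.mk sq.flipTensor.ι from
      Arrow.isoMk (Iso.refl _) (β_ _ _)) _).1 h₁

theorem mem_horn_one_zero {m : SimplexCategoryᵒᵖ} (x : (Δ[1] : SSet.{w}).obj m) :
    x ∈ (Λ[1, 0] : (Δ[1] : SSet.{w}).Subcomplex).obj m ↔
      ∀ k, stdSimplex.asOrderHom x k = 0 := by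
  rw [mem_horn_iff, Ne, Set.eq_univ_iff_forall]
  push Not
  constructor
  · rintro ⟨k, hk⟩ l
    simp only [Set.union_singleton, Set.mem_insert_iff, Set.mem_range, not_or, not_exists] at hk
    have := hk.2 l
    generalize stdSimplex.asOrderHom x l = z at *
    fin_cases z <;> fin_cases k <;> simp_all
  · intro h
    refine ⟨1, ?_⟩
    simp [h]

theorem mem_horn_one_one {m : SimplexCategoryᵒᵖ} (x : (Δ[1] : SSet.{w}).obj m) :
    x ∈ (Λ[1, 1] : (Δ[1] : SSet.{w}).Subcomplex).obj m ↔
      ∀ k, stdSimplex.asOrderHom x k = 1 := by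
  rw [mem_horn_iff, Ne, Set.eq_univ_iff_forall]
  push Not
  constructor
  · rintro ⟨k, hk⟩ l
    simp only [Set.union_singleton, Set.mem_insert_iff, Set.mem_range, not_or, not_exists] at hk
    have := hk.2 l
    generalize stdSimplex.asOrderHom x l = z at *
    fin_cases z <;> fin_cases k <;> simp_all
  · intro h
    refine ⟨0, ?_⟩
    simp [h]

theorem not_mem_horn_one_both {m : SimplexCategoryᵒᵖ} (x : (Δ[1] : SSet.{w}).obj m)
    (h₀ : x ∈ (Λ[1, 0] : (Δ[1] : SSet.{w}).Subcomplex).obj m)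
    (h₁ : x ∈ (Λ[1, 1] : (Δ[1] : SSet.{w}).Subcomplex).obj m) : False := by
  have h₀ := (mem_horn_one_zero x).1 h₀ 0
  have h₁ := (mem_horn_one_one x).1 h₁ 0
  rw [h₀] at h₁
  exact absurd h₁ (by decide)

open Classical in
/-- The map on `(L ⊗ ∂Δ[1]) ∪ (A ⊗ Δ[1])` which is `f` at the end `0` and `g` elsewhere. -/
noncomputable def glueEnds {L Z : SSet.{w}} (A : L.Subcomplex) (f g : L ⟶ Z)
    (h : A.ι ≫ f = A.ι ≫ g) :
    ((A.unionProd (Λ[1, 0] ⊔ Λ[1, 1]) : (L ⊗ Δ[1]).Subcomplex) : SSet.{w}) ⟶ Z where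
  app m := ↾fun x => if x.1.2 ∈ (Λ[1, 0] : (Δ[1] : SSet.{w}).Subcomplex).obj m
    then f.app m x.1.1 else g.app m x.1.1
  naturality := by
    intro m m' φ
    ext ⟨⟨x, y⟩, hx⟩
    change (if (Δ[1] : SSet.{w}).map φ y ∈ (Λ[1, 0] : (Δ[1] : SSet.{w}).Subcomplex).obj m'
      then f.app m' (L.map φ x) else g.app m' (L.map φ x)) = Z.map φ
      (if y ∈ (Λ[1, 0] : (Δ[1] : SSet.{w}).Subcomplex).obj m then f.app m x else g.app m x)
    have e (k : L ⟶ Z) : k.app m' (L.map φ x) = Z.map φ (k.app m x) :=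
      ConcreteCategory.congr_hom (k.naturality φ) x
    by_cases h0 : y ∈ (Λ[1, 0] : (Δ[1] : SSet.{w}).Subcomplex).obj m
    · rw [if_pos h0]
      exact (if_pos (Λ[1, 0].map φ h0)).trans (e f)
    · rw [if_neg h0]
      rcases (Subcomplex.mem_unionProd_iff _ _ _).1 hx with (h1 | h1) | h1
      · exact absurd h1 h0
      · exact (if_neg (fun h2 => not_mem_horn_one_both _ h2 (Λ[1, 1].map φ h1))).trans (e g)
      · have hA : f.app m x = g.app m x :=
          ConcreteCategory.congr_hom (congr_app h m) ⟨x, h1⟩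
        split_ifs
        · rw [e, hA]
        · rw [e]

theorem glueEnds_app_of_mem {L Z : SSet.{w}} (A : L.Subcomplex) (f g : L ⟶ Z)
    (h : A.ι ≫ f = A.ι ≫ g) {m : SimplexCategoryᵒᵖ}
    (x : ((A.unionProd (Λ[1, 0] ⊔ Λ[1, 1]) : (L ⊗ Δ[1]).Subcomplex) : SSet.{w}).obj m)
    (hx : x.1.2 ∈ (Λ[1, 0] : (Δ[1] : SSet.{w}).Subcomplex).obj m) :
    (glueEnds A f g h).app m x = f.app m x.1.1 :=
  if_pos hx

theorem glueEnds_app_of_notMem {L Z : SSet.{w}} (A : L.Subcomplex) (f g : L ⟶ Z)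
    (h : A.ι ≫ f = A.ι ≫ g) {m : SimplexCategoryᵒᵖ}
    (x : ((A.unionProd (Λ[1, 0] ⊔ Λ[1, 1]) : (L ⊗ Δ[1]).Subcomplex) : SSet.{w}).obj m)
    (hx : x.1.2 ∉ (Λ[1, 0] : (Δ[1] : SSet.{w}).Subcomplex).obj m) :
    (glueEnds A f g h).app m x = g.app m x.1.1 :=
  if_neg hx

theorem glueEnds_app_of_mem' {L Z : SSet.{w}} (A : L.Subcomplex) (f g : L ⟶ Z)
    (h : A.ι ≫ f = A.ι ≫ g) {m : SimplexCategoryᵒᵖ}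
    (x : ((A.unionProd (Λ[1, 0] ⊔ Λ[1, 1]) : (L ⊗ Δ[1]).Subcomplex) : SSet.{w}).obj m)
    (hx : x.1.1 ∈ A.obj m) : (glueEnds A f g h).app m x = f.app m x.1.1 := by
  by_cases h0 : x.1.2 ∈ (Λ[1, 0] : (Δ[1] : SSet.{w}).Subcomplex).obj m
  · exact glueEnds_app_of_mem A f g h x h0
  · rw [glueEnds_app_of_notMem A f g h x h0]
    exact (ConcreteCategory.congr_hom (congr_app h m) ⟨x.1.1, hx⟩).symm

theorem ι₀_mem_horn {X : SSet.{w}} {m : SimplexCategoryᵒᵖ} (x : X.obj m) :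
    ((ι₀ : X ⟶ X ⊗ Δ[1]).app m x).2 ∈ (Λ[1, 0] : (Δ[1] : SSet.{w}).Subcomplex).obj m := by
  rw [mem_horn_one_zero]
  intro k
  rfl

theorem ι₁_mem_horn {X : SSet.{w}} {m : SimplexCategoryᵒᵖ} (x : X.obj m) :
    ((ι₁ : X ⟶ X ⊗ Δ[1]).app m x).2 ∈ (Λ[1, 1] : (Δ[1] : SSet.{w}).Subcomplex).obj m := by
  rw [mem_horn_one_one]
  intro k
  rfl

/-- A fibration is a trivial fibration if its composition with a trivial fibration is one. -/
theorem rlp_monomorphisms_of_comp {Y Z W : SSet.{w}} (p : Y ⟶ Z) (q : Z ⟶ W) [Fibration p]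
    (hq : (MorphismProperty.monomorphisms SSet.{w}).rlp q)
    (hpq : (MorphismProperty.monomorphisms SSet.{w}).rlp (p ≫ q)) :
    (MorphismProperty.monomorphisms SSet.{w}).rlp p := by
  rw [rlp_monomorphisms]
  rintro _ _ _ ⟨n⟩
  refine ⟨fun {a b} sq => ?_⟩
  let A : (Δ[n] : SSet.{w}).Subcomplex := ∂Δ[n]
  have sqw : a ≫ p = A.ι ≫ b := sq.w
  have : HasLiftingProperty A.ι (p ≫ q) := hpq _ (MorphismProperty.monomorphisms.infer_property _)
  -- The lift `l` extends `a`, but `l ≫ p` agrees with `b` only on the boundary and after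
  -- composition with `q`.
  have sq₁ : CommSq a A.ι (p ≫ q) (b ≫ q) := ⟨by rw [← Category.assoc, sqw, Category.assoc]⟩
  set l := sq₁.lift
  have hl : A.ι ≫ l = a := sq₁.fac_left
  have hl' : l ≫ p ≫ q = b ≫ q := sq₁.fac_right
  have hAb : A.ι ≫ (l ≫ p) = A.ι ≫ b := by rw [← Category.assoc, hl, sqw]
  -- Since `q` is a trivial fibration, `l ≫ p` and `b` are joined by a homotopy over `W` that is
  -- constant on the boundary.
  let P : (Δ[n] ⊗ Δ[1] : SSet.{w}).Subcomplex := A.unionProd (Λ[1, 0] ⊔ Λ[1, 1])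
  have : HasLiftingProperty P.ι q := hq _ (MorphismProperty.monomorphisms.infer_property _)
  have sq₂ : CommSq (glueEnds A (l ≫ p) b hAb) P.ι q
      (CartesianMonoidalCategory.fst _ _ ≫ b ≫ q) := ⟨by
    ext m x
    change q.app m ((glueEnds A (l ≫ p) b hAb).app m x) = q.app m (b.app m x.1.1)
    by_cases h0 : x.1.2 ∈ (Λ[1, 0] : (Δ[1] : SSet.{w}).Subcomplex).obj m
    · rw [glueEnds_app_of_mem _ _ _ _ _ h0]
      exact ConcreteCategory.congr_hom (congr_app hl' m) x.1.1
    · rw [glueEnds_app_of_notMem _ _ _ _ _ h0]⟩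
  set h := sq₂.lift
  have hh : P.ι ≫ h = glueEnds A (l ≫ p) b hAb := sq₂.fac_left
  -- This homotopy is lifted through the fibration `p`, starting at `l` and constant on the
  -- boundary. The other end of the lift solves the original problem.
  let Q : (Δ[n] ⊗ Δ[1] : SSet.{w}).Subcomplex := A.unionProd Λ[1, 0]
  have hQ : anodyneExtensions Q.ι := anodyneExtensions_unionProd_ι _ _ (.horn_ι _)
  have : HasLiftingProperty Q.ι p := hQ p (by rwa [← HomotopicalAlgebra.fibration_iff])
  have sq₃ : CommSq (Q.ι ≫ CartesianMonoidalCategory.fst _ _ ≫ l) Q.ι p h := ⟨by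
    ext m ⟨x, hx⟩
    change p.app m (l.app m x.1) = h.app m x
    have hP : x ∈ P.obj m :=
      (Subcomplex.mem_unionProd_iff _ _ _).2
        (((Subcomplex.mem_unionProd_iff _ _ _).1 hx).imp_left Or.inl)
    refine Eq.trans ?_ (ConcreteCategory.congr_hom (congr_app hh m) ⟨x, hP⟩).symm
    rcases (Subcomplex.mem_unionProd_iff _ _ _).1 hx with h1 | h1
    · exact (glueEnds_app_of_mem A (l ≫ p) b hAb ⟨x, hP⟩ h1).symm
    · exact (glueEnds_app_of_mem' A (l ≫ p) b hAb ⟨x, hP⟩ h1).symm⟩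
  refine ⟨⟨⟨ι₁ ≫ sq₃.lift, ?_, ?_⟩⟩⟩
  · refine Eq.trans ?_ hl
    ext m x
    have hQ : (ι₁ : (Δ[n] : SSet.{w}) ⟶ Δ[n] ⊗ Δ[1]).app m x.1 ∈ Q.obj m :=
      (Subcomplex.mem_unionProd_iff _ _ _).2 (Or.inr x.2)
    exact ConcreteCategory.congr_hom (congr_app sq₃.fac_left m) ⟨_, hQ⟩
  · rw [Category.assoc, sq₃.fac_right]
    ext m x
    have hP : (ι₁ : (Δ[n] : SSet.{w}) ⟶ Δ[n] ⊗ Δ[1]).app m x ∈ P.obj m :=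
      (Subcomplex.mem_unionProd_iff _ _ _).2 (Or.inl (Or.inr (ι₁_mem_horn x)))
    refine (ConcreteCategory.congr_hom (congr_app hh m) ⟨_, hP⟩).trans ?_
    exact glueEnds_app_of_notMem A _ _ _ _
      (fun h => not_mem_horn_one_both _ h (ι₁_mem_horn x))

theorem rlp_pre_of_trivialCofibration {A B : SSet.{w}} {j : A ⟶ B} (hj : trivialCofibrations j)
    (X : SSet.{w}) [KanComplex X] :
    (MorphismProperty.monomorphisms SSet.{w}).rlp ((MonoidalClosed.pre j).app X) :=
  fun _ _ i (_ : Mono i) => hasLiftingProperty_pre_swap i j (hj _ ⟨i, X⟩)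

/-- After the swap this is cancellation for trivial fibrations: restriction along `j ≫ k` is
restriction along `k`, a Kan fibration because `k` is a monomorphism, followed by restriction along
`j`. -/
theorem trivialCofibrations_of_precomp {A B C : SSet.{w}} {j : A ⟶ B} {k : B ⟶ C} [Mono k]
    (hj : trivialCofibrations j) (hjk : trivialCofibrations (j ≫ k)) :
    trivialCofibrations k := by
  intro _ _ _ h
  obtain ⟨i, X⟩ := h
  apply hasLiftingProperty_pre_swap
  refine rlp_monomorphisms_of_comp _ _ (rlp_pre_of_trivialCofibration hj X) ?_ i
    (MorphismProperty.monomorphisms.infer_property _)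
  have := rlp_pre_of_trivialCofibration hjk X
  rwa [MonoidalClosed.pre_map, NatTrans.comp_app] at this

end SSet

/-! ### Singular simplicial sets -/

namespace stdSimplex

open Finset

variable {ι : Type*} [Fintype ι] [DecidableEq ι]
set_option linter.unusedSectionVars false

/-- Moving a point of the simplex along the direction from the vertex `i` to the barycenter. -/
def shift (i : ι) (t : ι → ℝ) (c : ℝ) : ι → ℝ :=
  fun j => if j = i then t i - (Fintype.card ι - 1) * c else t j + c

theorem shift_same (i : ι) (t : ι → ℝ) (c : ℝ) :
    shift i t c i = t i - (Fintype.card ι - 1) * c := if_pos rfl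

theorem shift_of_ne {i j : ι} (h : j ≠ i) (t : ι → ℝ) (c : ℝ) : shift i t c j = t j + c :=
  if_neg h

theorem sum_shift (i : ι) (t : ι → ℝ) (c : ℝ) : ∑ j, shift i t c j = ∑ j, t j := by
  rw [← Finset.add_sum_erase _ _ (mem_univ i), ← Finset.add_sum_erase _ t (mem_univ i), shift_same,
    Finset.sum_congr rfl (fun j hj => shift_of_ne (ne_of_mem_erase hj) t c), sum_add_distrib,
    sum_const, card_erase_of_mem (mem_univ i), card_univ, nsmul_eq_mul,
    Nat.cast_pred (Fintype.card_pos_iff.2 ⟨i⟩)]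
  ring

theorem shift_shift (i : ι) (t : ι → ℝ) (c c' : ℝ) :
    shift i (shift i t c) c' = shift i t (c + c') := by
  ext j
  by_cases h : j = i
  · subst h
    simp only [shift_same]
    ring
  · simp only [shift_of_ne h]
    ring

theorem shift_zero (i : ι) (t : ι → ℝ) : shift i t 0 = t := by
  ext j
  by_cases h : j = i
  · subst h
    simp [shift_same]
  · simp [shift_of_ne h]

variable [Nontrivial ι]

theorem erase_nonempty (i : ι) : (univ.erase i).Nonempty :=
  let ⟨j, hj⟩ := exists_ne i
  ⟨j, mem_erase.2 ⟨hj, mem_univ _⟩⟩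

theorem card_sub_one_pos : (0 : ℝ) < Fintype.card ι - 1 :=
  sub_pos.2 (Nat.one_lt_cast.2 Fintype.one_lt_card)

/-- The smallest barycentric coordinate that does not belong to the vertex `i`. -/
noncomputable def minOther (i : ι) (t : stdSimplex ℝ ι) : ℝ :=
  (univ.erase i).inf' (erase_nonempty i) t

theorem minOther_le {i j : ι} (h : j ≠ i) (t : stdSimplex ℝ ι) : minOther i t ≤ t j :=
  inf'_le _ (mem_erase.2 ⟨h, mem_univ _⟩)

theorem minOther_nonneg (i : ι) (t : stdSimplex ℝ ι) : 0 ≤ minOther i t :=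
  le_inf' _ _ fun _ _ => t.2.1 _

theorem exists_minOther_eq (i : ι) (t : stdSimplex ℝ ι) : ∃ j, j ≠ i ∧ minOther i t = t j :=
  let ⟨j, hj, h⟩ := exists_mem_eq_inf' (erase_nonempty i) (t : ι → ℝ)
  ⟨j, ne_of_mem_erase hj, h⟩

theorem continuous_coord (j : ι) : Continuous fun t : stdSimplex ℝ ι => t j :=
  (continuous_apply j).comp continuous_subtype_val

theorem continuous_minOther (i : ι) : Continuous (minOther i) :=
  Continuous.finset_inf'_apply _ fun j _ => continuous_coord j

theorem minOther_eq_zero {i j : ι} (h : j ≠ i) {t : stdSimplex ℝ ι} (ht : t j = 0) :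
    minOther i t = 0 :=
  le_antisymm ((minOther_le h t).trans ht.le) (minOther_nonneg i t)

/-- The retraction of the simplex to the horn with the face opposite to `i` missing. -/
noncomputable def toHorn (i : ι) (t : stdSimplex ℝ ι) : stdSimplex ℝ ι :=
  ⟨shift i t (-minOther i t), fun j => by
    by_cases h : j = i
    · subst h
      rw [shift_same]
      have := mul_nonneg (card_sub_one_pos (ι := ι)).le (minOther_nonneg j t)
      have := t.2.1 j
      change 0 ≤ t.1 j - _
      linarith
    · rw [shift_of_ne h]
      have := minOther_le h t
      linarith, (sum_shift _ _ _).trans t.2.2⟩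

theorem continuous_shift {X : Type*} [TopologicalSpace X] (i : ι) {f : X → ι → ℝ} {c : X → ℝ}
    (hf : Continuous f) (hc : Continuous c) : Continuous fun x => shift i (f x) (c x) := by
  refine continuous_pi fun j => ?_
  have := fun j => (continuous_apply j).comp hf
  by_cases h : j = i
  · subst h
    simp only [shift_same]
    exact (this j).sub (continuous_const.mul hc)
  · simp only [shift_of_ne h]
    exact (this j).add hc

theorem continuous_toHorn (i : ι) : Continuous (toHorn i) :=
  Continuous.subtype_mk
    (continuous_shift i continuous_subtype_val (continuous_minOther i).neg) _

theorem toHorn_eq_zero {i j : ι} (h : j ≠ i) {t : stdSimplex ℝ ι} (ht : minOther i t = t j) :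
    toHorn i t j = 0 :=
  (shift_of_ne h _ _).trans (by rw [ht]; exact add_neg_cancel _)

theorem toHorn_eq_self {i : ι} {t : stdSimplex ℝ ι} (ht : minOther i t = 0) : toHorn i t = t :=
  Subtype.ext (by
    change shift i t (-minOther i t) = t
    rw [ht, neg_zero, shift_zero])

/-- Moving points away from the vertex `i`. -/
noncomputable def fromHorn (i : ι) (x : stdSimplex ℝ ι × unitInterval) : stdSimplex ℝ ι :=
  -- The motion stops when the coordinate `i` becomes zero, where the point would leave the simplex.
  ⟨shift i x.1 (min x.2 (x.1 i / (Fintype.card ι - 1))), fun j => by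
    have hN := card_sub_one_pos (ι := ι)
    have h0 : 0 ≤ x.1 i := x.1.2.1 i
    by_cases h : j = i
    · subst h
      rw [shift_same, sub_nonneg, ← le_div_iff₀' hN]
      exact min_le_right _ _
    · rw [shift_of_ne h]
      exact add_nonneg (x.1.2.1 j) (le_min x.2.2.1 (by positivity)), (sum_shift _ _ _).trans x.1.2.2⟩

theorem continuous_fromHorn (i : ι) : Continuous (fromHorn i) :=
  Continuous.subtype_mk
    (continuous_shift i (continuous_subtype_val.comp continuous_fst)
      ((continuous_subtype_val.comp continuous_snd).min
        (((continuous_coord i).comp continuous_fst).div_const _))) _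

theorem fromHorn_zero (i : ι) (t : stdSimplex ℝ ι) : fromHorn i (t, 0) = t :=
  Subtype.ext (by
    change shift i t (min (0 : ℝ) _) = t
    rw [min_eq_left, shift_zero]
    exact div_nonneg (t.2.1 i) (card_sub_one_pos).le)

/-- Every point is reached from a point of the horn after the time `minOther`. This parametrization
of the simplex by points of the horn and times replaces a homeomorphism between the pairs (simplex,
horn) and (cylinder, bottom). -/
theorem fromHorn_toHorn (i : ι) (t : stdSimplex ℝ ι) :
    fromHorn i (toHorn i t, ⟨minOther i t, minOther_nonneg i t,
      let ⟨j, _, h⟩ := exists_minOther_eq i t; h ▸ le_one t j⟩) = t :=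
  Subtype.ext (by
    change shift i (shift i t (-minOther i t))
      (min (minOther i t) (shift i t (-minOther i t) i / _)) = t
    rw [min_eq_left, shift_shift, neg_add_cancel, shift_zero]
    rw [shift_same, le_div_iff₀' card_sub_one_pos]
    have : 0 ≤ t i := t.2.1 i
    change _ ≤ t i - _
    linarith)

theorem map_apply_eq_self {κ : Type*} [Fintype κ] (e : κ → κ) (t : stdSimplex ℝ κ)
    (h : ∀ j, t j ≠ 0 → e j = j) : map e t = t := by
  classical
  have e1 : ∀ k, map e t k = ∑ l, if e l = k then t l else 0 := fun k => by
    rw [map_coe, FunOnFinite.linearMap_apply_apply, Finset.sum_filter]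
  refine stdSimplex.ext (funext fun k => ?_)
  refine (e1 k).trans ?_
  rw [Finset.sum_eq_single k]
  · split_ifs with h1
    · rfl
    · by_contra h2
      exact h1 (h k (Ne.symm h2))
  · intro l _ hl
    split_ifs with h1
    · by_contra h2
      exact hl ((h l h2).symm.trans h1)
    · rfl
  · simp

theorem map_apply_eq_zero {κ κ' : Type*} [Fintype κ] [Fintype κ'] (e : κ → κ') (t : stdSimplex ℝ κ)
    (k : κ') (h : ∀ j, e j ≠ k) : map e t k = 0 := by
  classical
  rw [map_coe, FunOnFinite.linearMap_apply_apply]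
  exact Finset.sum_eq_zero fun l hl => absurd (Finset.mem_filter.1 hl).2 (h l)

end stdSimplex

/-- A finite linear order retracts to any nonempty part by a monotone map. -/
theorem exists_orderHom_retraction {α : Type*} [Fintype α] [LinearOrder α] (S : Finset α)
    (hS : S.Nonempty) : ∃ e : α →o α, (∀ l, e l ∈ S) ∧ ∀ l ∈ S, e l = l := by
  let T : α → Finset α := fun l => insert (S.min' hS) (S.filter (· ≤ l))
  have hT : ∀ l, (T l).Nonempty := fun l => Finset.insert_nonempty _ _
  have hTS : ∀ l, T l ⊆ S := fun l =>
    Finset.insert_subset (S.min'_mem hS) (Finset.filter_subset _ _)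
  refine ⟨⟨fun l => (T l).max' (hT l), fun a b hab => Finset.max'_subset (hT a)
    (Finset.insert_subset_insert _ (Finset.monotone_filter_right _
      fun x _ hx => le_trans hx hab))⟩,
    fun l => hTS l (Finset.max'_mem _ (hT l)), fun l hl => le_antisymm ?_ ?_⟩
  · refine Finset.max'_le _ (hT l) _ fun x hx => ?_
    rcases Finset.mem_insert.1 hx with rfl | hx
    · exact S.min'_le _ hl
    · exact (Finset.mem_filter.1 hx).2
  · exact Finset.le_max' (T l) _ (Finset.mem_insert_of_mem (Finset.mem_filter.2 ⟨hl, le_rfl⟩))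

namespace TopCat

open Simplicial HomotopicalAlgebra Opposite SSet modelCategoryQuillen

universe w

theorem toSSetObjEquiv_map (X : TopCat.{w}) {n m : SimplexCategoryᵒᵖ} (φ : n ⟶ m)
    (x : (toSSet.obj X).obj n) (t : _root_.stdSimplex ℝ (Fin (m.unop.len + 1))) :
    toSSetObjEquiv X m ((toSSet.obj X).map φ x) t =
      toSSetObjEquiv X n x (_root_.stdSimplex.map φ.unop.toOrderHom t) := rfl

theorem toSSetObjEquiv_app {X Y : TopCat.{w}} (p : X ⟶ Y) {n : SimplexCategoryᵒᵖ}
    (x : (toSSet.obj X).obj n) (t : _root_.stdSimplex ℝ (Fin (n.unop.len + 1))) :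
    toSSetObjEquiv Y n ((toSSet.map p).app n x) t = p (toSSetObjEquiv X n x t) := rfl

theorem mem_horn_iff_exists {n : ℕ} {i : Fin (n + 1)} {m : SimplexCategoryᵒᵖ}
    (x : (Δ[n] : SSet.{w}).obj m) : x ∈ (Λ[n, i] : (Δ[n] : SSet.{w}).Subcomplex).obj m ↔
      ∃ j, j ≠ i ∧ ∀ l, stdSimplex.asOrderHom x l ≠ j := by
  rw [mem_horn_iff, Ne, Set.eq_univ_iff_forall]
  push Not
  refine exists_congr fun j => ?_
  simp

/-- Evaluating a map from a horn to a singular simplicial set at a point of the simplex -/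
noncomputable def hornEval {Y : TopCat.{w}} {n : ℕ} {i : Fin (n + 2)}
    (φ : ((Λ[n + 1, i] : (Δ[n + 1] : SSet.{w}).Subcomplex) : SSet.{w}) ⟶ toSSet.obj Y)
    {m : SimplexCategoryᵒᵖ} (e : Fin (m.unop.len + 1) →o Fin (n + 2))
    (he : ∃ j, j ≠ i ∧ ∀ l, e l ≠ j) : C(_root_.stdSimplex ℝ (Fin (m.unop.len + 1)), Y) :=
  toSSetObjEquiv Y m (φ.app m ⟨stdSimplex.objMk e, (mem_horn_iff_exists _).2 he⟩)

theorem hornEval_comp {Y : TopCat.{w}} {n : ℕ} {i : Fin (n + 2)}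
    (φ : ((Λ[n + 1, i] : (Δ[n + 1] : SSet.{w}).Subcomplex) : SSet.{w}) ⟶ toSSet.obj Y)
    {m m' : SimplexCategoryᵒᵖ} (e : Fin (m.unop.len + 1) →o Fin (n + 2))
    (he : ∃ j, j ≠ i ∧ ∀ l, e l ≠ j) (f : Fin (m'.unop.len + 1) →o Fin (m.unop.len + 1))
    (e' : Fin (m'.unop.len + 1) →o Fin (n + 2)) (h : ∀ l, e' l = e (f l))
    (he' : ∃ j, j ≠ i ∧ ∀ l, e' l ≠ j) (t : _root_.stdSimplex ℝ (Fin (m'.unop.len + 1))) :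
    hornEval φ e' he' t = hornEval φ e he (_root_.stdSimplex.map f t) := by
  obtain rfl : e' = e.comp f := OrderHom.ext _ _ (funext h)
  let x : ((Λ[n + 1, i] : (Δ[n + 1] : SSet.{w}).Subcomplex) : SSet.{w}).obj m :=
    ⟨stdSimplex.objMk e, (mem_horn_iff_exists _).2 he⟩
  have nat := ConcreteCategory.congr_hom (φ.naturality (SimplexCategory.mkHom f).op) x
  have e1 : hornEval φ (e.comp f) he' t =
      toSSetObjEquiv Y m' ((toSSet.obj Y).map (SimplexCategory.mkHom f).op (φ.app m x)) t :=
    DFunLike.congr_fun (congrArg (toSSetObjEquiv Y m') nat) t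
  rw [e1]
  exact toSSetObjEquiv_map Y (SimplexCategory.mkHom f).op (φ.app m x) t

/-- `G` is `φ` composed with the retraction `toHorn`. Where the smallest coordinate is the one of
`j`, the retraction lands in the face opposite to `j`; there `φ` is evaluated through a monotone
retraction `e` of the vertices that avoids `j`. -/
theorem exists_extension_of_horn {Y : TopCat.{w}} {n : ℕ} {i : Fin (n + 2)}
    (φ : ((Λ[n + 1, i] : (Δ[n + 1] : SSet.{w}).Subcomplex) : SSet.{w}) ⟶ toSSet.obj Y) :
    ∃ G : C(_root_.stdSimplex ℝ (Fin (n + 2)), Y),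
      ∀ t j, j ≠ i → stdSimplex.minOther i t = t j →
        ∃ (e : Fin (n + 2) →o Fin (n + 2)) (he : ∃ j, j ≠ i ∧ ∀ l, e l ≠ j),
        (∀ l, l ≠ j → e l = l) ∧
        _root_.stdSimplex.map e (stdSimplex.toHorn i t) = stdSimplex.toHorn i t ∧
        G t = hornEval φ (m := op ⦋n + 1⦌) e he (stdSimplex.toHorn i t) := by
  have key : ∀ S : Finset (Fin (n + 2)), i ∉ S → ∃ e : Fin (n + 2) →o Fin (n + 2),
      (∀ l, e l ∉ S) ∧ ∀ l, l ∉ S → e l = l := fun S hS => by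
    obtain ⟨e, h1, h2⟩ := exists_orderHom_retraction Sᶜ ⟨i, by simpa using hS⟩
    exact ⟨e, fun l => Finset.mem_compl.1 (h1 l), fun l hl => h2 l (Finset.mem_compl.2 hl)⟩
  have key1 : ∀ j : {j // j ≠ i}, ∃ e : Fin (n + 2) →o Fin (n + 2),
      (∀ l, e l ≠ j.1) ∧ ∀ l, l ≠ j.1 → e l = l := fun j => by
    obtain ⟨e, h1, h2⟩ := key {j.1} (by simpa using j.2.symm)
    exact ⟨e, fun l => by simpa using h1 l, fun l hl => h2 l (by simpa using hl)⟩
  choose e he1 he2 using key1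
  have he : ∀ j, ∃ k, k ≠ i ∧ ∀ l, e j l ≠ k := fun j => ⟨j, j.2, he1 j⟩
  -- On the intersection of two faces both values agree with the evaluation through a retraction
  -- that avoids both vertices.
  have hcompat : ∀ (j k) (t : _root_.stdSimplex ℝ (Fin (n + 2))), t j.1 = 0 → t k.1 = 0 →
      hornEval φ (m := op ⦋n + 1⦌) (e j) (he j) t =
        hornEval φ (m := op ⦋n + 1⦌) (e k) (he k) t := by
    intro j k t hj hk
    obtain ⟨f, hf1, hf2⟩ := key {j.1, k.1} (by simpa using ⟨j.2.symm, k.2.symm⟩)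
    have hf1 : ∀ l, f l ≠ j.1 ∧ f l ≠ k.1 := fun l => by simpa using hf1 l
    have ht : _root_.stdSimplex.map f t = t := by
      refine stdSimplex.map_apply_eq_self _ _ fun l hl => hf2 l ?_
      have h1 : l ≠ j.1 := fun h => hl (h ▸ hj)
      have h2 : l ≠ k.1 := fun h => hl (h ▸ hk)
      simpa using ⟨h1, h2⟩
    have e1 := hornEval_comp φ (m := op ⦋n + 1⦌) (m' := op ⦋n + 1⦌) (e j) (he j) f f
      (fun l => (he2 j _ (hf1 l).1).symm) ⟨j.1, j.2, fun l => (hf1 l).1⟩ t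
    have e2 := hornEval_comp φ (m := op ⦋n + 1⦌) (m' := op ⦋n + 1⦌) (e k) (he k) f f
      (fun l => (he2 k _ (hf1 l).2).symm) ⟨j.1, j.2, fun l => (hf1 l).1⟩ t
    rw [ht] at e1 e2
    exact e1.symm.trans e2
  choose j hj using fun t : _root_.stdSimplex ℝ (Fin (n + 2)) => stdSimplex.exists_minOther_eq i t
  let G : _root_.stdSimplex ℝ (Fin (n + 2)) → Y := fun t =>
    hornEval φ (m := op ⦋n + 1⦌) (e ⟨j t, (hj t).1⟩) (he _) (stdSimplex.toHorn i t)
  have hG : Continuous G := by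
    refine (locallyFinite_of_finite fun k : {k // k ≠ i} =>
      Set.ofPred fun t => stdSimplex.minOther i t = t k.1).continuous
      ?_ ?_ ?_
    · exact Set.eq_univ_of_forall fun t => Set.mem_iUnion.2 ⟨⟨j t, (hj t).1⟩, (hj t).2⟩
    · exact fun k => isClosed_eq (stdSimplex.continuous_minOther i) (stdSimplex.continuous_coord _)
    · intro k
      refine (((hornEval φ (m := op ⦋n + 1⦌) (e k) (he k)).continuous.comp
        (stdSimplex.continuous_toHorn i)).continuousOn).congr fun t ht => ?_
      exact hcompat _ _ _ (stdSimplex.toHorn_eq_zero (hj t).1 (hj t).2)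
        (stdSimplex.toHorn_eq_zero k.2 ht)
  refine ⟨⟨G, hG⟩, fun t k hk hk' => ⟨e ⟨k, hk⟩, he _, he2 ⟨k, hk⟩, ?_,
    hcompat _ _ _ (stdSimplex.toHorn_eq_zero (hj t).1 (hj t).2)
      (stdSimplex.toHorn_eq_zero hk hk')⟩⟩
  refine stdSimplex.map_apply_eq_self _ _ fun l hl => he2 _ _ ?_
  rintro rfl
  exact hl (stdSimplex.toHorn_eq_zero hk hk')

/-- Maps with the homotopy lifting property for simplices induce Kan fibrations. -/
theorem fibration_toSSet_map {Y B : TopCat.{w}} (p : Y ⟶ B)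
    (hp : ∀ (n : ℕ) (G₀ : C(_root_.stdSimplex ℝ (Fin (n + 1)), Y))
      (H : C(_root_.stdSimplex ℝ (Fin (n + 1)) × unitInterval, B)), (∀ t, p (G₀ t) = H (t, 0)) →
      ∃ G : C(_root_.stdSimplex ℝ (Fin (n + 1)) × unitInterval, Y),
        (∀ t, G (t, 0) = G₀ t) ∧ ∀ x, p (G x) = H x) :
    Fibration (toSSet.map p) := by
  suffices ∀ (n : ℕ) (i : Fin (n + 2)),
      HasLiftingProperty (Λ[n + 1, i] : (Δ[n + 1] : SSet.{w}).Subcomplex).ι (toSSet.map p) by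
    rw [fibration_iff]
    intro _ _ _ hJ
    simp only [J, MorphismProperty.iSup_iff] at hJ
    obtain ⟨n, ⟨i⟩⟩ := hJ
    exact this n i
  intro n i
  refine ⟨fun {φ β} sq => ?_⟩
  obtain ⟨G₀, hG₀⟩ := exists_extension_of_horn φ
  let h : C(_root_.stdSimplex ℝ (Fin (n + 2)), B) :=
    toSSetObjEquiv B (op ⦋n + 1⦌) (yonedaEquiv β)
  have hφ : ∀ {m : SimplexCategoryᵒᵖ} (e : Fin (m.unop.len + 1) →o Fin (n + 2))
      (he : ∃ j, j ≠ i ∧ ∀ l, e l ≠ j) t, p (hornEval φ e he t) = h (_root_.stdSimplex.map e t) := by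
    intro m e he t
    let x : ((Λ[n + 1, i] : (Δ[n + 1] : SSet.{w}).Subcomplex) : SSet.{w}).obj m :=
      ⟨stdSimplex.objMk e, (mem_horn_iff_exists _).2 he⟩
    have e1 : (toSSet.map p).app m (φ.app m x) = β.app m x.1 :=
      ConcreteCategory.congr_hom (congr_app sq.w m) x
    have e2 : β.app m x.1 = (toSSet.obj B).map (SimplexCategory.mkHom e).op (yonedaEquiv β) :=
      ConcreteCategory.congr_hom (β.naturality (SimplexCategory.mkHom e).op)
        (stdSimplex.objEquiv.symm (𝟙 _))
    change p (toSSetObjEquiv Y m (φ.app m x) t) = _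
    rw [← toSSetObjEquiv_app, e1, e2, toSSetObjEquiv_map]
    rfl
  have hpG : ∀ t, p (G₀ t) = h (stdSimplex.fromHorn i (stdSimplex.toHorn i t, 0)) := by
    intro t
    obtain ⟨j, hj, hj'⟩ := stdSimplex.exists_minOther_eq i t
    obtain ⟨e, he, -, h1, h2⟩ := hG₀ t j hj hj'
    rw [h2, hφ, h1, stdSimplex.fromHorn_zero]
  -- The homotopy moves the retracted point back along its ray. Restricting its lift to the graph of
  -- the time `minOther` gives the filler of the horn.
  obtain ⟨G, hG, hG'⟩ := hp (n + 1) G₀ (h.comp ⟨_, (stdSimplex.continuous_fromHorn i).comp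
    (((stdSimplex.continuous_toHorn i).comp continuous_fst).prodMk continuous_snd)⟩) hpG
  let μ : _root_.stdSimplex ℝ (Fin (n + 2)) → unitInterval := fun t =>
    ⟨stdSimplex.minOther i t, stdSimplex.minOther_nonneg i t,
      let ⟨j, _, h⟩ := stdSimplex.exists_minOther_eq i t; h ▸ stdSimplex.le_one t j⟩
  have hμ : Continuous μ := (stdSimplex.continuous_minOther i).subtype_mk _
  let k : C(_root_.stdSimplex ℝ (Fin (n + 2)), Y) :=
    G.comp ⟨fun t => (t, μ t), continuous_id.prodMk hμ⟩
  let k' : (toSSet.obj Y).obj (op ⦋n + 1⦌) := (toSSetObjEquiv Y (op ⦋n + 1⦌)).symm k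
  have hk' : toSSetObjEquiv Y (op ⦋n + 1⦌) k' = k := Equiv.apply_symm_apply _ _
  refine ⟨⟨⟨yonedaEquiv.symm k', ?_, ?_⟩⟩⟩
  · ext m ⟨x, hx⟩
    refine (toSSetObjEquiv Y m).injective (ContinuousMap.ext fun t => ?_)
    refine (toSSetObjEquiv_map Y (n := op ⦋n + 1⦌) (stdSimplex.objEquiv x).op k' t).trans ?_
    rw [hk']
    have hx' := (mem_horn_iff_exists _).1 hx
    obtain ⟨j, hj, hj'⟩ := id hx'
    set s := _root_.stdSimplex.map (stdSimplex.objEquiv x).op.unop.toOrderHom t with hs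
    have hsj : s j = 0 := stdSimplex.map_apply_eq_zero _ _ _ hj'
    have hs0 : stdSimplex.minOther i s = 0 := stdSimplex.minOther_eq_zero hj hsj
    have e1 : k s = G₀ s := by
      rw [← hG]
      exact congrArg (fun z => G (s, z)) (Subtype.ext hs0)
    obtain ⟨e, he, h0, h1, h2⟩ := hG₀ s j hj (hs0.trans hsj.symm)
    rw [stdSimplex.toHorn_eq_self hs0] at h1 h2
    rw [e1, h2]
    exact (hornEval_comp φ (m := op ⦋n + 1⦌) e he (stdSimplex.asOrderHom x)
      (stdSimplex.asOrderHom x) (fun l => (h0 _ (hj' l)).symm) hx' t).symm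
  · refine yonedaEquiv.injective ?_
    refine (toSSetObjEquiv B (op ⦋n + 1⦌)).injective (ContinuousMap.ext fun t => ?_)
    change toSSetObjEquiv B (op ⦋n + 1⦌) ((toSSet.map p).app _
      ((toSSet.obj Y).map (𝟙 _) k')) t = h t
    rw [toSSetObjEquiv_app, CategoryTheory.Functor.map_id]
    change p (toSSetObjEquiv Y (op ⦋n + 1⦌) k' t) = h t
    rw [hk']
    exact (hG' _).trans (congrArg h (stdSimplex.fromHorn_toHorn i t))

end TopCat

/-! ### Homotopies between maps of realizations -/

namespace TopCat

open Simplicial HomotopicalAlgebra Opposite SSet MonoidalCategory modelCategoryQuillen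
open scoped unitInterval

universe w

instance kanComplex_toSSet (Z : TopCat.{w}) : KanComplex (toSSet.obj Z) := by
  have h := (TopCat.isTerminalPUnit.{w}).isTerminalObj toSSet
  refine (isFibrant_iff_of_isTerminal (toSSet.map (TopCat.isTerminalPUnit.{w}.from Z)) h).2 ?_
  exact fibration_toSSet_map _ fun n G₀ H _ =>
    ⟨G₀.comp ⟨Prod.fst, continuous_fst⟩, fun _ => rfl, fun _ => rfl⟩

/-- The two end points of a path. -/
def pathEnds (Z : TopCat.{w}) : TopCat.of C(I, Z) ⟶ TopCat.of (Z × Z) :=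
  TopCat.ofHom ⟨fun γ => (γ 0, γ 1), (continuous_eval_const 0).prodMk (continuous_eval_const 1)⟩

/-- Extending a path at both ends by given paths. -/
theorem exists_extended_path {X Z : Type*} [TopologicalSpace X] [TopologicalSpace Z]
    (γ : C(X, C(I, Z))) (H₀ H₁ : C(X × I, Z)) (h₀ : ∀ x, γ x 0 = H₀ (x, 0))
    (h₁ : ∀ x, γ x 1 = H₁ (x, 0)) :
    ∃ G : C(X × I, C(I, Z)), (∀ x, G (x, 0) = γ x) ∧ ∀ z, G z 0 = H₀ z ∧ G z 1 = H₁ z := by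
  let i : ℝ → I := Set.projIcc 0 1 zero_le_one
  have hi : Continuous i := continuous_projIcc
  have hi0 : i 0 = 0 := Set.projIcc_left _
  have hi1 : i 1 = 1 := Set.projIcc_right _
  -- At time `τ` the path runs through `H₀` backwards on `[0, τ/4]`, through a rescaled `γ`, and
  -- through `H₁` on `[1 - τ/4, 1]`. The quarters leave at least half of the interval to `γ`, so the
  -- denominator `1 - τ/2` does not vanish.
  let F : (X × I) × I → Z := fun z =>
    if (z.2 : ℝ) ≤ (z.1.2 : ℝ) / 4 then H₀ (z.1.1, i (z.1.2 - 4 * z.2)) else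
    if 1 - (z.1.2 : ℝ) / 4 ≤ z.2 then H₁ (z.1.1, i (z.1.2 - 4 * (1 - z.2))) else
    γ z.1.1 (i ((z.2 - z.1.2 / 4) / (1 - z.1.2 / 2)))
  have hx : Continuous fun z : (X × I) × I => z.1.1 := by fun_prop
  have hτ : Continuous fun z : (X × I) × I => (z.1.2 : ℝ) := by fun_prop
  have hu : Continuous fun z : (X × I) × I => (z.2 : ℝ) := by fun_prop
  have hF : Continuous F := by
    refine Continuous.if_le ?_ (Continuous.if_le ?_ ?_ ?_ ?_ ?_) ?_ ?_ ?_
    · exact H₀.continuous.comp (hx.prodMk (hi.comp (by fun_prop)))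
    · exact H₁.continuous.comp (hx.prodMk (hi.comp (by fun_prop)))
    · refine (ContinuousMap.continuous_uncurry_of_continuous γ).comp
        (hx.prodMk (hi.comp (Continuous.div (by fun_prop) (by fun_prop) fun z => ?_)))
      have := z.1.2.2.2
      linarith
    · fun_prop
    · fun_prop
    · rintro ⟨⟨x, τ⟩, u⟩ (h : 1 - (τ : ℝ) / 4 = u)
      have : (1 : ℝ) - τ / 2 ≠ 0 := by have := τ.2.2; linarith
      change H₁ (x, i (τ - 4 * (1 - u))) = γ x (i ((u - τ / 4) / (1 - τ / 2)))
      rw [← h, show (τ : ℝ) - 4 * (1 - (1 - τ / 4)) = 0 by ring,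
        show ((1 : ℝ) - τ / 4 - τ / 4) / (1 - τ / 2) = 1 by rw [div_eq_one_iff_eq this]; ring, hi0, hi1, h₁]
    · fun_prop
    · fun_prop
    · rintro ⟨⟨x, τ⟩, u⟩ (h : (u : ℝ) = τ / 4)
      have h3 : ¬ 1 - (τ : ℝ) / 4 ≤ u := by have := τ.2.2; rw [h]; linarith
      refine Eq.trans ?_ (if_neg h3).symm
      change H₀ (x, i (τ - 4 * u)) = γ x (i ((u - τ / 4) / (1 - τ / 2)))
      rw [h, show (τ : ℝ) - 4 * (τ / 4) = 0 by ring, sub_self, zero_div, hi0, h₀]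
  refine ⟨ContinuousMap.curry ⟨F, hF⟩, fun x => ContinuousMap.ext fun u => ?_, fun z => ⟨?_, ?_⟩⟩
  · change F ((x, 0), u) = γ x u
    have e0 : ((0 : I) : ℝ) = 0 := rfl
    by_cases hu0 : (u : ℝ) ≤ 0
    · have : u = 0 := Subtype.ext (le_antisymm hu0 u.2.1)
      subst this
      simp only [F, e0, zero_div, le_refl, if_true, mul_zero, sub_zero, hi0]
      exact (h₀ x).symm
    · by_cases hu1 : 1 ≤ (u : ℝ)
      · have : u = 1 := Subtype.ext (le_antisymm u.2.2 hu1)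
        subst this
        have e1 : ((1 : I) : ℝ) = 1 := rfl
        simp only [F, e0, e1, zero_div, sub_zero, sub_self, mul_zero, hi0, le_refl, if_true]
        rw [if_neg (by norm_num)]
        exact (h₁ x).symm
      · simp only [F, e0, zero_div, sub_zero, div_one, if_neg hu0, if_neg hu1]
        exact congrArg (γ x) (Set.projIcc_val zero_le_one u)
  · change F (z, 0) = _
    have : ((0 : I) : ℝ) ≤ (z.2 : ℝ) / 4 := by have := z.2.2.1; simp; linarith
    refine (if_pos this).trans ?_
    have e : (z.2 : ℝ) - 4 * ((0 : I) : ℝ) = z.2 := by simp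
    rw [e]
    exact congrArg (fun t => H₀ (z.1, t)) (Set.projIcc_val zero_le_one z.2)
  · change F (z, 1) = _
    have : ¬ ((1 : I) : ℝ) ≤ (z.2 : ℝ) / 4 := by have := z.2.2.2; simp; linarith
    have h' : 1 - (z.2 : ℝ) / 4 ≤ ((1 : I) : ℝ) := by have := z.2.2.1; simp; linarith
    refine (if_neg this).trans ((if_pos h').trans ?_)
    have e : (z.2 : ℝ) - 4 * (1 - ((1 : I) : ℝ)) = z.2 := by simp
    rw [e]
    exact congrArg (fun t => H₁ (z.1, t)) (Set.projIcc_val zero_le_one z.2)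

instance fibration_pathEnds (Z : TopCat.{w}) : Fibration (toSSet.map (pathEnds Z)) := by
  refine fibration_toSSet_map _ fun n γ H h => ?_
  obtain ⟨G, hG, hG'⟩ := exists_extended_path γ ((⟨Prod.fst, continuous_fst⟩ : C(Z × Z, Z)).comp H)
    ((⟨Prod.snd, continuous_snd⟩ : C(Z × Z, Z)).comp H) (fun x => congrArg Prod.fst (h x))
    (fun x => congrArg Prod.snd (h x))
  exact ⟨G, hG, fun z => Prod.ext (hG' z).1 (hG' z).2⟩

/-- The map to a product of spaces with given components. -/
def pair {X Y Z : TopCat.{w}} (f : X ⟶ Y) (g : X ⟶ Z) : X ⟶ TopCat.of (Y × Z) :=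
  TopCat.ofHom (f.hom.prodMk g.hom)

/-- Simplicially homotopic maps to a singular simplicial set are homotopic. -/
theorem homotopic_of_cylinder {A : SSet.{w}} {Z : TopCat.{w}} (f g : SSet.toTop.obj A ⟶ Z)
    (h : A ⊗ Δ[1] ⟶ toSSet.obj Z) (h₀ : SSet.ι₀ ≫ h = sSetTopAdj.homEquiv _ _ f)
    (h₁ : SSet.ι₁ ≫ h = sSetTopAdj.homEquiv _ _ g) : f.hom.Homotopic g.hom := by
  let pr : A ⊗ Δ[1] ⟶ A := CartesianMonoidalCategory.fst _ _
  let b : A ⊗ Δ[1] ⟶ toSSet.obj (TopCat.of (Z × Z)) := sSetTopAdj.homEquiv _ _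
    (pair (SSet.toTop.map pr ≫ f) ((sSetTopAdj.homEquiv _ _).symm h))
  have hb : ∀ (s : A ⟶ A ⊗ Δ[1]) (k : SSet.toTop.obj A ⟶ Z), s ≫ pr = 𝟙 A →
      s ≫ h = sSetTopAdj.homEquiv _ _ k → s ≫ b = sSetTopAdj.homEquiv _ _ (pair f k) := by
    intro s k hs hk
    rw [← Adjunction.homEquiv_naturality_left]
    congr 1
    have e1 : SSet.toTop.map s ≫ SSet.toTop.map pr ≫ f = f := by
      rw [← Functor.map_comp_assoc, hs, CategoryTheory.Functor.map_id, Category.id_comp]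
    have e2 : SSet.toTop.map s ≫ (sSetTopAdj.homEquiv _ _).symm h = k := by
      rw [← Adjunction.homEquiv_naturality_left_symm, hk, Equiv.symm_apply_apply]
    refine TopCat.hom_ext (ContinuousMap.ext fun x => ?_)
    have h1 := ConcreteCategory.congr_hom e1 x
    have h2 := ConcreteCategory.congr_hom e2 x
    exact Prod.ext (by exact h1) (by exact h2)
  -- The map `b`, with components `f` and `h`, is lifted to the path space, starting with constant
  -- paths. At the other end the lift is adjoint to a map from the realization of `A` to `C(I, Z)`,
  -- which is the homotopy. The realization of `A ⊗ Δ[1]` need not be compared with a product with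
  -- the interval.
  let c : SSet.toTop.obj A ⟶ TopCat.of C(I, Z) := f ≫ TopCat.ofHom ContinuousMap.const'
  let Q : (A ⊗ Δ[1]).Subcomplex := (⊥ : A.Subcomplex).unionProd Λ[1, 0]
  have hQ : anodyneExtensions Q.ι := anodyneExtensions_unionProd_ι _ _ (.horn_ι _)
  have : HasLiftingProperty Q.ι (toSSet.map (pathEnds Z)) :=
    hQ _ (by rw [← HomotopicalAlgebra.fibration_iff]; infer_instance)
  have hsq : sSetTopAdj.homEquiv _ _ c ≫ toSSet.map (pathEnds Z) = SSet.ι₀ ≫ b := by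
    rw [hb _ f rfl h₀, ← Adjunction.homEquiv_naturality_right]
    rfl
  have sq : CommSq (Q.ι ≫ pr ≫ sSetTopAdj.homEquiv _ _ c) Q.ι (toSSet.map (pathEnds Z)) b := ⟨by
    rw [Category.assoc, Category.assoc, hsq]
    ext m ⟨x, hx⟩
    have hx' : x.2 ∈ (Λ[1, 0] : (Δ[1] : SSet.{w}).Subcomplex).obj m :=
      ((Subcomplex.mem_unionProd_iff _ _ _).1 hx).resolve_right id
    refine congrArg (b.app m) (Prod.ext rfl ?_)
    have : ∀ k, SSet.stdSimplex.asOrderHom x.2 k = 0 := (mem_horn_one_zero x.2).1 hx'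
    refine SSet.stdSimplex.objEquiv.injective (SimplexCategory.Hom.ext _ _ (OrderHom.ext _ _ ?_))
    exact funext fun k => (this k).symm⟩
  let k := (sSetTopAdj.homEquiv _ _).symm (SSet.ι₁ ≫ sq.lift)
  have hk : k ≫ pathEnds Z = pair f g := by
    refine (sSetTopAdj.homEquiv _ _).injective ?_
    rw [Adjunction.homEquiv_naturality_right, Equiv.apply_symm_apply, Category.assoc, sq.fac_right]
    exact hb _ g rfl h₁
  exact ⟨{
    toFun := fun x => k x.2 x.1
    continuous_toFun := by
      exact (ContinuousMap.continuous_uncurry_of_continuous k.hom).comp continuous_swap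
    map_zero_left := fun x => congrArg Prod.fst (ConcreteCategory.congr_hom hk x)
    map_one_left := fun x => congrArg Prod.snd (ConcreteCategory.congr_hom hk x) }⟩

end TopCat

namespace SSet

open Simplicial MonoidalCategory Limits

universe w

theorem homotopic_toTop_map {A B : SSet.{w}} (f g : A ⟶ B) (h : A ⊗ Δ[1] ⟶ B)
    (h₀ : ι₀ ≫ h = f) (h₁ : ι₁ ≫ h = g) :
    (toTop.map f).hom.Homotopic (toTop.map g).hom := by
  refine TopCat.homotopic_of_cylinder _ _ (h ≫ sSetTopAdj.unit.app B) ?_ ?_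
  · rw [← Category.assoc, h₀, Adjunction.homEquiv_unit]
    exact sSetTopAdj.unit.naturality f
  · rw [← Category.assoc, h₁, Adjunction.homEquiv_unit]
    exact sSetTopAdj.unit.naturality g

/-- Trivial cofibrations have the homotopy extension property with respect to Kan complexes. -/
theorem exists_extension_of_trivialCofibration {A B K L X : SSet.{w}} [KanComplex X] {j : A ⟶ B}
    (hj : trivialCofibrations j) (i : K ⟶ L) [Mono i] (p : L ⊗ A ⟶ X) (q : K ⊗ B ⟶ X)
    (h : i ▷ A ≫ p = K ◁ j ≫ q) : ∃ r : L ⊗ B ⟶ X, L ◁ j ≫ r = p ∧ i ▷ B ≫ r = q := by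
  let sq := Functor.PushoutObjObj.ofHasPushout (curriedTensor SSet.{w}) i j
  have : HasLiftingProperty sq.ι (terminal.from X) :=
    (MonoidalClosed.internalHomAdjunction₂.hasLiftingProperty_iff sq
      (Functor.PullbackObjObj.ofIsTerminal MonoidalClosed.internalHom i (terminal.from X)
        terminalIsTerminal)).2 (hj _ ⟨i, X⟩)
  have cs : CommSq (sq.isPushout.desc p q h) sq.ι (terminal.from X) (terminal.from _) :=
    ⟨terminal.hom_ext _ _⟩
  refine ⟨cs.lift, ?_, ?_⟩
  · have := sq.inl ≫= cs.fac_left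
    rw [sq.isPushout.inl_desc, Functor.PushoutObjObj.inl_ι_assoc] at this
    exact this
  · have := sq.inr ≫= cs.fac_left
    rw [sq.isPushout.inr_desc, Functor.PushoutObjObj.inr_ι_assoc] at this
    exact this

theorem exists_extension_of_trivialCofibration' {A B X : SSet.{w}} [KanComplex X] {j : A ⟶ B}
    (hj : trivialCofibrations j) (f : A ⟶ X) : ∃ f' : B ⟶ X, j ≫ f' = f := by
  let q : ((⊥ : (𝟙_ SSet.{w}).Subcomplex) : SSet.{w}) ⊗ B ⟶ X :=
    { app := fun _ => ↾fun x => x.1.2.elim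
      naturality := fun _ _ _ => by
        ext x
        exact x.1.2.elim }
  obtain ⟨r, hr, -⟩ := exists_extension_of_trivialCofibration hj
    (⊥ : (𝟙_ SSet.{w}).Subcomplex).ι ((λ_ A).hom ≫ f) q (by
      ext m x
      exact x.1.2.elim)
  exact ⟨(λ_ B).inv ≫ r, by rw [leftUnitor_inv_naturality_assoc, hr, Iso.inv_hom_id_assoc]⟩

/-- The homotopy is prescribed at both ends of `Δ[1]`, by `f` and `g`, and on `A`, where it is
constant; the homotopy extension property fills in the rest. -/
theorem exists_homotopy_of_trivialCofibration {A B X : SSet.{w}} [KanComplex X] {j : A ⟶ B}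
    (hj : trivialCofibrations j) (f g : B ⟶ X) (h : j ≫ f = j ≫ g) :
    ∃ k : B ⊗ Δ[1] ⟶ X, ι₀ ≫ k = f ∧ ι₁ ≫ k = g := by
  let T : (Δ[1] : SSet.{w}).Subcomplex := Λ[1, 0] ⊔ Λ[1, 1]
  let q : (T : SSet.{w}) ⊗ B ⟶ X := (β_ _ _).hom ≫ Subcomplex.unionProd.ι₁ ⊥ T ≫
    glueEnds ⊥ f g (by ext m x; exact x.2.elim)
  have h0 : ∀ {m} (x : B.obj m) (t : (T : SSet.{w}).obj m)
      (ht : t.1 ∈ (Λ[1, 0] : (Δ[1] : SSet.{w}).Subcomplex).obj m),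
      q.app m (t, x) = f.app m x := fun x t ht => if_pos ht
  have h1 : ∀ {m} (x : B.obj m) (t : (T : SSet.{w}).obj m)
      (ht : t.1 ∉ (Λ[1, 0] : (Δ[1] : SSet.{w}).Subcomplex).obj m),
      q.app m (t, x) = g.app m x := fun x t ht => if_neg ht
  obtain ⟨r, -, hr⟩ := exists_extension_of_trivialCofibration hj T.ι
    (CartesianMonoidalCategory.snd _ _ ≫ j ≫ f) q (by
      ext m ⟨t, a⟩
      by_cases ht : t.1 ∈ (Λ[1, 0] : (Δ[1] : SSet.{w}).Subcomplex).obj m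
      · exact (h0 (j.app m a) t ht).symm
      · exact (ConcreteCategory.congr_hom (congr_app h m) a).trans (h1 (j.app m a) t ht).symm)
  refine ⟨(β_ _ _).hom ≫ r, ?_, ?_⟩
  · ext m x
    have ht := ι₀_mem_horn x
    exact (ConcreteCategory.congr_hom (congr_app hr m)
      ((⟨_, Or.inl ht⟩, x) : ((T : SSet.{w}) ⊗ B).obj m)).trans (h0 x _ ht)
  · ext m x
    have ht := ι₁_mem_horn x
    exact (ConcreteCategory.congr_hom (congr_app hr m)
      ((⟨_, Or.inr ht⟩, x) : ((T : SSet.{w}) ⊗ B).obj m)).trans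
      (h1 x _ fun h => not_mem_horn_one_both _ h ht)

/-- The realization of a trivial cofibration is a homotopy equivalence. -/
theorem exists_homotopyEquiv_of_trivialCofibration {A B : SSet.{w}} {j : A ⟶ B}
    (hj : trivialCofibrations j) :
    ∃ h : ContinuousMap.HomotopyEquiv (toTop.obj A) (toTop.obj B),
      h.toFun = (toTop.map j).hom := by
  -- The unit from `A` to the singular simplicial set of its realization extends to `B`; the adjoint
  -- `ρ` of the extension is a strict retraction. The composition the other way agrees with the
  -- identity on `A`, hence is homotopic to it.
  obtain ⟨r, hr⟩ := exists_extension_of_trivialCofibration' hj (sSetTopAdj.homEquiv _ _ (𝟙 _))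
  let ρ := (sSetTopAdj.homEquiv _ _).symm r
  have hρ : toTop.map j ≫ ρ = 𝟙 _ := by
    refine (sSetTopAdj.homEquiv _ _).injective ?_
    rw [Adjunction.homEquiv_naturality_left, Equiv.apply_symm_apply, hr]
  obtain ⟨k, h₀, h₁⟩ := exists_homotopy_of_trivialCofibration hj
    (sSetTopAdj.homEquiv _ _ (ρ ≫ toTop.map j)) (sSetTopAdj.homEquiv _ _ (𝟙 _)) (by
      rw [← Adjunction.homEquiv_naturality_left, ← Adjunction.homEquiv_naturality_left,
        reassoc_of% hρ, Category.comp_id])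
  exact ⟨{
    toFun := (toTop.map j).hom
    invFun := ρ.hom
    left_inv := by
      have : ρ.hom.comp (toTop.map j).hom = ContinuousMap.id _ := congrArg TopCat.Hom.hom hρ
      rw [this]
    right_inv := TopCat.homotopic_of_cylinder _ _ k h₀ h₁ }, rfl⟩

end SSet

/-! ### Natural transformations as homotopies of nerves -/

namespace CategoryTheory

open Simplicial MonoidalCategory

/-- The simplicial homotopy between the maps of nerves induced by a natural transformation. -/
def nerveHomotopy {C D : Type u} [Category.{v} C] [Category.{v} D] {F G : C ⥤ D} (α : F ⟶ G) :
    nerve C ⊗ Δ[1] ⟶ nerve D where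
  app _ := ↾fun x => ((SSet.stdSimplex.asOrderHom x.2).monotone.functor.prod' x.1) ⋙
    Functor.uncurry.obj (ComposableArrows.mk₁ α)
  naturality _ _ _ := rfl

theorem ι₀_nerveHomotopy {C D : Type u} [Category.{v} C] [Category.{v} D] {F G : C ⥤ D}
    (α : F ⟶ G) : SSet.ι₀ ≫ nerveHomotopy α = nerveMap F := by
  ext m x
  refine Functor.ext (fun i => rfl) fun i j f => ?_
  change ((ComposableArrows.mk₁ α).map (𝟙 (0 : Fin 2))).app (x.obj i) ≫ F.map (x.map f) =
    𝟙 _ ≫ F.map (x.map f) ≫ 𝟙 _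
  rw [CategoryTheory.Functor.map_id, Category.comp_id]
  rfl

theorem ι₁_nerveHomotopy {C D : Type u} [Category.{v} C] [Category.{v} D] {F G : C ⥤ D}
    (α : F ⟶ G) : SSet.ι₁ ≫ nerveHomotopy α = nerveMap G := by
  ext m x
  refine Functor.ext (fun i => rfl) fun i j f => ?_
  change ((ComposableArrows.mk₁ α).map (𝟙 (1 : Fin 2))).app (x.obj i) ≫ G.map (x.map f) =
    𝟙 _ ≫ G.map (x.map f) ≫ 𝟙 _
  rw [CategoryTheory.Functor.map_id, Category.comp_id]
  rfl

end CategoryTheory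

/-! ### Homotopy equivalences of categories -/

theorem ContinuousMap.HomotopyEquiv.exists_of_homotopic {X Y : Type*} [TopologicalSpace X]
    [TopologicalSpace Y] (h : ContinuousMap.HomotopyEquiv X Y) {f : C(X, Y)}
    (hf : h.toFun.Homotopic f) : ∃ h : ContinuousMap.HomotopyEquiv X Y, h.toFun = f :=
  ⟨⟨f, h.invFun, (ContinuousMap.Homotopic.comp (.refl _) hf.symm).trans h.left_inv,
    (ContinuousMap.Homotopic.comp hf.symm (.refl _)).trans h.right_inv⟩, rfl⟩

namespace IsHomotopyEquivalence

variable {C D E : Type u} [Category.{v} C] [Category.{v} D] [Category.{v} E]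

theorem map_comp (F : C ⥤ D) (G : D ⥤ E) : (SSet.toTop.map (nerveMap (F ⋙ G))).hom =
    (SSet.toTop.map (nerveMap G)).hom.comp (SSet.toTop.map (nerveMap F)).hom :=
  congrArg TopCat.Hom.hom (SSet.toTop.map_comp (nerveMap F) (nerveMap G))

theorem comp {F : C ⥤ D} {G : D ⥤ E} (hF : IsHomotopyEquivalence F)
    (hG : IsHomotopyEquivalence G) : IsHomotopyEquivalence (F ⋙ G) := by
  obtain ⟨f, hf⟩ := hF
  obtain ⟨g, hg⟩ := hG
  exact ⟨f.trans g, by rw [map_comp, ← hf, ← hg]; rfl⟩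

theorem of_comp_left {F : C ⥤ D} {G : D ⥤ E} (hF : IsHomotopyEquivalence F)
    (hFG : IsHomotopyEquivalence (F ⋙ G)) : IsHomotopyEquivalence G := by
  obtain ⟨f, hf⟩ := hF
  obtain ⟨k, hk⟩ := hFG
  refine (f.symm.trans k).exists_of_homotopic ?_
  change (k.toFun.comp f.invFun).Homotopic _
  rw [hk, map_comp, ← hf, ContinuousMap.comp_assoc]
  exact ContinuousMap.Homotopic.comp (.refl _) f.right_inv

theorem of_comp_right {F : C ⥤ D} {G : D ⥤ E} (hG : IsHomotopyEquivalence G)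
    (hFG : IsHomotopyEquivalence (F ⋙ G)) : IsHomotopyEquivalence F := by
  obtain ⟨g, hg⟩ := hG
  obtain ⟨k, hk⟩ := hFG
  refine (k.trans g.symm).exists_of_homotopic ?_
  change (g.invFun.comp k.toFun).Homotopic _
  rw [hk, map_comp, ← hg, ← ContinuousMap.comp_assoc]
  exact ContinuousMap.Homotopic.comp g.left_inv (.refl _)

theorem of_homotopy_inverse (F : C ⥤ D) (G : D ⥤ C)
    (h₁ : (SSet.toTop.map (nerveMap (F ⋙ G))).hom.Homotopic (ContinuousMap.id _))
    (h₂ : (SSet.toTop.map (nerveMap (G ⋙ F))).hom.Homotopic (ContinuousMap.id _)) :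
    IsHomotopyEquivalence F := by
  rw [map_comp] at h₁ h₂
  exact ⟨⟨_, _, h₁, h₂⟩, rfl⟩

theorem homotopic_of_natTrans {F G : C ⥤ D} (α : F ⟶ G) :
    (SSet.toTop.map (nerveMap F)).hom.Homotopic (SSet.toTop.map (nerveMap G)).hom :=
  SSet.homotopic_toTop_map _ _ (nerveHomotopy α) (ι₀_nerveHomotopy α) (ι₁_nerveHomotopy α)

theorem of_iso {F G : C ⥤ D} (α : F ≅ G) (h : IsHomotopyEquivalence F) :
    IsHomotopyEquivalence G := by
  obtain ⟨h, hF⟩ := h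
  refine h.exists_of_homotopic ?_
  rw [hF]
  exact homotopic_of_natTrans α.hom

theorem map_id (C : Type u) [Category.{v} C] :
    (SSet.toTop.map (nerveMap (𝟭 C))).hom = ContinuousMap.id _ :=
  congrArg TopCat.Hom.hom (SSet.toTop.map_id (nerve C))

theorem of_isLeftAdjoint (F : C ⥤ D) [F.IsLeftAdjoint] : IsHomotopyEquivalence F := by
  have adj := Adjunction.ofIsLeftAdjoint F
  refine of_homotopy_inverse F F.rightAdjoint ?_ ?_ <;> rw [← map_id]
  · exact (homotopic_of_natTrans adj.unit).symm
  · exact homotopic_of_natTrans adj.counit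

theorem of_isEquivalence (F : C ⥤ D) [F.IsEquivalence] : IsHomotopyEquivalence F :=
  of_isLeftAdjoint F

end IsHomotopyEquivalence

/-! ### Nerves of full subcategories -/

namespace CategoryTheory

open Simplicial MonoidalCategory Limits Opposite SSet

section General

variable {C : Type u} [Category.{v} C]

/-- The nerve of the full subcategory on a set of objects. -/
def fullNerve (S : Set C) : (nerve C).Subcomplex where
  obj _ := Set.ofPred fun x : ComposableArrows C _ => ∀ i, x.obj i ∈ S
  map _ _ hx _ := hx _

theorem fullNerve_mono {S S' : Set C} (h : S ⊆ S') : fullNerve S ≤ fullNerve S' :=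
  fun _ _ hx i => h (hx i)

/-- The inclusion of nerves of full subcategories is a trivial cofibration. -/
def TrivialExtension (S S' : Set C) : Prop :=
  ∃ h : S ⊆ S', trivialCofibrations (Subcomplex.homOfLE (fullNerve_mono h))

namespace TrivialExtension

theorem trans {S S' S'' : Set C} (h : TrivialExtension S S') (h' : TrivialExtension S' S'') :
    TrivialExtension S S'' :=
  ⟨h.1.trans h'.1, trivialCofibrations.comp_mem _ _ h.2 h'.2⟩

theorem of_trans {S S' S'' : Set C} (h : TrivialExtension S S') (h' : TrivialExtension S S'')
    (h'' : S' ⊆ S'') : TrivialExtension S' S'' :=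
  ⟨h'', trivialCofibrations_of_precomp h.2 h'.2⟩

/-- No morphism connects `S \ T` with `T \ S`, so every simplex on `S ∪ T` lies on `S` or on `T`.
The nerve of the union is the pushout of the two nerves along that of the intersection. -/
theorem union {S T : Set C} (h : TrivialExtension (S ∩ T) T)
    (h₁ : ∀ x ∈ S, x ∉ T → ∀ y ∈ T, y ∉ S → IsEmpty (x ⟶ y))
    (h₂ : ∀ x ∈ S, x ∉ T → ∀ y ∈ T, y ∉ S → IsEmpty (y ⟶ x)) : TrivialExtension S (S ∪ T) := by
  have sq : Subcomplex.BicartSq (fullNerve (S ∩ T)) (fullNerve T) (fullNerve S)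
      (fullNerve (S ∪ T)) := by
    refine ⟨le_antisymm (sup_le (fullNerve_mono Set.subset_union_right)
      (fullNerve_mono Set.subset_union_left)) ?_, le_antisymm ?_ (le_inf
        (fullNerve_mono Set.inter_subset_right) (fullNerve_mono Set.inter_subset_left))⟩
    · intro m (x : ComposableArrows C _) hx
      by_contra hn
      have hn1 : ¬ ∀ i, x.obj i ∈ T := fun h => hn (Or.inl h)
      have hn2 : ¬ ∀ i, x.obj i ∈ S := fun h => hn (Or.inr h)
      push Not at hn1 hn2
      obtain ⟨i, hi⟩ := hn1
      obtain ⟨j, hj⟩ := hn2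
      have hi' := (hx i).resolve_right hi
      have hj' := (hx j).resolve_left hj
      rcases le_total i j with hij | hij
      · exact (h₁ _ hi' hi _ hj' hj).false (x.map (homOfLE hij))
      · exact (h₂ _ hi' hi _ hj' hj).false (x.map (homOfLE hij))
    · exact fun m x hx i => ⟨hx.2 i, hx.1 i⟩
  exact ⟨Set.subset_union_left, trivialCofibrations.of_isPushout sq.isPushout.flip h.2⟩

/-- A simplex has finitely many vertices and therefore lies on some `S n`; compatible lifts are
chosen recursively and glued. -/
theorem iUnion {S : ℕ → Set C} (h : ∀ n, TrivialExtension (S n) (S (n + 1))) :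
    TrivialExtension (S 0) (⋃ n, S n) := by
  have hS : Monotone S := monotone_nat_of_le_succ fun n => (h n).1
  refine ⟨Set.subset_iUnion S 0, fun P Q p hp => ⟨fun {a b} sq => ?_⟩⟩
  let b' (n : ℕ) : (fullNerve (S n) : SSet) ⟶ Q :=
    Subcomplex.homOfLE (fullNerve_mono (Set.subset_iUnion S n)) ≫ b
  have ext (n : ℕ) (l : (fullNerve (S n) : SSet) ⟶ P) (hl : l ≫ p = b' n) :
      ∃ l' : (fullNerve (S (n + 1)) : SSet) ⟶ P,
        Subcomplex.homOfLE (fullNerve_mono (h n).1) ≫ l' = l ∧ l' ≫ p = b' (n + 1) := by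
    have := (h n).2 p hp
    have sq : CommSq l (Subcomplex.homOfLE (fullNerve_mono (h n).1)) p (b' (n + 1)) := ⟨hl⟩
    exact ⟨sq.lift, sq.fac_left, sq.fac_right⟩
  choose e he he' using ext
  let L (n : ℕ) : {l : (fullNerve (S n) : SSet) ⟶ P // l ≫ p = b' n} :=
    Nat.rec ⟨a, sq.w⟩ (fun n l => ⟨e n l.1 l.2, he' n l.1 l.2⟩) n
  have hL (n : ℕ) : Subcomplex.homOfLE (fullNerve_mono (h n).1) ≫ (L (n + 1)).1 = (L n).1 :=
    he n _ _
  have hL' : ∀ {n k : ℕ} (hnk : n ≤ k) {m} (x : ComposableArrows C _)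
      (hx : x ∈ (fullNerve (S n)).obj m),
      (L k).1.app m ⟨x, fullNerve_mono (hS hnk) _ hx⟩ = (L n).1.app m ⟨x, hx⟩ := by
    intro n k hnk m x hx
    induction k, hnk using Nat.le_induction with
    | base => rfl
    | succ k hnk ih =>
      refine Eq.trans ?_ ih
      exact ConcreteCategory.congr_hom (congr_app (hL k) m) ⟨x, fullNerve_mono (hS hnk) _ hx⟩
  have hx : ∀ {m} (x : ComposableArrows C _), x ∈ (fullNerve (⋃ n, S n)).obj m →
      ∃ n, x ∈ (fullNerve (S n)).obj m := by
    intro m x hx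
    choose n hn using fun i => Set.mem_iUnion.1 (hx i)
    exact ⟨Finset.univ.sup n, fun i => hS (Finset.le_sup (Finset.mem_univ i)) (hn i)⟩
  choose N hN using @hx
  have key : ∀ {m} (x : ComposableArrows C _) (hx : x ∈ (fullNerve (⋃ n, S n)).obj m) (n : ℕ)
      (hn : x ∈ (fullNerve (S n)).obj m), (L (N x hx)).1.app m ⟨x, hN x hx⟩ =
        (L n).1.app m ⟨x, hn⟩ := by
    intro m x hx n hn
    rw [← hL' (le_max_left (N x hx) n) x, ← hL' (le_max_right (N x hx) n) x]
  let l : (fullNerve (⋃ n, S n) : SSet) ⟶ P :=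
    { app := fun m => ↾fun x => (L (N x.1 x.2)).1.app m ⟨x.1, hN x.1 x.2⟩
      naturality := fun m m' φ => by
        ext x
        refine (key _ ((fullNerve (⋃ n, S n)).map φ x.2) (N x.1 x.2)
          ((fullNerve (S (N x.1 x.2))).map φ (hN x.1 x.2))).trans ?_
        exact ConcreteCategory.congr_hom ((L (N x.1 x.2)).1.naturality φ) ⟨x.1, hN x.1 x.2⟩ }
  refine ⟨⟨⟨l, ?_, ?_⟩⟩⟩
  · ext m x
    exact key x.1 _ 0 x.2
  · ext m x
    exact ConcreteCategory.congr_hom (congr_app (L (N x.1 x.2)).2 m) ⟨x.1, hN x.1 x.2⟩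

end TrivialExtension

/-- The forgetful functor from a coslice category on nerves. -/
def nerveUnderForget (b : C) : nerve (Under b) ⟶ nerve C where
  app _ := ↾fun x => x ⋙ Under.forget b
  naturality _ _ _ := rfl

/-- The lift of a simplex of the nerve to a coslice category. -/
def underLift {b : C} {m : ℕ} (x : ComposableArrows C m) (f : b ⟶ x.obj 0) :
    ComposableArrows (Under b) m where
  obj i := Under.mk (f ≫ x.map (homOfLE (Fin.zero_le i)))
  map {i j} φ := Under.homMk (x.map φ) (by
    change (f ≫ x.map _) ≫ x.map φ = f ≫ x.map _
    rw [Category.assoc, ← x.map_comp]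
    rfl)
  map_id i := by
    apply (Under.forget b).map_injective
    exact x.map_id i
  map_comp φ ψ := by
    apply (Under.forget b).map_injective
    exact x.map_comp φ ψ

theorem underLift_forget {b : C} {m : ℕ} (y : ComposableArrows (Under b) m) :
    underLift (y ⋙ Under.forget b) (y.obj 0).hom = y := by
  have e : ∀ i, (underLift (y ⋙ Under.forget b) (y.obj 0).hom).obj i = y.obj i := fun i =>
    congrArg (fun f : b ⟶ (y.obj i).right => Under.mk f) (Under.w (y.map (homOfLE (Fin.zero_le i))))
  refine Functor.ext e fun i j φ => ?_
  apply (Under.forget b).map_injective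
  rw [Functor.map_comp, Functor.map_comp, eqToHom_map, eqToHom_map]
  change (y.map φ).right = 𝟙 _ ≫ (y.map φ).right ≫ 𝟙 _
  rw [Category.id_comp, Category.comp_id]

end General

namespace TrivialExtension

variable {C : Type u} [Category.{v} C]

open Classical in
/-- Attaching new objects, each of which receives a unique morphism from a unique member of a
family of objects. -/
theorem of_under {S S' : Set C} (hS : S ⊆ S') {ι : Type*} (β : ι → C)
    (hβ : ∀ x ∈ S', x ∉ S → Nonempty (Unique (Σ i, β i ⟶ x)))
    (hS' : ∀ x ∈ S, ∀ y ∈ S', y ∉ S → IsEmpty (x ⟶ y))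
    (h : ∀ i, TrivialExtension ((Under.forget (β i)).obj ⁻¹' S)
      ((Under.forget (β i)).obj ⁻¹' S')) : TrivialExtension S S' := by
  refine ⟨hS, fun P Q p hp => ⟨fun {a b} sq => ?_⟩⟩
  have hl : ∀ i, ∃ l : (fullNerve ((Under.forget (β i)).obj ⁻¹' S') : SSet) ⟶ P,
      (∀ {m} (y : ComposableArrows (Under (β i)) _)
        (hy : y ∈ (fullNerve ((Under.forget (β i)).obj ⁻¹' S)).obj m),
        l.app m ⟨y, fullNerve_mono (Set.preimage_mono hS) _ hy⟩ =
          a.app m ⟨y ⋙ Under.forget (β i), hy⟩) ∧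
      (∀ {m} (y : ComposableArrows (Under (β i)) _)
        (hy : y ∈ (fullNerve ((Under.forget (β i)).obj ⁻¹' S')).obj m),
        p.app m (l.app m ⟨y, hy⟩) = b.app m ⟨y ⋙ Under.forget (β i), hy⟩) := by
    intro i
    have := (h i).2 p hp
    have sq' : CommSq
      (Subcomplex.lift (B := fullNerve S) (Subcomplex.ι _ ≫ nerveUnderForget (β i))
        (by rintro m _ ⟨y, rfl⟩; exact y.2) ≫ a)
      (Subcomplex.homOfLE (fullNerve_mono (h i).1)) p
      (Subcomplex.lift (B := fullNerve S') (Subcomplex.ι _ ≫ nerveUnderForget (β i))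
        (by rintro m _ ⟨y, rfl⟩; exact y.2) ≫ b) := ⟨by
          rw [Category.assoc, sq.w]
          rfl⟩
    exact ⟨sq'.lift, fun {m} y hy => ConcreteCategory.congr_hom (congr_app sq'.fac_left m) ⟨y, hy⟩,
      fun {m} y hy => ConcreteCategory.congr_hom (congr_app sq'.fac_right m) ⟨y, hy⟩⟩
  choose l hl hl' using hl
  -- Morphisms never lead from `S` to the new objects, so a simplex that is not contained in `S`
  -- already starts at a new object.
  have h0 : ∀ {m} (x : ComposableArrows C _), x ∈ (fullNerve S').obj m →
      x ∉ (fullNerve S).obj m → x.obj 0 ∉ S := by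
    intro m x hx hx' h0
    refine hx' fun i => ?_
    by_contra hi
    exact (hS' _ h0 _ (hx i) hi).false (x.map (homOfLE (Fin.zero_le i)))
  have hu : ∀ {m} (x : ComposableArrows C _), x ∈ (fullNerve S').obj m →
      x ∉ (fullNerve S).obj m → Nonempty (Unique (Σ i, β i ⟶ x.obj 0)) :=
    fun x hx hx' => hβ _ (hx 0) (h0 x hx hx')
  -- The first vertex of such a simplex has a unique morphism from a unique `β i`, so the simplex
  -- lifts uniquely to one coslice, where the lifting problem has been solved.
  let k : ∀ {m} (x : ComposableArrows C _), x ∈ (fullNerve S').obj m → P.obj m := fun {m} x hx =>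
    if hx' : x ∈ (fullNerve S).obj m then a.app m ⟨x, hx'⟩ else
      (l ((hu x hx hx').some.default).1).app m
        ⟨underLift x ((hu x hx hx').some.default).2, hx⟩
  have key : ∀ {m} (i) (y : ComposableArrows (Under (β i)) _)
      (hy : y ∈ (fullNerve ((Under.forget (β i)).obj ⁻¹' S')).obj m),
      k (y ⋙ Under.forget (β i)) hy = (l i).app m ⟨y, hy⟩ := by
    intro m i y hy
    by_cases hx' : y ⋙ Under.forget (β i) ∈ (fullNerve S).obj m
    · exact (dif_pos hx').trans (hl i y hx').symm
    · refine (dif_neg hx').trans ?_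
      let x : ComposableArrows C _ := y ⋙ Under.forget (β i)
      have e2 : ∀ q : Σ i, β i ⟶ x.obj 0, q = ⟨i, (y.obj 0).hom⟩ →
          (l q.1).app m ⟨underLift x q.2, hy⟩ = (l i).app m ⟨y, hy⟩ := by
        rintro _ rfl
        exact congrArg ((l i).app m) (Subtype.ext (underLift_forget y))
      exact e2 _ ((hu x hy hx').some.uniq ⟨i, (y.obj 0).hom⟩).symm
  have hk : ∀ {m} (x : ComposableArrows C _) (hx : x ∈ (fullNerve S').obj m),
      x ∉ (fullNerve S).obj m → ∃ i, ∃ y : ComposableArrows (Under (β i)) _,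
        x = y ⋙ Under.forget (β i) := by
    intro m x hx hx'
    exact ⟨_, underLift x ((hu x hx hx').some.default).2, rfl⟩
  refine ⟨⟨⟨{ app := fun m => ↾fun x => k x.1 x.2, naturality := ?_ }, ?_, ?_⟩⟩⟩
  · intro m m' φ
    ext ⟨x, hx⟩
    by_cases hx' : x ∈ (fullNerve S).obj m
    · have e1 : k x hx = a.app m ⟨x, hx'⟩ := dif_pos hx'
      refine (dif_pos ((fullNerve S).map φ hx')).trans ?_
      refine (ConcreteCategory.congr_hom (a.naturality φ) ⟨x, hx'⟩).trans ?_
      exact congrArg (P.map φ) e1.symm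
    · obtain ⟨i, y, rfl⟩ := hk x hx hx'
      refine (key i ((nerve _).map φ y) ((fullNerve _).map φ hx)).trans ?_
      refine (ConcreteCategory.congr_hom ((l i).naturality φ) ⟨y, hx⟩).trans ?_
      exact congrArg (P.map φ) (key i y hx).symm
  · ext m ⟨x, hx⟩
    exact dif_pos hx
  · ext m ⟨x, hx⟩
    by_cases hx' : x ∈ (fullNerve S).obj m
    · have e1 : k x hx = a.app m ⟨x, hx'⟩ := dif_pos hx'
      refine (congrArg (p.app m) e1).trans ?_
      exact ConcreteCategory.congr_hom (congr_app sq.w m) ⟨x, hx'⟩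
    · obtain ⟨i, y, rfl⟩ := hk x hx hx'
      exact (congrArg (p.app m) (key i y hx)).trans (hl' i y hx)

end TrivialExtension

end CategoryTheory

/-! ### Retractions of thin categories -/

namespace CategoryTheory

open Simplicial MonoidalCategory Limits Opposite SSet

/-- A simplex of the nerve of a thin category. -/
noncomputable def thinArrows {C : Type u} [Category.{v} C] [Quiver.IsThin C] {m : ℕ}
    (x : Fin (m + 1) → C) (h : ∀ i j, i ≤ j → Nonempty (x i ⟶ x j)) : ComposableArrows C m where
  obj := x
  map f := (h _ _ (leOfHom f)).some
  map_id _ := Subsingleton.elim _ _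
  map_comp _ _ := Subsingleton.elim _ _

theorem mem_horn_one_iff (k : Fin 2) {m : SimplexCategoryᵒᵖ} (x : (Δ[1] : SSet.{u}).obj m) :
    x ∈ (Λ[1, k] : (Δ[1] : SSet.{u}).Subcomplex).obj m ↔
      ∀ i, SSet.stdSimplex.asOrderHom x i = k := by
  fin_cases k
  · exact mem_horn_one_zero x
  · exact mem_horn_one_one x

namespace TrivialExtension

variable {C : Type u} [Category.{v} C] [Quiver.IsThin C]

open Classical in
/-- A monotone map that only decreases (`k = 0`) or only increases (`k = 1`) objects. -/
theorem of_retraction {S S' : Set C} (hS : S ⊆ S') (k : Fin 2) (r : C → C)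
    (hr : ∀ x ∈ S', r x ∈ S)
    (hmono : ∀ x ∈ S', ∀ y ∈ S', (x ⟶ y) → Nonempty (r x ⟶ r y))
    (hk : ∀ x ∈ S', (k = 0 ∧ Nonempty (r x ⟶ x)) ∨ (k = 1 ∧ Nonempty (x ⟶ r x))) :
    TrivialExtension S S' := by
  refine ⟨hS, fun P Q p hp => ⟨fun {a b} sq => ?_⟩⟩
  have hfun : ∀ {m} (x : ComposableArrows C m), (∀ i, x.obj i ∈ S') →
      ∀ (θ : Fin (m + 1) →o Fin 2) (i j), i ≤ j →
      Nonempty ((if θ i = k then r (x.obj i) else x.obj i) ⟶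
        (if θ j = k then r (x.obj j) else x.obj j)) := by
    intro m x hx θ i j hij
    have hθ := θ.monotone hij
    have f := x.map (homOfLE hij)
    by_cases hi : θ i = k <;> by_cases hj : θ j = k
    · rw [if_pos hi, if_pos hj]
      exact hmono _ (hx i) _ (hx j) f
    · rw [if_pos hi, if_neg hj]
      rcases hk _ (hx i) with ⟨-, ⟨g⟩⟩ | ⟨rfl, -⟩
      · exact ⟨g ≫ f⟩
      · rw [hi] at hθ
        exact absurd (le_antisymm (Fin.le_last _) hθ) hj
    · rw [if_neg hi, if_pos hj]
      rcases hk _ (hx j) with ⟨rfl, -⟩ | ⟨-, ⟨g⟩⟩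
      · rw [hj] at hθ
        exact absurd (le_antisymm hθ (Fin.zero_le _)) hi
      · exact ⟨f ≫ g⟩
    · rw [if_neg hi, if_neg hj]
      exact ⟨f⟩
  -- The homotopy `H` applies `r` at the vertices that lie over `k`, so it is the identity at the
  -- end `1 - k`, and it sends `U` into the nerve of `S`. A lift along the anodyne inclusion of `U`
  -- restricts at the end `1 - k` to the desired lift.
  let H : (fullNerve S' : SSet) ⊗ Δ[1] ⟶ (fullNerve S' : SSet) :=
    { app := fun m => ↾fun x =>
        ⟨thinArrows _ (hfun x.1.1 x.1.2 (SSet.stdSimplex.asOrderHom x.2)), fun i => by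
          change (if _ then _ else _) ∈ S'
          split_ifs
          · exact hS (hr _ (x.1.2 i))
          · exact x.1.2 i⟩
      naturality := fun m m' φ => by
        ext x
        exact Subtype.ext (nerve.ext_of_isThin rfl) }
  let A : (fullNerve S' : SSet).Subcomplex := (fullNerve S).preimage (fullNerve S').ι
  let U : ((fullNerve S' : SSet) ⊗ Δ[1]).Subcomplex := A.unionProd Λ[1, k]
  have hU : anodyneExtensions U.ι := anodyneExtensions_unionProd_ι _ _ (.horn_ι _)
  have := anodyneExtensions_le_trivialCofibrations _ hU p hp
  let ρ : (U : SSet) ⟶ (fullNerve S : SSet) :=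
    Subcomplex.lift (U.ι ≫ H ≫ (fullNerve S').ι) (by
      rintro m _ ⟨⟨⟨x, θ⟩, hx⟩, rfl⟩ i
      have : (if SSet.stdSimplex.asOrderHom θ i = k then r ((x.1 : ComposableArrows C _).obj i)
          else (x.1 : ComposableArrows C _).obj i) ∈ S := by
        rcases (Subcomplex.mem_unionProd_iff _ _ _).1 hx with hx | hx
        · rw [if_pos ((mem_horn_one_iff k θ).1 hx i)]
          exact hr _ (x.2 i)
        · split_ifs
          · exact hr _ (x.2 i)
          · exact hx i
      exact this)
  have sq' : CommSq (ρ ≫ a) U.ι p (H ≫ b) := ⟨by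
    rw [Category.assoc, sq.w]
    rfl⟩
  let s : (fullNerve S' : SSet) ⟶ (fullNerve S' : SSet) ⊗ Δ[1] :=
    CartesianMonoidalCategory.lift (𝟙 _) (SSet.const (SSet.stdSimplex.obj₀Equiv.symm (1 - k)))
  have hne : 1 - k ≠ k := by
    fin_cases k <;> decide
  have hs : s ≫ H = 𝟙 _ := by
    ext m x
    refine Subtype.ext (nerve.ext_of_isThin (funext fun i => ?_))
    exact if_neg hne
  refine ⟨⟨⟨s ≫ sq'.lift, ?_, ?_⟩⟩⟩
  · ext m x
    have hx : s.app m ⟨x.1, fullNerve_mono hS _ x.2⟩ ∈ U.obj m :=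
      (Subcomplex.mem_unionProd_iff _ _ _).2 (Or.inr x.2)
    refine (ConcreteCategory.congr_hom (congr_app sq'.fac_left m) ⟨_, hx⟩).trans ?_
    refine congrArg (a.app m) (Subtype.ext (nerve.ext_of_isThin (funext fun i => ?_)))
    exact if_neg hne
  · rw [Category.assoc, sq'.fac_right, ← Category.assoc, hs, Category.id_comp]

open Classical in
/-- Criterion for the union of two upward closed sets of objects of a thin category with a least
object. -/
theorem union_univ (Z Q E : Set C) (b b' : C) (hb : b ∉ Z) (hb' : b' ∈ Z)
    (hle : ∀ x, Nonempty (b ⟶ x)) (hle' : ∀ x ∈ Z, Nonempty (b' ⟶ x))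
    (hZ : ∀ x ∈ Z, ∀ y, (x ⟶ y) → y ∈ Z) (hQ : ∀ x ∈ Q, ∀ y, (x ⟶ y) → y ∈ Q)
    (l : C → C) (hl : ∀ x, x ∉ Z → x ∉ E → Nonempty (l x ⟶ x) ∧ l x ∈ E ∧ (x ∈ Q → l x ∈ Q) ∧
      ∀ z ∈ E, (z ⟶ x) → Nonempty (z ⟶ l x))
    (d : C → C) (hd : ∀ x ∈ E, Nonempty (x ⟶ d x) ∧ d x ∈ Z ∧
      ∀ z ∈ Z, (x ⟶ z) → Nonempty (d x ⟶ z)) :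
    TrivialExtension (Z ∪ Q) Set.univ := by
  -- Both `Z ∪ Q` and the whole category are shown to be trivial extensions of `{b'}`, after which
  -- `{b'}` is cancelled. The whole category is reached through `{b, b'}` and `insert b Z`.
  have h1 : TrivialExtension {b'} Z :=
    of_retraction (by simpa using hb') 0 (fun _ => b') (fun _ _ => rfl)
      (fun _ _ _ _ _ => ⟨𝟙 _⟩)
      (fun x hx => Or.inl ⟨rfl, hle' x hx⟩)
  have h2 : TrivialExtension {b'} {b, b'} :=
    of_retraction (by simp) 1 (fun _ => b') (fun _ _ => rfl)
      (fun _ _ _ _ _ => ⟨𝟙 _⟩)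
      (fun x hx => Or.inr ⟨rfl, by
        rcases hx with rfl | hx
        · exact hle _
        · exact ⟨eqToHom hx⟩⟩)
  have h3 : TrivialExtension {b, b'} (insert b Z) := by
    refine of_retraction (Set.insert_subset_insert (by simpa using hb')) 0
      (fun x => if x = b then b else b') ?_ ?_ ?_
    · intro x _
      split_ifs
      · exact Or.inl rfl
      · exact Or.inr rfl
    · intro x hx y hy f
      by_cases hxb : x = b
      · rw [if_pos hxb]
        exact hle _
      · have hy' : y ≠ b := by
          rintro rfl
          exact hb (hZ x (hx.resolve_left hxb) _ f)
        rw [if_neg hxb, if_neg hy']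
        exact ⟨𝟙 _⟩
    · intro x hx
      refine Or.inl ⟨rfl, ?_⟩
      split_ifs with h
      · exact hle _
      · exact hle' _ (hx.resolve_left h)
  have h4 : TrivialExtension (insert b Z) Set.univ := by
    refine of_retraction (Set.subset_univ _) 0 (fun x => if x ∈ Z then x else b) ?_ ?_ ?_
    · intro x _
      split_ifs with h
      · exact Or.inr h
      · exact Or.inl rfl
    · intro x _ y _ f
      by_cases hx : x ∈ Z
      · rw [if_pos hx, if_pos (hZ x hx y f)]
        exact ⟨f⟩
      · rw [if_neg hx]
        exact hle _
    · intro x _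
      refine Or.inl ⟨rfl, ?_⟩
      split_ifs
      · exact ⟨𝟙 _⟩
      · exact hle _
  -- Inside `Q`, the objects of `E` are raised into `Z` by `d`, and then the remaining ones are
  -- lowered into `E` by `l`.
  have h5 : TrivialExtension (Z ∩ Q) (Q ∩ (Z ∪ E)) := by
    refine of_retraction (fun x hx => ⟨hx.2, Or.inl hx.1⟩) 1 (fun x => if x ∈ Z then x else d x)
      ?_ ?_ ?_
    · intro x hx
      split_ifs with h
      · exact ⟨h, hx.1⟩
      · obtain ⟨⟨f⟩, h', -⟩ := hd x (hx.2.resolve_left h)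
        exact ⟨h', hQ x hx.1 _ f⟩
    · intro x hx y hy f
      by_cases hxZ : x ∈ Z
      · rw [if_pos hxZ, if_pos (hZ x hxZ y f)]
        exact ⟨f⟩
      · rw [if_neg hxZ]
        split_ifs with hyZ
        · exact (hd x (hx.2.resolve_left hxZ)).2.2 y hyZ f
        · obtain ⟨⟨g⟩, h', -⟩ := hd y (hy.2.resolve_left hyZ)
          exact (hd x (hx.2.resolve_left hxZ)).2.2 _ h' (f ≫ g)
    · intro x hx
      refine Or.inr ⟨rfl, ?_⟩
      split_ifs with h
      · exact ⟨𝟙 _⟩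
      · exact (hd x (hx.2.resolve_left h)).1
  have h6 : TrivialExtension (Q ∩ (Z ∪ E)) Q := by
    refine of_retraction Set.inter_subset_left 0 (fun x => if x ∈ Z ∪ E then x else l x)
      ?_ ?_ ?_
    · intro x hx
      split_ifs with h
      · exact ⟨hx, h⟩
      · rw [Set.mem_union, not_or] at h
        obtain ⟨-, h1, h2, -⟩ := hl x h.1 h.2
        exact ⟨h2 hx, Or.inr h1⟩
    · intro x hx y hy f
      by_cases hxR : x ∈ Z ∪ E <;> by_cases hyR : y ∈ Z ∪ E
      · rw [if_pos hxR, if_pos hyR]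
        exact ⟨f⟩
      · rw [if_pos hxR, if_neg hyR]
        rw [Set.mem_union, not_or] at hyR
        rcases hxR with hxZ | hxE
        · exact absurd (hZ x hxZ y f) hyR.1
        · exact (hl y hyR.1 hyR.2).2.2.2 x hxE f
      · rw [if_neg hxR, if_pos hyR]
        rw [Set.mem_union, not_or] at hxR
        obtain ⟨⟨g⟩, -⟩ := hl x hxR.1 hxR.2
        exact ⟨g ≫ f⟩
      · rw [if_neg hxR, if_neg hyR]
        rw [Set.mem_union, not_or] at hxR hyR
        obtain ⟨⟨g⟩, h', -⟩ := hl x hxR.1 hxR.2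
        exact (hl y hyR.1 hyR.2).2.2.2 _ h' (g ≫ f)
    · intro x hx
      refine Or.inl ⟨rfl, ?_⟩
      split_ifs with h
      · exact ⟨𝟙 _⟩
      · rw [Set.mem_union, not_or] at h
        exact (hl x h.1 h.2).1
  -- As `Z` and `Q` are upward closed, no morphism connects `Z \ Q` with `Q \ Z`.
  have h7 : TrivialExtension Z (Z ∪ Q) :=
    union (h5.trans h6) (fun x hx _ y _ hy' => ⟨fun f => hy' (hZ x hx y f)⟩)
      (fun x _ hx' y hy _ => ⟨fun f => hx' (hQ y hy x f)⟩)
  exact (h1.trans h7).of_trans ((h2.trans h3).trans h4) (Set.subset_univ _)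

end TrivialExtension

/-- The inclusion of a full subcategory is a homotopy equivalence if the corresponding inclusion
of nerves is a trivial cofibration. -/
theorem TrivialExtension.isHomotopyEquivalence {C : Type u} [Category.{v} C]
    {P : ObjectProperty C} (h : TrivialExtension (Set.ofPred P) Set.univ) :
    IsHomotopyEquivalence P.ι := by
  let e : nerve P.FullSubcategory ⟶ (fullNerve (Set.ofPred P) : SSet) :=
    Subcomplex.lift (nerveMap P.ι) (by
      rintro m _ ⟨y, rfl⟩ i
      exact ((y : ComposableArrows P.FullSubcategory _).obj i).property)
  have he : IsIso e := by
    rw [NatTrans.isIso_iff_isIso_app]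
    intro m
    rw [isIso_iff_bijective]
    constructor
    · intro (x : ComposableArrows P.FullSubcategory _) (y : ComposableArrows P.FullSubcategory _) hxy
      have hlift : ∀ (F G : ComposableArrows C m.unop.len) (hF : ∀ i, P (F.obj i))
          (hG : ∀ i, P (G.obj i)), F = G → P.lift F hF = P.lift G hG := by
        rintro F _ _ _ rfl
        rfl
      exact hlift (x ⋙ P.ι) (y ⋙ P.ι) (fun i => (x.obj i).property) (fun i => (y.obj i).property)
        (congrArg Subtype.val hxy)
    · rintro ⟨x, hx⟩
      exact ⟨P.lift x hx, rfl⟩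
  have htop : IsIso (fullNerve (Set.univ : Set C)).ι := by
    have : fullNerve (Set.univ : Set C) = ⊤ := top_le_iff.1 fun m x _ i => Set.mem_univ _
    rw [this]
    infer_instance
  have hj : trivialCofibrations (nerveMap P.ι) := by
    have e1 : nerveMap P.ι = e ≫ Subcomplex.homOfLE (fullNerve_mono h.1) ≫
      (fullNerve (Set.univ : Set C)).ι := rfl
    rw [e1]
    exact (trivialCofibrations.cancel_left_of_respectsIso _ _).2
      ((trivialCofibrations.cancel_right_of_respectsIso _ _).2 h.2)
  exact exists_homotopyEquiv_of_trivialCofibration hj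

end CategoryTheory

/-! ### Maps between oriented polygons -/

theorem IsWalk.eq_iterate {Y : Type} {t : Equiv.Perm Y} {l : List Y} {x z : Y}
    (h : IsWalk t x l z) : z = t^[l.length] x := by
  induction l generalizing x with
  | nil => exact h.symm
  | cons a l ih => exact ih h.2

theorem IsWalk.unique {Y : Type} {t : Equiv.Perm Y} {l : List Y} {x z z' : Y}
    (h : IsWalk t x l z) (h' : IsWalk t x l z') : z = z' :=
  h.eq_iterate.trans h'.eq_iterate.symm

theorem isWalk_append_iff {Y : Type} {t : Equiv.Perm Y} {l l' : List Y} {x z : Y} :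
    IsWalk t x (l ++ l') z ↔ ∃ y, IsWalk t x l y ∧ IsWalk t y l' z := by
  refine ⟨fun h => ?_, fun ⟨y, h, h'⟩ => h.append h'⟩
  induction l generalizing x with
  | nil => exact ⟨x, rfl, h⟩
  | cons a l ih =>
    obtain ⟨y, h1, h2⟩ := ih h.2
    exact ⟨y, ⟨h.1, h1⟩, h2⟩

theorem IsWalk.map {X Y : Type} {s : Equiv.Perm X} {t : Equiv.Perm Y} {φ : X → Y}
    (hφ : ∀ x, t (φ x) = φ (s x)) {l : List X} {x z : X} (h : IsWalk s x l z) :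
    IsWalk t (φ x) (l.map φ) (φ z) := by
  induction l generalizing x with
  | nil => exact congrArg φ h
  | cons a l ih =>
    refine ⟨congrArg φ h.1, ?_⟩
    rw [hφ]
    exact ih h.2

namespace PolygonMap

variable {X Y Z : Type} {s : Equiv.Perm X} {t : Equiv.Perm Y} {u : Equiv.Perm Z}

theorem comp_onVertex (f : PolygonMap s t) (g : PolygonMap t u) (x : X) :
    (f.comp g).onVertex x = g.onVertex (f.onVertex x) := rfl

theorem comp_path (f : PolygonMap s t) (g : PolygonMap t u) (x : X) :
    (f.comp g).path x = (f.path x).flatMap g.path := rfl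

variable (f : PolygonMap s t)

theorem eq_of_mem {x x' : X} {y : Y} (h : y ∈ f.path x) (h' : y ∈ f.path x') : x = x' :=
  (f.cover y).unique h h'

theorem head_eq {x : X} {a : Y} {l : List Y} (h : f.path x = a :: l) : f.onVertex x = a := by
  have := f.walk x
  rw [h] at this
  exact this.1.symm

theorem onVertex_mem {x : X} (h : f.path x ≠ []) : f.onVertex x ∈ f.path x := by
  obtain ⟨a, l, h⟩ := List.exists_cons_of_ne_nil h
  rw [f.head_eq h, h]
  exact List.mem_cons_self

theorem onVertex_of_nil {x : X} (h : f.path x = []) : f.onVertex (s x) = f.onVertex x := by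
  have := f.walk x
  rw [h] at this
  exact this.symm

theorem apply_last {x : X} {a : Y} {l : List Y} (h : f.path x = l ++ [a]) :
    t a = f.onVertex (s x) := by
  have := f.walk x
  rw [h] at this
  obtain ⟨y, -, h1, h2⟩ := isWalk_append_iff.1 this
  rw [h1]
  exact h2

theorem apply_of_append {x : X} {a b : Y} {l l' : List Y} (h : f.path x = l ++ a :: b :: l') :
    t a = b := by
  have := f.walk x
  rw [h] at this
  obtain ⟨y, -, h1, h2, -⟩ := isWalk_append_iff.1 this
  rw [h1, h2]

theorem onVertex_pow {d : X} {k : ℕ} (h : ∀ j < k, f.path ((s ^ j) d) = []) :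
    f.onVertex ((s ^ k) d) = f.onVertex d := by
  induction k with
  | zero => rfl
  | succ k ih =>
    rw [pow_succ', Equiv.Perm.mul_apply, f.onVertex_of_nil (h k k.lt_succ_self)]
    exact ih fun j hj => h j (hj.trans k.lt_succ_self)

/-- The edge leaving the image of a vertex is the first edge of a path. -/
theorem exists_pow_of_mem [Finite X] {d x : X} (hdx : s.SameCycle d x)
    (h : f.onVertex d ∈ f.path x) :
    ∃ k : ℕ, (s ^ k) d = x ∧ (∀ j < k, f.path ((s ^ j) d) = []) ∧
      ∃ l, f.path x = f.onVertex d :: l := by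
  classical
  -- From `d` one proceeds to the first edge that is not shrunk. The image of the vertex does not
  -- change on the way, so the path of this edge begins with `f.onVertex d`, and by the uniqueness
  -- in `cover` the edge is `x`.
  have hex : ∃ k : ℕ, f.path ((s ^ k) d) ≠ [] := by
    obtain ⟨k, -, hk⟩ := hdx.exists_pow_eq'
    exact ⟨k, fun h' => by rw [hk] at h'; rw [h'] at h; simp at h⟩
  have hmin : ∀ j < Nat.find hex, f.path ((s ^ j) d) = [] := fun j hj => by
    simpa using Nat.find_min hex hj
  have h1 := f.onVertex_pow hmin
  obtain ⟨a, l, hl⟩ := List.exists_cons_of_ne_nil (Nat.find_spec hex)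
  have h2 := f.head_eq hl
  rw [h1] at h2
  subst h2
  have h3 : (s ^ Nat.find hex) d = x := f.eq_of_mem (by rw [hl]; exact List.mem_cons_self) h
  exact ⟨_, h3, hmin, l, by rw [← h3, hl]⟩

end PolygonMap

/-- On a finite set inverses are powers with nonnegative exponents, so it is enough to consider
properties that are preserved by the two permutations in the forward direction. -/
theorem Equiv.Perm.transitive_closure_pair_iff {X : Type*} [Finite X] {p q : Equiv.Perm X} :
    (∀ d e, ∃ w ∈ Subgroup.closure {p, q}, w d = e) ↔
      ∀ (P : X → Prop) (d e), (∀ d, P d → P (p d)) → (∀ d, P d → P (q d)) → P d → P e := by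
  constructor
  · intro h P d e hp hq hd
    have hfin : ∀ (p : Equiv.Perm X), (∀ d, P d → P (p d)) → ∀ d, P d → P (p⁻¹ d) := by
      intro p hp d hd
      have hpow : ∀ k : ℕ, P ((p ^ k) d) := fun k => by
        induction k with
        | zero => exact hd
        | succ k ih =>
          rw [pow_succ', Equiv.Perm.mul_apply]
          exact hp _ ih
      have hk : p ^ (orderOf p - 1) = p⁻¹ := by
        rw [eq_inv_iff_mul_eq_one, ← pow_succ, Nat.sub_add_cancel (orderOf_pos p),
          pow_orderOf_eq_one]
      rw [← hk]
      exact hpow _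
    obtain ⟨w, hw, rfl⟩ := h d e
    induction hw using Subgroup.closure_induction generalizing d with
    | mem p hp =>
      rcases hp with rfl | rfl
      · exact hp _ hd
      · exact hq _ hd
    | one => exact hd
    | mul p q _ _ hp hq => exact hp _ (hq _ hd)
    | inv p _ hp => exact hfin p (fun d h => hp d h) d hd
  · intro h d e
    refine h (fun x => ∃ w ∈ Subgroup.closure {p, q}, w d = x) d e ?_ ?_ ⟨1, one_mem _, rfl⟩
    · rintro _ ⟨w, hw, rfl⟩
      exact ⟨p * w, mul_mem (Subgroup.subset_closure (Or.inl rfl)) hw, rfl⟩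
    · rintro _ ⟨w, hw, rfl⟩
      exact ⟨q * w, mul_mem (Subgroup.subset_closure (Or.inr rfl)) hw, rfl⟩

/-! ### Cellular maps and vertices of valence two -/

namespace FatGraph

variable {g n : ℕ}

instance (Γ : FatGraph g n) : Finite Γ.Flag := Γ.finite

theorem boundary_apply (Γ : FatGraph g n) (d : Γ.Flag) : Γ.boundary d = Γ.rot (Γ.opp d) := rfl

theorem boundary_opp (Γ : FatGraph g n) (d : Γ.Flag) : Γ.boundary (Γ.opp d) = Γ.rot d := by
  rw [boundary_apply, Γ.opp_opp]

theorem sameCycle_of_mark_eq (Γ : FatGraph g n) {d e : Γ.Flag} (h : Γ.mark d = Γ.mark e) :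
    Γ.boundary.SameCycle d e := (Γ.mark_eq_iff d e).1 h

theorem sameCycle_rot (Γ : FatGraph g n) (d : Γ.Flag) : Γ.rot.SameCycle d (Γ.rot d) :=
  Equiv.Perm.sameCycle_apply_right.2 (Equiv.Perm.SameCycle.refl _ _)

/-- The vertices of valence two. -/
def Bivalent (Γ : FatGraph g n) (d : Γ.Flag) : Prop := Γ.rot (Γ.rot d) = d

theorem Bivalent.rot {Γ : FatGraph g n} {d : Γ.Flag} (h : Γ.Bivalent d) : Γ.Bivalent (Γ.rot d) :=
  congrArg Γ.rot h

theorem Bivalent.eq_or_eq {Γ : FatGraph g n} {d e : Γ.Flag} (h : Γ.Bivalent d)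
    (he : Γ.rot.SameCycle d e) : e = d ∨ e = Γ.rot d := by
  obtain ⟨k, -, rfl⟩ := he.exists_pow_eq'
  clear he
  induction k with
  | zero => exact Or.inl rfl
  | succ k ih =>
    rw [pow_succ', Equiv.Perm.mul_apply]
    rcases ih with h' | h'
    · exact Or.inr (by rw [h'])
    · exact Or.inl (by rw [h']; exact h)

theorem Bivalent.of_sameCycle {Γ : FatGraph g n} {d e : Γ.Flag} (h : Γ.Bivalent d)
    (he : Γ.rot.SameCycle d e) : Γ.Bivalent e := by
  rcases h.eq_or_eq he with rfl | rfl
  · exact h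
  · exact h.rot

/-- Everything that is preserved by `rot` and `opp` and holds for one flag holds for all flags. -/
theorem induction_on_flags (Γ : FatGraph g n) {P : Γ.Flag → Prop} {d : Γ.Flag} (hd : P d)
    (hrot : ∀ d, P d → P (Γ.rot d)) (hopp : ∀ d, P d → P (Γ.opp d)) (e : Γ.Flag) : P e :=
  Equiv.Perm.transitive_closure_pair_iff.1 Γ.connected P d e hrot hopp hd

namespace CellMap

variable {Γ Δ Θ : FatGraph g n}

theorem comp_path (f : CellMap Γ Δ) (h : CellMap Δ Θ) (d : Γ.Flag) :
    (f.comp h).path d = (f.path d).flatMap h.path := rfl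

theorem comp_onVertex (f : CellMap Γ Δ) (h : CellMap Δ Θ) (d : Γ.Flag) :
    (f.comp h).onVertex d = h.onVertex (f.onVertex d) := rfl

theorem id_path (d : Γ.Flag) : (CellMap.id Γ).path d = [d] := rfl

theorem comp_assoc {Ξ : FatGraph g n} (f : CellMap Γ Δ) (h : CellMap Δ Θ) (k : CellMap Θ Ξ) :
    (f.comp h).comp k = f.comp (h.comp k) :=
  CellMap.ext rfl (funext fun _ => List.flatMap_assoc)

theorem comp_id (f : CellMap Γ Δ) : f.comp (CellMap.id Δ) = f :=
  CellMap.ext rfl (funext fun x => by simp [comp_path, CellMap.id, PolygonMap.id])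

theorem id_comp (f : CellMap Γ Δ) : (CellMap.id Γ).comp f = f :=
  CellMap.ext rfl (funext fun x => by simp [comp_path, id_path])

variable (f : CellMap Γ Δ)

theorem sameCycle_of_onVertex_eq {d x : Γ.Flag} (h : f.onVertex d ∈ f.path x) :
    Γ.boundary.SameCycle d x :=
  Γ.sameCycle_of_mark_eq ((f.mark_onVertex d).symm.trans (f.mark_path h))

/-- A cellular map is determined by the images of the edges. -/
theorem ext_path {f h : CellMap Γ Δ} (e : ∀ d, f.path d = h.path d) : f = h := by
  refine CellMap.ext (funext fun d => ?_) (funext e)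
  obtain ⟨x, hx, -⟩ := f.cover (f.onVertex d)
  -- The image of the corner `d` is the first edge of the first nonconstant path after `d`.
  obtain ⟨k, hk, hk', l, hl⟩ := f.exists_pow_of_mem (f.sameCycle_of_onVertex_eq hx) hx
  have h1 := h.onVertex_pow (d := d) (k := k) fun j hj => (e _).symm.trans (hk' j hj)
  rw [← h1, hk]
  exact (h.head_eq ((e x).symm.trans hl)).symm

theorem path_opp_eq_nil {d : Γ.Flag} (h : f.path d = []) : f.path (Γ.opp d) = [] := by
  rw [f.path_opp, h]
  rfl

theorem path_opp_eq_nil_iff {d : Γ.Flag} : f.path (Γ.opp d) = [] ↔ f.path d = [] :=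
  ⟨fun h => by simpa [Γ.opp_opp] using f.path_opp_eq_nil h, f.path_opp_eq_nil⟩

theorem length_path_opp (d : Γ.Flag) : (f.path (Γ.opp d)).length = (f.path d).length := by
  rw [f.path_opp, List.length_reverse, List.length_map]

theorem opp_mem_path_opp {d : Γ.Flag} {e : Δ.Flag} (h : e ∈ f.path d) :
    Δ.opp e ∈ f.path (Γ.opp d) := by
  rw [f.path_opp, List.mem_reverse]
  exact List.mem_map_of_mem h

/-- The reversed path ends with the reverse of the first edge of the path, and the boundary
component continues from there at `rot` of this first edge. -/
theorem rot_onVertex {d : Γ.Flag} (h : f.path d ≠ []) :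
    Δ.rot (f.onVertex d) = f.onVertex (Γ.rot d) := by
  obtain ⟨a, l, hl⟩ := List.exists_cons_of_ne_nil h
  have h1 : f.path (Γ.opp d) = (l.map Δ.opp).reverse ++ [Δ.opp a] := by
    rw [f.path_opp, hl, List.map_cons, List.reverse_cons]
  have h2 := f.apply_last h1
  rwa [Δ.boundary_opp, Γ.boundary_opp, ← f.head_eq hl] at h2

/-- The vertices in the interior of the image of an edge have valence two. -/
theorem bivalent_of_append {d : Γ.Flag} {a b : Δ.Flag} {l l' : List Δ.Flag}
    (h : f.path d = l ++ a :: b :: l') : Δ.rot b = Δ.opp a ∧ Δ.Bivalent b := by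
  have h1 := f.apply_of_append h
  have h2 : f.path (Γ.opp d) =
      (l'.map Δ.opp).reverse ++ Δ.opp b :: Δ.opp a :: (l.map Δ.opp).reverse := by
    rw [f.path_opp, h]
    simp
  have h3 := f.apply_of_append h2
  rw [Δ.boundary_opp] at h3
  refine ⟨h3, ?_⟩
  rw [Bivalent, h3, ← boundary_apply, h1]

/-- The corners in the interior of the image of an edge are not images of corners. -/
theorem onVertex_ne_of_append {d : Γ.Flag} {a b : Δ.Flag} {l l' : List Δ.Flag}
    (h : f.path d = l ++ a :: b :: l') (x : Γ.Flag) : f.onVertex x ≠ b := by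
  intro hx
  have hb : f.onVertex x ∈ f.path d := by
    rw [hx, h]
    simp
  obtain ⟨k, -, -, l'', hl⟩ := f.exists_pow_of_mem (f.sameCycle_of_onVertex_eq hb) hb
  have hn := f.nodup d
  rw [hx] at hl
  rw [h] at hn hl
  cases l with
  | nil =>
    simp only [List.nil_append, List.cons.injEq] at hl
    rw [hl.1] at hn
    simp at hn
  | cons c l =>
    simp only [List.cons_append, List.cons.injEq] at hl
    rw [hl.1] at hn
    simp at hn

/-- Two consecutive edges `a`, `b` of a path meet at a vertex of valence two. Its corners are `b`
and `Δ.opp a`, one in the interior of the path and one in the interior of the reversed path, so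
neither is the image of a corner. -/
theorem length_path_le_one
    (h : ∀ e, Δ.Bivalent e → ∃ x, f.onVertex x = e ∨ f.onVertex x = Δ.rot e) (d : Γ.Flag) :
    (f.path d).length ≤ 1 := by
  by_contra hd
  rcases hl : f.path d with _ | ⟨a, _ | ⟨b, l⟩⟩
  · simp [hl] at hd
  · simp [hl] at hd
  have hl' : f.path d = [] ++ a :: b :: l := hl
  obtain ⟨h1, h2⟩ := f.bivalent_of_append hl'
  have hl2 : f.path (Γ.opp d) = (l.map Δ.opp).reverse ++ Δ.opp b :: Δ.opp a :: [] := by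
    rw [f.path_opp, hl]
    simp
  obtain ⟨x, hx | hx⟩ := h b h2
  · exact f.onVertex_ne_of_append hl' x hx
  · exact f.onVertex_ne_of_append hl2 x (hx.trans h1)

theorem path_eq_singleton {d : Γ.Flag} (h : (f.path d).length ≤ 1) (h' : f.path d ≠ []) :
    f.path d = [f.onVertex d] := by
  rcases hl : f.path d with _ | ⟨a, _ | ⟨b, l⟩⟩
  · exact absurd hl h'
  · rw [f.head_eq hl]
  · simp [hl] at h

theorem exists_path_eq_singleton (h : ∀ d, (f.path d).length ≤ 1) (e : Δ.Flag) :
    ∃ d, f.path d = [e] ∧ f.onVertex d = e := by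
  obtain ⟨d, hd, -⟩ := f.cover e
  have h1 := f.path_eq_singleton (h d) (List.ne_nil_of_mem hd)
  rw [h1, List.mem_singleton] at hd
  exact ⟨d, by rw [h1, hd], hd.symm⟩

/-- Each edge of the target is the whole image of an edge, so `f` is an epimorphism. This will make
coslices thin. -/
theorem cancel_left (hf : ∀ d, (f.path d).length ≤ 1) {h k : CellMap Δ Θ}
    (e : f.comp h = f.comp k) : h = k := by
  refine ext_path fun a => ?_
  obtain ⟨d, hd, -⟩ := f.exists_path_eq_singleton hf a
  have := congrArg (fun k : CellMap Γ Θ => k.path d) e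
  simpa [comp_path, hd] using this

theorem injective_of_path_ne_nil {d d' : Γ.Flag} (h : f.onVertex d = f.onVertex d')
    (hd : f.path d ≠ []) (hd' : f.path d' ≠ []) : d = d' :=
  f.eq_of_mem (f.onVertex_mem hd) (h ▸ f.onVertex_mem hd')

/-- Shrinking an edge between vertices of valences `p` and `q` gives valence `p + q - 2`. As `p` and
`q` are at least two, this can be two only if both are two. -/
theorem bivalent_of_shrink {e : Γ.Flag} (hloop : ¬ Γ.rot.SameCycle e (Γ.opp e))
    (he : f.path e = []) (h : ∀ d, d ≠ e → d ≠ Γ.opp e → f.path d ≠ [])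
    {d : Γ.Flag} (hd : Γ.rot.SameCycle e d) (hb : Δ.Bivalent (f.onVertex d)) : Γ.Bivalent d := by
  have hsc : ∀ {x}, Γ.rot.SameCycle e x → x ≠ Γ.opp e := by
    rintro _ hx rfl
    exact hloop hx
  have hp := Γ.sameCycle_rot e
  have hb' : Δ.Bivalent (f.onVertex (Γ.rot e)) :=
    hb.of_sameCycle (f.sameCycle (hd.symm.trans hp))
  have hp0 : f.path (Γ.rot e) ≠ [] := h _ (Γ.rot_ne e) (hsc hp)
  suffices Γ.rot (Γ.rot e) = e from Bivalent.of_sameCycle this hd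
  by_contra hp2
  have hsc2 := hp.trans (Γ.sameCycle_rot _)
  have h2 := h _ hp2 (hsc hsc2)
  have h3 : f.onVertex (Γ.rot (Γ.rot (Γ.rot e))) = f.onVertex (Γ.rot e) := by
    rw [← f.rot_onVertex h2, ← f.rot_onVertex hp0]
    exact hb'
  by_cases hp3 : Γ.rot (Γ.rot (Γ.rot e)) = e
  · rw [hp3, ← f.onVertex_of_nil he, boundary_apply] at h3
    have h4 : Γ.rot (Γ.opp e) ≠ e := fun h' => hloop (by
      conv_lhs => rw [← h']
      exact (Γ.sameCycle_rot _).symm)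
    have := f.injective_of_path_ne_nil h3 (h _ h4 (Γ.rot_ne _)) hp0
    exact (Γ.opp_ne e) (Γ.rot.injective this)
  · have := f.injective_of_path_ne_nil h3 (h _ hp3 (hsc (hsc2.trans (Γ.sameCycle_rot _)))) hp0
    exact hp2 (Γ.rot.injective this)

/-- A corner that is mapped to a vertex of valence two belongs to a vertex of valence two. -/
theorem IsGenerated.bivalent {Γ Δ : FatGraph g n} {f : CellMap Γ Δ} (hf : f.IsGenerated)
    {d : Γ.Flag} (h : Δ.Bivalent (f.onVertex d)) : Γ.Bivalent d := by
  -- At unshrunk flags `onVertex` is injective and commutes with `rot`, so bivalence in the target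
  -- is reflected.
  have key : ∀ {Γ Δ : FatGraph g n} (f : CellMap Γ Δ) (P : Γ.Flag → Prop),
      (∀ d, P d → f.path d ≠ []) → ∀ {d}, P d → P (Γ.rot d) → P (Γ.rot (Γ.rot d)) →
      Δ.Bivalent (f.onVertex d) → Γ.Bivalent d := by
    intro Γ Δ f P hP d h0 h1 h2 hb
    refine f.injective_of_path_ne_nil ?_ (hP _ h2) (hP _ h0)
    rw [← f.rot_onVertex (hP _ h1), ← f.rot_onVertex (hP _ h0)]
    exact hb
  induction hf with
  | iso f hf =>
    exact key f (fun _ => True) (fun d _ h' => by simpa [h'] using hf d) trivial trivial trivial h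
  | @insert Γ Δ f e he hf =>
    refine key f (fun _ => True) (fun d _ h' => ?_) trivial trivial trivial h
    by_cases h1 : d = e
    · simp [← h1, h'] at he
    · by_cases h2 : d = Γ.opp e
      · rw [← f.length_path_opp, ← h2, h'] at he
        simp at he
      · simpa [h'] using hf d h1 h2
  | @shrink Γ Δ f e hloop he hf =>
    have he' : f.path e = [] := List.length_eq_zero_iff.1 he
    have hne : ∀ d, d ≠ e → d ≠ Γ.opp e → f.path d ≠ [] := fun d h1 h2 h' => by
      simpa [h'] using hf d h1 h2
    by_cases h1 : Γ.rot.SameCycle e d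
    · exact f.bivalent_of_shrink hloop he' hne h1 h
    by_cases h2 : Γ.rot.SameCycle (Γ.opp e) d
    · refine f.bivalent_of_shrink (e := Γ.opp e) ?_ (f.path_opp_eq_nil he')
        (fun d h1 h2 => hne d ?_ h1) h2 h
      · rw [Γ.opp_opp]
        exact fun h => hloop h.symm
      · rwa [Γ.opp_opp] at h2
    · refine key f (fun d => ¬ Γ.rot.SameCycle e d ∧ ¬ Γ.rot.SameCycle (Γ.opp e) d)
        (fun d hd => hne d ?_ ?_) ⟨h1, h2⟩ ?_ ?_ h
      · rintro rfl
        exact hd.1 (Equiv.Perm.SameCycle.refl _ _)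
      · rintro rfl
        exact hd.2 (Equiv.Perm.SameCycle.refl _ _)
      · simpa only [Equiv.Perm.sameCycle_apply_right] using ⟨h1, h2⟩
      · simpa only [Equiv.Perm.sameCycle_apply_right] using ⟨h1, h2⟩
  | comp f f' hf hf' ih ih' => exact ih (ih' h)

/-- An isomorphism of fat graphs given by a bijection between the flags. -/
def ofEquiv (θ : Γ.Flag ≃ Δ.Flag) (hrot : ∀ d, Δ.rot (θ d) = θ (Γ.rot d))
    (hopp : ∀ d, Δ.opp (θ d) = θ (Γ.opp d)) (hmark : ∀ d, Δ.mark (θ d) = Γ.mark d) :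
    CellMap Γ Δ where
  onVertex := θ
  path d := [θ d]
  walk d := ⟨rfl, by
    change Δ.rot (Δ.opp (θ d)) = _
    rw [hopp, hrot]
    rfl⟩
  nodup d := List.nodup_singleton _
  cover e := ⟨θ.symm e, by simp, fun d hd => by
    rw [List.mem_singleton.1 hd, Equiv.symm_apply_apply]⟩
  path_opp d := by simp [hopp]
  onVertex_rot d := by
    rw [← hrot]
    exact Δ.sameCycle_rot _
  mark_onVertex := hmark

theorem isGenerated_ofEquiv (θ : Γ.Flag ≃ Δ.Flag) (hrot : ∀ d, Δ.rot (θ d) = θ (Γ.rot d))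
    (hopp : ∀ d, Δ.opp (θ d) = θ (Γ.opp d)) (hmark : ∀ d, Δ.mark (θ d) = Γ.mark d) :
    (ofEquiv θ hrot hopp hmark).IsGenerated := .iso _ fun _ => rfl

end CellMap

end FatGraph

/-! ### Insertion and removal of a vertex of valence two -/

namespace Equiv.Perm

theorem SameCycle.map_of_step {X Y : Type*} {s : Perm X} {t : Perm Y} {φ : X → Y}
    (h : ∀ x, t.SameCycle (φ x) (φ (s x))) {x y : X} (hxy : s.SameCycle x y) :
    t.SameCycle (φ x) (φ y) := by
  obtain ⟨i, rfl⟩ := hxy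
  induction i using Int.induction_on with
  | zero => exact SameCycle.refl _ _
  | succ i ih =>
    rw [add_comm, zpow_add, zpow_one, mul_apply]
    exact ih.trans (h _)
  | pred i ih =>
    refine ih.trans (SameCycle.symm ?_)
    have := h ((s ^ (-(i : ℤ) - 1)) x)
    rwa [← mul_apply, ← zpow_one_add, add_sub_cancel] at this

theorem card_quotient_congr {X Y : Type*} {s : Perm X} {t : Perm Y} (θ : X ≃ Y)
    (h : ∀ x, t (θ x) = θ (s x)) : Nat.card (Quotient (SameCycle.setoid s)) =
      Nat.card (Quotient (SameCycle.setoid t)) := by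
  refine Nat.card_congr (Quotient.congr θ fun x y => ⟨fun hxy => ?_, fun hxy => ?_⟩)
  · refine SameCycle.map_of_step (fun x => ?_) hxy
    rw [← h]
    exact sameCycle_apply_right.2 (SameCycle.refl _ _)
  · have := SameCycle.map_of_step (s := t) (t := s) (φ := θ.symm) (fun y => ?_) hxy
    · simp only [symm_apply_apply] at this
      exact this
    · obtain ⟨x, rfl⟩ := θ.surjective y
      rw [h, symm_apply_apply, symm_apply_apply]
      exact sameCycle_apply_right.2 (SameCycle.refl _ _)

theorem sameCycle_iff_of_involutive {X : Type*} {p : Perm X} (hp : ∀ x, p (p x) = x) {x y : X} :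
    p.SameCycle x y ↔ y = x ∨ y = p x := by
  constructor
  · rintro ⟨i, rfl⟩
    induction i using Int.induction_on with
    | zero => exact Or.inl rfl
    | succ i ih =>
      rw [add_comm, zpow_add, zpow_one, mul_apply]
      rcases ih with h | h <;> rw [h]
      · exact Or.inr rfl
      · exact Or.inl (hp x)
    | pred i ih =>
      have e : p⁻¹ = p := Equiv.ext fun x => by rw [inv_eq_iff_eq, hp]
      rw [sub_eq_add_neg, add_comm, zpow_add, zpow_neg_one, mul_apply, e]
      rcases ih with h | h <;> rw [h]
      · exact Or.inr rfl
      · exact Or.inl (hp x)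
  · rintro (rfl | rfl)
    · exact SameCycle.refl _ _
    · exact sameCycle_apply_right.2 (SameCycle.refl _ _)

theorem two_mul_card_quotient {X : Type*} [Finite X] {p : Perm X} (hp : ∀ x, p (p x) = x)
    (hne : ∀ x, p x ≠ x) : 2 * Nat.card (Quotient (SameCycle.setoid p)) = Nat.card X := by
  have : Function.Bijective fun z : Bool × Quotient (SameCycle.setoid p) =>
      if z.1 then z.2.out else p z.2.out := by
    have hq : ∀ q : Quotient (SameCycle.setoid p), (⟦p q.out⟧ : Quotient (SameCycle.setoid p)) = q :=
      fun q => by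
        conv_rhs => rw [← Quotient.out_eq q]
        exact Quotient.sound (sameCycle_apply_left.2 (SameCycle.refl _ _))
    constructor
    · rintro ⟨b, q⟩ ⟨b', q'⟩ h
      have h1 : q = q' := by
        have := congrArg (fun x => (⟦x⟧ : Quotient (SameCycle.setoid p))) h
        cases b <;> cases b' <;> simpa [hq] using this
      subst h1
      cases b <;> cases b' <;> simp_all
      exact hne _ h.symm
    · intro x
      have : p.SameCycle (Quotient.out (⟦x⟧ : Quotient (SameCycle.setoid p))) x :=
        Quotient.mk_out (s := SameCycle.setoid p) x
      rcases (sameCycle_iff_of_involutive hp).1 this with h | h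
      · exact ⟨(true, ⟦x⟧), h.symm⟩
      · exact ⟨(false, ⟦x⟧), h.symm⟩
  rw [← Nat.card_eq_of_bijective _ this, Nat.card_prod]
  simp

section Subdivision

variable {X : Type} (rot opp : Perm X) (e : X)

/-- The cyclic orders after the insertion of a new vertex with the two flags `inr false` and
`inr true`. -/
def subdivideRot : Perm (X ⊕ Bool) := Equiv.sumCongr rot Equiv.boolNot

open Classical in
/-- The opposite ends after the insertion of a new vertex into the edge of `e`. -/
noncomputable def subdivideOppFun : X ⊕ Bool → X ⊕ Bool
  | .inl d => if d = e then .inr true else if d = opp e then .inr false else .inl (opp d)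
  | .inr false => .inl (opp e)
  | .inr true => .inl e

variable {rot opp}

theorem subdivideOppFun_involutive (hopp : ∀ d, opp (opp d) = d) (hne : ∀ d, opp d ≠ d) :
    Function.Involutive (subdivideOppFun opp e) := by
  rintro (d | _ | _)
  · by_cases h1 : d = e
    · simp [subdivideOppFun, h1]
    · by_cases h2 : d = opp e
      · simp [subdivideOppFun, h2, hne]
      · have h3 : opp d ≠ e := fun h => h2 (by rw [← h, hopp])
        have h4 : opp d ≠ opp e := fun h => h1 (opp.injective h)
        simp [subdivideOppFun, h1, h2, h3, hopp, h4]
  · simp [subdivideOppFun, hne]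
  · simp [subdivideOppFun]

variable (hopp : ∀ d, opp (opp d) = d) (hne : ∀ d, opp d ≠ d)

/-- The opposite ends after the insertion of a new vertex into the edge of `e`. -/
noncomputable def subdivideOpp : Perm (X ⊕ Bool) := (subdivideOppFun_involutive e hopp hne).toPerm

theorem subdivideOpp_opp (x : X ⊕ Bool) :
    subdivideOpp e hopp hne (subdivideOpp e hopp hne x) = x :=
  subdivideOppFun_involutive e hopp hne x

theorem subdivideOpp_false : subdivideOpp e hopp hne (.inr false) = .inl (opp e) := rfl

theorem subdivideOpp_true : subdivideOpp e hopp hne (.inr true) = .inl e := rfl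

theorem subdivideOpp_self : subdivideOpp e hopp hne (.inl e) = .inr true := if_pos rfl

theorem subdivideOpp_opp_self : subdivideOpp e hopp hne (.inl (opp e)) = .inr false :=
  (if_neg (hne e)).trans (if_pos rfl)

theorem subdivideOpp_of_ne {d : X} (h : d ≠ e) (h' : d ≠ opp e) :
    subdivideOpp e hopp hne (.inl d) = .inl (opp d) :=
  (if_neg h).trans (if_neg h')

theorem subdivideOpp_ne (x : X ⊕ Bool) : subdivideOpp e hopp hne x ≠ x := by
  rcases x with d | _ | _
  · by_cases h1 : d = e
    · subst h1
      simp [subdivideOpp_self]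
    · by_cases h2 : d = opp e
      · subst h2
        simp [subdivideOpp_opp_self]
      · simp [subdivideOpp_of_ne e hopp hne h1 h2, hne]
  · simp [subdivideOpp_false]
  · simp [subdivideOpp_true]

/-- The flag from which a given flag of the subdivision arises. -/
def subdivideFold (opp : Perm X) (e : X) : X ⊕ Bool → X
  | .inl d => d
  | .inr false => e
  | .inr true => opp e

/-- On the boundary the new flag `inr false` is passed immediately after `e` and `inr true`
immediately after `opp e`; each cycle only becomes longer. -/
theorem sameCycle_subdivide_iff (x y : X ⊕ Bool) :
    (subdivideRot rot * subdivideOpp e hopp hne).SameCycle x y ↔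
      (rot * opp).SameCycle (subdivideFold opp e x) (subdivideFold opp e y) := by
  set p := subdivideRot rot * subdivideOpp e hopp hne with hp
  have p1 : p (.inl e) = .inr false := by
    rw [hp, mul_apply, subdivideOpp_self]; rfl
  have p2 : p (.inl (opp e)) = .inr true := by
    rw [hp, mul_apply, subdivideOpp_opp_self]; rfl
  have p3 : p (.inr false) = .inl (rot (opp e)) := rfl
  have p4 : p (.inr true) = .inl (rot e) := rfl
  have p5 : ∀ d, d ≠ e → d ≠ opp e → p (.inl d) = .inl (rot (opp d)) := fun d h h' => by
    rw [hp, mul_apply, subdivideOpp_of_ne e hopp hne h h']; rfl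
  have hs : ∀ x, p.SameCycle x (p x) := fun x => sameCycle_apply_right.2 (SameCycle.refl _ _)
  have hs' : ∀ x, (rot * opp).SameCycle x (rot (opp x)) :=
    fun x => sameCycle_apply_right.2 (SameCycle.refl _ _)
  constructor
  · refine SameCycle.map_of_step fun x => ?_
    rcases x with d | _ | _
    · by_cases h1 : d = e
      · subst h1
        rw [p1]
        exact SameCycle.refl _ _
      · by_cases h2 : d = opp e
        · subst h2
          rw [p2]
          exact SameCycle.refl _ _
        · rw [p5 d h1 h2]
          exact hs' d
    · rw [p3]
      exact hs' e
    · rw [p4]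
      have := hs' (opp e)
      rwa [hopp] at this
  · intro h
    have hfold : ∀ x, p.SameCycle (.inl (subdivideFold opp e x)) x := by
      rintro (d | _ | _)
      · exact SameCycle.refl _ _
      · have := hs (.inl e)
        rwa [p1] at this
      · have := hs (.inl (opp e))
        rwa [p2] at this
    refine (hfold x).symm.trans (SameCycle.trans ?_ (hfold y))
    refine SameCycle.map_of_step (φ := Sum.inl) (fun d => ?_) h
    by_cases h1 : d = e
    · subst h1
      have e1 := hs (.inl d)
      have e2 := hs (.inr false)
      rw [p1] at e1
      exact e1.trans e2
    · by_cases h2 : d = opp e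
      · subst h2
        have e1 := hs (.inl (opp e))
        have e2 := hs (.inr true)
        rw [p2] at e1
        rw [mul_apply, hopp]
        exact e1.trans e2
      · have e1 := hs (.inl d)
        rwa [p5 d h1 h2] at e1

theorem card_quotient_subdivideRot [Finite X] :
    Nat.card (Quotient (SameCycle.setoid (subdivideRot rot))) =
      Nat.card (Quotient (SameCycle.setoid rot)) + 1 := by
  have hmap : ∀ x y, rot.SameCycle x y →
      (subdivideRot rot).SameCycle (.inl x : X ⊕ Bool) (.inl y) := fun x y h =>
    SameCycle.map_of_step (φ := Sum.inl) (fun d => sameCycle_apply_right.2 (SameCycle.refl _ _)) h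
  let F : Quotient (SameCycle.setoid rot) ⊕ Unit → Quotient (SameCycle.setoid (subdivideRot rot)) :=
    Sum.elim (Quotient.map Sum.inl hmap) fun _ => ⟦.inr false⟧
  have hleft : ∀ x y : X ⊕ Bool, (subdivideRot rot).SameCycle x y → x.isLeft = y.isLeft :=
    fun x y h => by
      have := SameCycle.map_of_step (t := (1 : Perm Bool)) (φ := Sum.isLeft) (fun x => ?_) h
      · exact (sameCycle_one).1 this
      · rcases x with _ | _ <;> exact SameCycle.refl _ _
  have hF : Function.Bijective F := by
    constructor
    · rintro (a | ⟨⟩) (b | ⟨⟩) h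
      · induction a using Quotient.inductionOn with | _ a =>
        induction b using Quotient.inductionOn with | _ b =>
        have h' : (subdivideRot rot).SameCycle (.inl a : X ⊕ Bool) (.inl b) := Quotient.exact h
        refine congrArg Sum.inl (Quotient.sound ?_)
        exact SameCycle.map_of_step (φ := fun x : X ⊕ Bool => Sum.elim (fun d => d) (fun _ => a) x)
          (fun x => by
            rcases x with d | _
            · exact sameCycle_apply_right.2 (SameCycle.refl _ _)
            · exact SameCycle.refl _ _) h'
      · induction a using Quotient.inductionOn with | _ a =>
        exact absurd (hleft _ _ (Quotient.exact h)) (by simp)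
      · induction b using Quotient.inductionOn with | _ b =>
        exact absurd (hleft _ _ (Quotient.exact h)) (by simp)
      · rfl
    · intro q
      induction q using Quotient.inductionOn with | _ x =>
      rcases x with d | _ | _
      · exact ⟨.inl ⟦d⟧, rfl⟩
      · exact ⟨.inr (), rfl⟩
      · exact ⟨.inr (), Quotient.sound (sameCycle_apply_right.2 (SameCycle.refl _ _) :
          (subdivideRot rot).SameCycle (.inr false) (subdivideRot rot (.inr false)))⟩
  rw [← Nat.card_eq_of_bijective F hF, Nat.card_sum, Nat.card_unique (α := Unit)]

/-- The number of edges is half the number of flags, of which there are two more. -/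
theorem card_quotient_subdivideOpp [Finite X] :
    Nat.card (Quotient (SameCycle.setoid (subdivideOpp e hopp hne))) =
      Nat.card (Quotient (SameCycle.setoid opp)) + 1 := by
  have h1 := two_mul_card_quotient (subdivideOpp_opp e hopp hne) (subdivideOpp_ne e hopp hne)
  have h2 := two_mul_card_quotient hopp hne
  rw [Nat.card_sum, ← h2] at h1
  simp at h1
  omega

theorem connected_subdivide_iff [Finite X] :
    (∀ x y, ∃ w ∈ Subgroup.closure {subdivideRot rot, subdivideOpp e hopp hne}, w x = y) ↔
      ∀ d d', ∃ w ∈ Subgroup.closure {rot, opp}, w d = d' := by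
  rw [transitive_closure_pair_iff, transitive_closure_pair_iff]
  have hrot : ∀ d, subdivideRot rot (.inl d) = .inl (rot d) := fun _ => rfl
  constructor
  · intro h P d d' hr ho hd
    have ho' : ∀ d, P (opp d) → P d := fun d h => by
      have := ho _ h
      rwa [hopp] at this
    refine h (Sum.elim P fun _ => P e) (.inl d) (.inl d') ?_ ?_ hd
    · rintro (d | _) hd
      · exact hr d hd
      · exact hd
    · rintro (d | _ | _) hd
      · by_cases h1 : d = e
        · subst h1
          rw [subdivideOpp_self]
          exact hd
        · by_cases h2 : d = opp e
          · subst h2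
            rw [subdivideOpp_opp_self]
            exact ho' _ hd
          · rw [subdivideOpp_of_ne e hopp hne h1 h2]
            exact ho _ hd
      · exact ho _ hd
      · exact hd
  · intro h P x y hr ho hx
    have key : ∀ d, P (.inl d) → P (.inl (opp d)) := by
      intro d hd
      by_cases h1 : d = e
      · subst h1
        have := ho _ (hr _ (ho _ hd))
        rwa [subdivideOpp_self] at this
      · by_cases h2 : d = opp e
        · subst h2
          have := ho _ (hr _ (ho _ hd))
          rw [subdivideOpp_opp_self] at this
          rw [hopp]
          exact this
        · have := ho _ hd
          rwa [subdivideOpp_of_ne e hopp hne h1 h2] at this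
    have hall : ∀ d d', P (.inl d) → P (.inl d') := fun d d' hd =>
      h (fun d => P (.inl d)) d d' (fun d hd => hr _ hd) key hd
    have h1 : P (.inl e) := by
      rcases x with d | _ | _
      · exact hall _ _ hx
      · exact hall _ _ (ho _ hx)
      · exact hall _ _ (ho _ hx)
    rcases y with d | _ | _
    · exact hall _ _ h1
    · have := ho _ (hall _ (opp e) h1)
      rwa [subdivideOpp_opp_self] at this
    · have := ho _ h1
      rwa [subdivideOpp_self] at this

end Subdivision

end Equiv.Perm

namespace FatGraph

open Equiv.Perm

variable {g n : ℕ}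

/-- The insertion of a vertex of valence two into the edge of `e`. -/
noncomputable def subdivide (Γ : FatGraph g n) (e : Γ.Flag) : FatGraph g n where
  Flag := Γ.Flag ⊕ Bool
  rot := subdivideRot Γ.rot
  opp := subdivideOpp e Γ.opp_opp Γ.opp_ne
  opp_opp := subdivideOpp_opp e _ _
  opp_ne := subdivideOpp_ne e _ _
  rot_ne := by
    rintro (d | _ | _)
    · exact fun h => Γ.rot_ne d (Sum.inl_injective h)
    · exact fun h => Bool.noConfusion (Sum.inr_injective h)
    · exact fun h => Bool.noConfusion (Sum.inr_injective h)
  connected := (connected_subdivide_iff e _ _).2 Γ.connected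
  mark := fun x => Γ.mark (subdivideFold Γ.opp e x)
  mark_surjective := fun i => by
    obtain ⟨d, hd⟩ := Γ.mark_surjective i
    exact ⟨.inl d, hd⟩
  mark_eq_iff := fun x y => (Γ.mark_eq_iff _ _).trans (sameCycle_subdivide_iff e _ _ x y).symm
  euler := by
    have := Γ.euler
    rw [card_quotient_subdivideRot, card_quotient_subdivideOpp]
    push_cast
    linarith

/-- Every vertex of valence two which is not the vertex of a circle arises by insertion. -/
theorem exists_subdivide (Γ : FatGraph g n) (b : Γ.Flag) (hb : Γ.Bivalent b)
    (hb' : Γ.opp b ≠ Γ.rot b) : ∃ (Δ : FatGraph g n) (e : Δ.Flag)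
      (θ : (Δ.subdivide e).Flag ≃ Γ.Flag), (∀ d, Γ.rot (θ d) = θ ((Δ.subdivide e).rot d)) ∧
      (∀ d, Γ.opp (θ d) = θ ((Δ.subdivide e).opp d)) ∧
      (∀ d, Γ.mark (θ d) = (Δ.subdivide e).mark d) ∧ θ (.inr false) = b := by
  classical
  let X := {d : Γ.Flag // d ≠ b ∧ d ≠ Γ.rot b}
  let rot' : Equiv.Perm X := Γ.rot.subtypePerm fun d => by
    rw [and_comm]
    refine and_congr (not_congr Γ.rot.injective.eq_iff) (not_congr ⟨fun h => ?_, fun h => ?_⟩)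
    · exact Γ.rot.injective (h.trans hb.symm)
    · rw [h]
      exact hb
  let c : Γ.Flag := Γ.opp (Γ.rot b)
  have hc : c ≠ b ∧ c ≠ Γ.rot b := ⟨fun h => hb' ((congrArg Γ.opp h).symm.trans (Γ.opp_opp _)), Γ.opp_ne _⟩
  have hob : Γ.opp b ≠ b ∧ Γ.opp b ≠ Γ.rot b := ⟨Γ.opp_ne _, hb'⟩
  -- The flags `b` and `rot b` are deleted and their two edges merged, so `opp b` and `c` become
  -- opposite. The hypothesis `hb'` says that these edges are different, so that `opp b` and `c`
  -- survive.
  let oppF : X → X := fun d => if h : Γ.opp d.1 = b then ⟨c, hc⟩ else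
    if h' : Γ.opp d.1 = Γ.rot b then ⟨Γ.opp b, hob⟩ else ⟨Γ.opp d.1, h, h'⟩
  have o1 : ∀ d : X, Γ.opp d.1 = b → oppF d = ⟨c, hc⟩ := fun d h => dif_pos h
  have o2 : ∀ d : X, Γ.opp d.1 = Γ.rot b → oppF d = ⟨Γ.opp b, hob⟩ := fun d h =>
    (dif_neg (by rw [h]; exact Γ.rot_ne b)).trans (dif_pos h)
  have o3 : ∀ (d : X) (h : Γ.opp d.1 ≠ b) (h' : Γ.opp d.1 ≠ Γ.rot b),
      oppF d = ⟨Γ.opp d.1, h, h'⟩ := fun d h h' => (dif_neg h).trans (dif_neg h')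
  have hoppF : Function.Involutive oppF := by
    intro d
    by_cases h1 : Γ.opp d.1 = b
    · rw [o1 d h1, o2 _ (Γ.opp_opp _)]
      exact Subtype.ext ((congrArg Γ.opp h1).symm.trans (Γ.opp_opp _))
    · by_cases h2 : Γ.opp d.1 = Γ.rot b
      · rw [o2 d h2, o1 _ (Γ.opp_opp _)]
        exact Subtype.ext ((congrArg Γ.opp h2).symm.trans (Γ.opp_opp _))
      · rw [o3 d h1 h2, o3 _ (by rw [Γ.opp_opp]; exact d.2.1) (by rw [Γ.opp_opp]; exact d.2.2)]
        exact Subtype.ext (Γ.opp_opp _)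
  let opp' : Equiv.Perm X := hoppF.toPerm
  have hopp' : ∀ d, opp' (opp' d) = d := hoppF
  have hne' : ∀ d, opp' d ≠ d := by
    intro d h
    have h := congrArg Subtype.val h
    change (oppF d).1 = d.1 at h
    by_cases h1 : Γ.opp d.1 = b
    · rw [o1 d h1] at h
      have h3 : Γ.opp d.1 = Γ.rot b := (congrArg Γ.opp h).symm.trans (Γ.opp_opp _)
      exact Γ.rot_ne b (h3.symm.trans h1)
    · by_cases h2 : Γ.opp d.1 = Γ.rot b
      · rw [o2 d h2] at h
        have h3 : Γ.opp d.1 = b := (congrArg Γ.opp h).symm.trans (Γ.opp_opp _)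
        exact Γ.rot_ne b (h2.symm.trans h3)
      · rw [o3 d h1 h2] at h
        exact Γ.opp_ne _ h
  let e : X := ⟨c, hc⟩
  have he : opp' e = ⟨Γ.opp b, hob⟩ := o2 _ (Γ.opp_opp _)
  let F : X ⊕ Bool → Γ.Flag := Sum.elim Subtype.val fun i => if i then Γ.rot b else b
  have hF : Function.Bijective F := by
    constructor
    · rintro (d | _ | _) (d' | _ | _) h
      · exact congrArg Sum.inl (Subtype.ext h)
      · exact absurd h d.2.1
      · exact absurd h d.2.2
      · exact absurd h.symm d'.2.1
      · rfl
      · exact absurd h.symm (Γ.rot_ne b)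
      · exact absurd h.symm d'.2.2
      · exact absurd h (Γ.rot_ne b)
      · rfl
    · intro d
      by_cases h1 : d = b
      · exact ⟨.inr false, h1.symm⟩
      · by_cases h2 : d = Γ.rot b
        · exact ⟨.inr true, h2.symm⟩
        · exact ⟨.inl ⟨d, h1, h2⟩, rfl⟩
  let θ := Equiv.ofBijective F hF
  have hθr : ∀ x, Γ.rot (θ x) = θ (subdivideRot rot' x) := by
    rintro (d | _ | _)
    · rfl
    · rfl
    · exact hb
  have hθo : ∀ x, Γ.opp (θ x) = θ (subdivideOpp e hopp' hne' x) := by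
    rintro (d | _ | _)
    · by_cases h1 : d = e
      · rw [h1, subdivideOpp_self]
        exact Γ.opp_opp _
      · by_cases h2 : d = opp' e
        · rw [h2, subdivideOpp_opp_self, he]
          exact Γ.opp_opp _
        · rw [subdivideOpp_of_ne e hopp' hne' h1 h2]
          change Γ.opp d.1 = (oppF d).1
          rw [o3 d]
          · intro h
            exact h2 (he ▸ Subtype.ext ((Γ.opp_opp _).symm.trans (congrArg Γ.opp h)))
          · intro h
            exact h1 (Subtype.ext ((Γ.opp_opp _).symm.trans (congrArg Γ.opp h)))
    · change Γ.opp b = θ (.inl (opp' e))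
      rw [he]
      rfl
    · rfl
  have hθb : ∀ x, Γ.boundary (θ x) = θ ((subdivideRot rot' * subdivideOpp e hopp' hne') x) := by
    intro x
    rw [boundary_apply, hθo, hθr]
    rfl
  have hθs : ∀ x y, Γ.boundary.SameCycle (θ x) (θ y) ↔
      (subdivideRot rot' * subdivideOpp e hopp' hne').SameCycle x y := by
    refine fun x y => ⟨fun h => ?_, fun h => SameCycle.map_of_step (fun x => ?_) h⟩
    · have := SameCycle.map_of_step (φ := θ.symm)
        (t := subdivideRot rot' * subdivideOpp e hopp' hne') (fun z => ?_) h
      · simpa using this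
      · obtain ⟨x, rfl⟩ := θ.surjective z
        rw [hθb, Equiv.symm_apply_apply, Equiv.symm_apply_apply]
        exact sameCycle_apply_right.2 (SameCycle.refl _ _)
    · rw [← hθb]
      exact sameCycle_apply_right.2 (SameCycle.refl _ _)
  have hmark : ∀ x : X ⊕ Bool, Γ.mark (θ x) = Γ.mark (subdivideFold opp' e x).1 := by
    intro x
    refine (Γ.mark_eq_iff _ _).2 ?_
    refine (hθs x (.inl _)).2 ((sameCycle_subdivide_iff e hopp' hne' _ _).2 ?_)
    exact SameCycle.refl _ _
  let Δ : FatGraph g n :=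
    { Flag := X
      nonempty := ⟨e⟩
      rot := rot'
      opp := opp'
      opp_opp := hopp'
      opp_ne := hne'
      rot_ne := fun d h => Γ.rot_ne d.1 (congrArg Subtype.val h)
      connected := by
        rw [← connected_subdivide_iff e hopp' hne', transitive_closure_pair_iff]
        intro P x y hr ho hx
        have := Γ.induction_on_flags (P := fun d => P (θ.symm d)) (d := θ x)
          (by simpa using hx) (fun d hd => by
            obtain ⟨x, rfl⟩ := θ.surjective d
            rw [hθr, Equiv.symm_apply_apply]
            exact hr _ (by simpa using hd)) (fun d hd => by
            obtain ⟨x, rfl⟩ := θ.surjective d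
            rw [hθo, Equiv.symm_apply_apply]
            exact ho _ (by simpa using hd)) (θ y)
        simpa using this
      mark := fun d => Γ.mark d.1
      mark_surjective := fun i => by
        obtain ⟨d, hd⟩ := Γ.mark_surjective i
        obtain ⟨x, rfl⟩ := θ.surjective d
        exact ⟨subdivideFold opp' e x, (hmark x).symm.trans hd⟩
      mark_eq_iff := fun d d' => by
        rw [Γ.mark_eq_iff]
        exact (hθs (.inl d) (.inl d')).trans (sameCycle_subdivide_iff e hopp' hne' _ _)
      euler := by
        have := Γ.euler
        rw [← card_quotient_congr θ hθr, ← card_quotient_congr θ hθo,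
          card_quotient_subdivideRot, card_quotient_subdivideOpp] at this
        push_cast at this
        linarith }
  exact ⟨Δ, e, θ, hθr, hθo, hmark, rfl⟩

end FatGraph

/-! ### The cellular maps between a fat graph and its subdivisions -/

namespace FatGraph

open Equiv.Perm

variable {g n : ℕ} (Γ : FatGraph g n) (e : Γ.Flag)

/-- A flag of `Γ`, regarded as a flag of a subdivision. -/
def old (d : Γ.Flag) : (Γ.subdivide e).Flag := Sum.inl d

/-- The flag at the new vertex of a subdivision that continues the edge of `e`. -/
def new : (Γ.subdivide e).Flag := Sum.inr false

/-- The flag at the new vertex of a subdivision that points towards `e`. -/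
def new' : (Γ.subdivide e).Flag := Sum.inr true

theorem subdivide_cases (x : (Γ.subdivide e).Flag) :
    (∃ d, x = Γ.old e d) ∨ x = Γ.new e ∨ x = Γ.new' e := by
  rcases x with d | _ | _
  · exact Or.inl ⟨d, rfl⟩
  · exact Or.inr (Or.inl rfl)
  · exact Or.inr (Or.inr rfl)

theorem old_injective : Function.Injective (Γ.old e) := Sum.inl_injective

theorem old_ne_new (d : Γ.Flag) : Γ.old e d ≠ Γ.new e := Sum.inl_ne_inr

theorem old_ne_new' (d : Γ.Flag) : Γ.old e d ≠ Γ.new' e := Sum.inl_ne_inr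

theorem new_ne_new' : Γ.new e ≠ Γ.new' e := fun h => Bool.noConfusion (Sum.inr_injective h)

theorem rot_old (d : Γ.Flag) : (Γ.subdivide e).rot (Γ.old e d) = Γ.old e (Γ.rot d) := rfl

theorem rot_new : (Γ.subdivide e).rot (Γ.new e) = Γ.new' e := rfl

theorem rot_new' : (Γ.subdivide e).rot (Γ.new' e) = Γ.new e := rfl

theorem bivalent_new : (Γ.subdivide e).Bivalent (Γ.new e) := rfl

theorem opp_new : (Γ.subdivide e).opp (Γ.new e) = Γ.old e (Γ.opp e) := rfl

theorem opp_new' : (Γ.subdivide e).opp (Γ.new' e) = Γ.old e e := rfl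

theorem opp_old_self : (Γ.subdivide e).opp (Γ.old e e) = Γ.new' e :=
  subdivideOpp_self e Γ.opp_opp Γ.opp_ne

theorem opp_old_opp : (Γ.subdivide e).opp (Γ.old e (Γ.opp e)) = Γ.new e :=
  subdivideOpp_opp_self e Γ.opp_opp Γ.opp_ne

variable {Γ e} in
theorem opp_old_of_ne {d : Γ.Flag} (h : d ≠ e) (h' : d ≠ Γ.opp e) :
    (Γ.subdivide e).opp (Γ.old e d) = Γ.old e (Γ.opp d) :=
  subdivideOpp_of_ne e Γ.opp_opp Γ.opp_ne h h'

theorem boundary_old_self : (Γ.subdivide e).boundary (Γ.old e e) = Γ.new e := by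
  rw [boundary_apply, opp_old_self, rot_new']

theorem boundary_old_opp : (Γ.subdivide e).boundary (Γ.old e (Γ.opp e)) = Γ.new' e := by
  rw [boundary_apply, opp_old_opp, rot_new]

theorem boundary_new : (Γ.subdivide e).boundary (Γ.new e) = Γ.old e (Γ.boundary e) := rfl

theorem boundary_new' : (Γ.subdivide e).boundary (Γ.new' e) = Γ.old e (Γ.boundary (Γ.opp e)) := by
  rw [boundary_apply, opp_new', boundary_opp, rot_old]

variable {Γ e} in
theorem boundary_old_of_ne {d : Γ.Flag} (h : d ≠ e) (h' : d ≠ Γ.opp e) :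
    (Γ.subdivide e).boundary (Γ.old e d) = Γ.old e (Γ.boundary d) := by
  rw [boundary_apply, opp_old_of_ne h h', rot_old]
  rfl

variable {Γ e} in
theorem opp_ne_of_ne {d : Γ.Flag} (h : d ≠ e) (h' : d ≠ Γ.opp e) :
    Γ.opp d ≠ e ∧ Γ.opp d ≠ Γ.opp e :=
  ⟨fun h1 => h' ((Γ.opp_opp d).symm.trans (congrArg Γ.opp h1)), fun h1 => h (Γ.opp.injective h1)⟩

namespace CellMap

open Classical in
/-- The path in a subdivision that corresponds to an edge. -/
noncomputable def insertionPath (d : Γ.Flag) : List (Γ.subdivide e).Flag :=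
  if d = e then [Γ.old e e, Γ.new e] else if d = Γ.opp e then [Γ.old e (Γ.opp e), Γ.new' e]
  else [Γ.old e d]

theorem insertionPath_self : insertionPath Γ e e = [Γ.old e e, Γ.new e] := if_pos rfl

theorem insertionPath_opp : insertionPath Γ e (Γ.opp e) = [Γ.old e (Γ.opp e), Γ.new' e] :=
  (if_neg (Γ.opp_ne e)).trans (if_pos rfl)

variable {Γ e} in
theorem insertionPath_of_ne {d : Γ.Flag} (h : d ≠ e) (h' : d ≠ Γ.opp e) :
    insertionPath Γ e d = [Γ.old e d] := (if_neg h).trans (if_neg h')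

variable {Γ} in
theorem edge_cases (e d : Γ.Flag) : d = e ∨ d = Γ.opp e ∨ (d ≠ e ∧ d ≠ Γ.opp e) := by
  tauto

/-- The insertion of a vertex of valence two. -/
noncomputable def insertion : CellMap Γ (Γ.subdivide e) where
  onVertex := Γ.old e
  path := insertionPath Γ e
  walk d := by
    rcases edge_cases e d with rfl | rfl | ⟨h, h'⟩
    · rw [insertionPath_self]
      exact ⟨rfl, (boundary_old_self Γ d).symm, by rw [boundary_old_self, boundary_new]; rfl⟩
    · rw [insertionPath_opp]
      exact ⟨rfl, (boundary_old_opp Γ e).symm, by rw [boundary_old_opp, boundary_new']; rfl⟩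
    · rw [insertionPath_of_ne h h']
      exact ⟨rfl, boundary_old_of_ne h h'⟩
  nodup d := by
    rcases edge_cases e d with rfl | rfl | ⟨h, h'⟩
    · simp [insertionPath_self, old_ne_new]
    · simp [insertionPath_opp, old_ne_new']
    · simp [insertionPath_of_ne h h']
  cover y := by
    have hmem : ∀ d x, x ∈ insertionPath Γ e d → d = subdivideFold Γ.opp e x := by
      intro d x hx
      rcases edge_cases e d with rfl | rfl | ⟨h, h'⟩
      · rw [insertionPath_self] at hx
        rcases List.mem_pair.1 hx with rfl | rfl <;> rfl
      · rw [insertionPath_opp] at hx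
        rcases List.mem_pair.1 hx with rfl | rfl <;> rfl
      · rw [insertionPath_of_ne h h'] at hx
        rw [List.mem_singleton.1 hx]
        rfl
    refine ⟨subdivideFold Γ.opp e y, ?_, fun d hd => hmem d y hd⟩
    rcases Γ.subdivide_cases e y with ⟨d, rfl⟩ | rfl | rfl
    · change Γ.old e d ∈ insertionPath Γ e d
      rcases edge_cases e d with rfl | rfl | ⟨h, h'⟩
      · simp [insertionPath_self]
      · simp [insertionPath_opp]
      · simp [insertionPath_of_ne h h']
    · change Γ.new e ∈ insertionPath Γ e e
      simp [insertionPath_self]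
    · change Γ.new' e ∈ insertionPath Γ e (Γ.opp e)
      simp [insertionPath_opp]
  path_opp d := by
    rcases edge_cases e d with rfl | rfl | ⟨h, h'⟩
    · simp [insertionPath_self, insertionPath_opp, opp_new, opp_old_self]
    · simp [insertionPath_self, insertionPath_opp, opp_new', opp_old_opp, Γ.opp_opp]
    · rw [insertionPath_of_ne h h', insertionPath_of_ne (opp_ne_of_ne h h').1 (opp_ne_of_ne h h').2]
      simp [opp_old_of_ne h h']
  onVertex_rot d := (Γ.subdivide e).sameCycle_rot (Γ.old e d)
  mark_onVertex d := rfl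

theorem insertion_onVertex (d : Γ.Flag) : (insertion Γ e).onVertex d = Γ.old e d := rfl

theorem insertion_path_self : (insertion Γ e).path e = [Γ.old e e, Γ.new e] := insertionPath_self Γ e

theorem insertion_path_opp : (insertion Γ e).path (Γ.opp e) = [Γ.old e (Γ.opp e), Γ.new' e] :=
  insertionPath_opp Γ e

variable {Γ e} in
theorem insertion_path_of_ne {d : Γ.Flag} (h : d ≠ e) (h' : d ≠ Γ.opp e) :
    (insertion Γ e).path d = [Γ.old e d] := insertionPath_of_ne h h'

theorem insertion_path_ne_nil (d : Γ.Flag) : (insertion Γ e).path d ≠ [] := by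
  rcases edge_cases e d with rfl | rfl | ⟨h, h'⟩
  · simp [insertion_path_self]
  · simp [insertion_path_opp]
  · simp [insertion_path_of_ne h h']

theorem isGenerated_insertion : (insertion Γ e).IsGenerated :=
  .insert _ e (by rw [insertion_path_self]; rfl) fun d h h' => by rw [insertion_path_of_ne h h']; rfl

section Lift

variable {Γ e} {Δ : FatGraph g n} (h : CellMap Γ Δ) {l l' : List Δ.Flag} {a : Δ.Flag}
  (hl : h.path e = l ++ a :: l')

theorem path_opp_of_append (hl : h.path e = l ++ a :: l') :
    h.path (Γ.opp e) = (l'.map Δ.opp).reverse ++ Δ.opp a :: (l.map Δ.opp).reverse := by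
  rw [h.path_opp, hl]
  simp

open Classical in
variable (l l' a) in
/-- The paths of an extension of a cellular map to a subdivision. -/
noncomputable def subdivideLiftPath (x : (Γ.subdivide e).Flag) : List Δ.Flag :=
  match (x : Γ.Flag ⊕ Bool) with
  | .inl d => if d = e then l ++ [a] else if d = Γ.opp e then (l'.map Δ.opp).reverse else h.path d
  | .inr false => l'
  | .inr true => Δ.opp a :: (l.map Δ.opp).reverse

variable (a) in
/-- The corners of an extension of a cellular map to a subdivision. -/
def subdivideLiftVertex (x : (Γ.subdivide e).Flag) : Δ.Flag :=
  match (x : Γ.Flag ⊕ Bool) with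
  | .inl d => h.onVertex d
  | .inr false => Δ.boundary a
  | .inr true => Δ.opp a

theorem subdivideLiftPath_self : subdivideLiftPath h l l' a (Γ.old e e) = l ++ [a] := if_pos rfl

theorem subdivideLiftPath_opp :
    subdivideLiftPath h l l' a (Γ.old e (Γ.opp e)) = (l'.map Δ.opp).reverse :=
  (if_neg (Γ.opp_ne e)).trans (if_pos rfl)

theorem subdivideLiftPath_of_ne {d : Γ.Flag} (h1 : d ≠ e) (h2 : d ≠ Γ.opp e) :
    subdivideLiftPath h l l' a (Γ.old e d) = h.path d := (if_neg h1).trans (if_neg h2)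

theorem subdivideLiftPath_new : subdivideLiftPath h l l' a (Γ.new e) = l' := rfl

theorem subdivideLiftPath_new' :
    subdivideLiftPath h l l' a (Γ.new' e) = Δ.opp a :: (l.map Δ.opp).reverse := rfl

theorem isWalk_append_cons {Y : Type} {t : Equiv.Perm Y} {l l' : List Y} {x z a : Y}
    (h : IsWalk t x (l ++ a :: l') z) : IsWalk t x (l ++ [a]) (t a) ∧ IsWalk t (t a) l' z := by
  obtain ⟨y, h1, rfl, h2⟩ := isWalk_append_iff.1 h
  exact ⟨h1.append ⟨rfl, rfl⟩, h2⟩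

theorem isWalk_append_cons' {Y : Type} {t : Equiv.Perm Y} {l l' : List Y} {x z a : Y}
    (h : IsWalk t x (l ++ a :: l') z) : IsWalk t x l a ∧ IsWalk t a (a :: l') z := by
  obtain ⟨y, h1, rfl, h2⟩ := isWalk_append_iff.1 h
  exact ⟨h1, rfl, h2⟩

/-- The extension of a cellular map to a subdivision that sends the new vertex to a vertex in the
interior or at the end of the image of the subdivided edge. -/
noncomputable def subdivideLift : CellMap (Γ.subdivide e) Δ where
  onVertex := subdivideLiftVertex h a
  path := subdivideLiftPath h l l' a
  walk x := by
    rcases Γ.subdivide_cases e x with ⟨d, rfl⟩ | rfl | rfl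
    · rcases edge_cases e d with rfl | rfl | ⟨h1, h2⟩
      · rw [subdivideLiftPath_self, boundary_old_self]
        have := h.walk d
        rw [hl] at this
        exact (isWalk_append_cons this).1
      · rw [subdivideLiftPath_opp, boundary_old_opp]
        have := h.walk (Γ.opp e)
        rw [h.path_opp_of_append hl] at this
        exact (isWalk_append_cons' this).1
      · rw [subdivideLiftPath_of_ne h h1 h2, boundary_old_of_ne h1 h2]
        exact h.walk d
    · have := h.walk e
      rw [hl] at this
      exact (isWalk_append_cons this).2
    · rw [boundary_new']
      have := h.walk (Γ.opp e)
      rw [h.path_opp_of_append hl] at this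
      exact (isWalk_append_cons' this).2
  nodup x := by
    have h1 := h.nodup e
    have h2 := h.nodup (Γ.opp e)
    rw [hl] at h1
    rw [h.path_opp_of_append hl] at h2
    rcases Γ.subdivide_cases e x with ⟨d, rfl⟩ | rfl | rfl
    · rcases edge_cases e d with rfl | rfl | ⟨h3, h4⟩
      · rw [subdivideLiftPath_self]
        rw [← List.singleton_append, ← List.append_assoc] at h1
        exact h1.of_append_left
      · rw [subdivideLiftPath_opp]
        exact h2.of_append_left
      · rw [subdivideLiftPath_of_ne h h3 h4]
        exact h.nodup d
    · exact (List.nodup_cons.1 h1.of_append_right).2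
    · exact h2.of_append_right
  cover y := by
    obtain ⟨d, hd, hd'⟩ := h.cover y
    have hfold : ∀ x : (Γ.subdivide e).Flag, y ∈ subdivideLiftPath h l l' a x →
        subdivideFold Γ.opp e x = d := by
      refine fun x hx => hd' _ ?_
      rcases Γ.subdivide_cases e x with ⟨d, rfl⟩ | rfl | rfl
      · change y ∈ h.path d
        rcases edge_cases e d with rfl | rfl | ⟨h3, h4⟩
        · rw [subdivideLiftPath_self] at hx
          rw [hl]
          simp at hx ⊢
          tauto
        · rw [subdivideLiftPath_opp] at hx
          rw [h.path_opp_of_append hl]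
          exact List.mem_append_left _ hx
        · rwa [subdivideLiftPath_of_ne h h3 h4] at hx
      · change y ∈ h.path e
        rw [subdivideLiftPath_new] at hx
        rw [hl]
        simp [hx]
      · change y ∈ h.path (Γ.opp e)
        rw [subdivideLiftPath_new'] at hx
        rw [h.path_opp_of_append hl]
        exact List.mem_append_right _ hx
    have hcases : ∀ x : (Γ.subdivide e).Flag, subdivideFold Γ.opp e x = d →
        x = Γ.old e d ∨ (d = e ∧ x = Γ.new e) ∨ (d = Γ.opp e ∧ x = Γ.new' e) := by
      intro x hx
      rcases Γ.subdivide_cases e x with ⟨d', rfl⟩ | rfl | rfl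
      · exact Or.inl (congrArg (Γ.old e) hx)
      · exact Or.inr (Or.inl ⟨hx.symm, rfl⟩)
      · exact Or.inr (Or.inr ⟨hx.symm, rfl⟩)
    have hn := h.nodup d
    rcases edge_cases e d with rfl | rfl | ⟨h3, h4⟩
    · rw [hl] at hd hn
      have hdisj := List.disjoint_of_nodup_append (l₁ := l ++ [a]) (l₂ := l') (by simpa using hn)
      have hd1 : y ∈ l ++ [a] ∨ y ∈ l' := by
        simp at hd ⊢
        tauto
      have hx2 : ∀ x, y ∈ subdivideLiftPath h l l' a x → x = Γ.old d d ∨ x = Γ.new d := by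
        intro x hx
        rcases hcases x (hfold x hx) with h1 | h1 | h1
        · exact Or.inl h1
        · exact Or.inr h1.2
        · exact absurd h1.1.symm (Γ.opp_ne d)
      rcases hd1 with hy | hy
      · refine ⟨Γ.old d d, ?_, fun x hx => (hx2 x hx).resolve_right fun hx' => ?_⟩
        · exact (congrArg (y ∈ ·) (subdivideLiftPath_self h)).mpr hy
        · rw [hx', subdivideLiftPath_new] at hx
          exact hdisj hy hx
      · refine ⟨Γ.new d, hy, fun x hx => (hx2 x hx).resolve_left fun hx' => ?_⟩
        rw [hx', subdivideLiftPath_self] at hx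
        exact hdisj hx hy
    · rw [h.path_opp_of_append hl] at hd hn
      have hdisj := List.disjoint_of_nodup_append hn
      have hx2 : ∀ x, y ∈ subdivideLiftPath h l l' a x →
          x = Γ.old e (Γ.opp e) ∨ x = Γ.new' e := by
        intro x hx
        rcases hcases x (hfold x hx) with h1 | h1 | h1
        · exact Or.inl h1
        · exact absurd h1.1 (Γ.opp_ne e)
        · exact Or.inr h1.2
      rcases List.mem_append.1 hd with hy | hy
      · refine ⟨Γ.old e (Γ.opp e), ?_, fun x hx => (hx2 x hx).resolve_right fun hx' => ?_⟩
        · exact (congrArg (y ∈ ·) (subdivideLiftPath_opp h)).mpr hy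
        · rw [hx', subdivideLiftPath_new'] at hx
          exact hdisj hy hx
      · refine ⟨Γ.new' e, hy, fun x hx => (hx2 x hx).resolve_left fun hx' => ?_⟩
        rw [hx', subdivideLiftPath_opp] at hx
        exact hdisj hx hy
    · refine ⟨Γ.old e d, ?_, fun x hx => ?_⟩
      · exact (congrArg (y ∈ ·) (subdivideLiftPath_of_ne h h3 h4)).mpr hd
      · rcases hcases x (hfold x hx) with h1 | h1 | h1
        · exact h1
        · exact absurd h1.1 h3
        · exact absurd h1.1 h4
  path_opp x := by
    have hopp : ∀ k : List Δ.Flag, (k.map Δ.opp).map Δ.opp = k := fun k => by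
      simp [Function.comp_def, Δ.opp_opp]
    rcases Γ.subdivide_cases e x with ⟨d, rfl⟩ | rfl | rfl
    · rcases edge_cases e d with rfl | rfl | ⟨h1, h2⟩
      · rw [opp_old_self, subdivideLiftPath_self, subdivideLiftPath_new']
        simp
      · rw [opp_old_opp, subdivideLiftPath_opp, subdivideLiftPath_new, List.map_reverse,
          List.reverse_reverse, hopp]
      · rw [opp_old_of_ne h1 h2, subdivideLiftPath_of_ne h h1 h2,
          subdivideLiftPath_of_ne h (opp_ne_of_ne h1 h2).1 (opp_ne_of_ne h1 h2).2, h.path_opp]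
    · rw [opp_new, subdivideLiftPath_opp, subdivideLiftPath_new]
    · rw [opp_new', subdivideLiftPath_self, subdivideLiftPath_new', List.map_cons,
        List.reverse_cons, List.map_reverse, List.reverse_reverse, hopp, Δ.opp_opp]
  onVertex_rot x := by
    rcases Γ.subdivide_cases e x with ⟨d, rfl⟩ | rfl | rfl
    · exact h.onVertex_rot d
    · exact (Δ.sameCycle_rot (Δ.opp a)).symm
    · exact Δ.sameCycle_rot (Δ.opp a)
  mark_onVertex x := by
    have ha : a ∈ h.path e := by simp [hl]
    rcases Γ.subdivide_cases e x with ⟨d, rfl⟩ | rfl | rfl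
    · exact h.mark_onVertex d
    · exact (Δ.mark_boundary a).trans (h.mark_path ha)
    · exact h.mark_path (h.opp_mem_path_opp ha)

theorem subdivideLift_new : (h.subdivideLift hl).onVertex (Γ.new e) = Δ.boundary a := rfl

theorem subdivideLift_new' : (h.subdivideLift hl).onVertex (Γ.new' e) = Δ.opp a := rfl

theorem subdivideLift_path_self : (h.subdivideLift hl).path (Γ.old e e) = l ++ [a] :=
  subdivideLiftPath_self h

theorem subdivideLift_path_opp :
    (h.subdivideLift hl).path (Γ.old e (Γ.opp e)) = (l'.map Δ.opp).reverse :=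
  subdivideLiftPath_opp h

theorem subdivideLift_path_of_ne {d : Γ.Flag} (h1 : d ≠ e) (h2 : d ≠ Γ.opp e) :
    (h.subdivideLift hl).path (Γ.old e d) = h.path d := subdivideLiftPath_of_ne h h1 h2

theorem subdivideLift_path_new : (h.subdivideLift hl).path (Γ.new e) = l' := rfl

theorem subdivideLift_path_new' :
    (h.subdivideLift hl).path (Γ.new' e) = Δ.opp a :: (l.map Δ.opp).reverse := rfl

theorem insertion_comp_subdivideLift : (insertion Γ e).comp (h.subdivideLift hl) = h := by
  refine ext_path fun d => ?_
  rw [comp_path]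
  rcases edge_cases e d with rfl | rfl | ⟨h1, h2⟩
  · rw [insertion_path_self, hl]
    simp [subdivideLift_path_self, subdivideLift_path_new]
  · rw [insertion_path_opp, h.path_opp_of_append hl]
    simp [subdivideLift_path_opp, subdivideLift_path_new']
  · rw [insertion_path_of_ne h1 h2]
    simp [subdivideLift_path_of_ne h hl h1 h2]

end Lift

/-- The shrinking of one half of a subdivided edge. -/
noncomputable def contraction : CellMap (Γ.subdivide e) Γ :=
  (CellMap.id Γ).subdivideLift (e := e) (l := []) (a := e) (l' := []) rfl

theorem contraction_old (d : Γ.Flag) : (contraction Γ e).onVertex (Γ.old e d) = d := rfl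

theorem contraction_path_self : (contraction Γ e).path (Γ.old e e) = [e] :=
  subdivideLift_path_self _ _

theorem contraction_path_opp : (contraction Γ e).path (Γ.old e (Γ.opp e)) = [] :=
  subdivideLift_path_opp _ _

theorem contraction_path_new : (contraction Γ e).path (Γ.new e) = [] := rfl

theorem contraction_path_new' : (contraction Γ e).path (Γ.new' e) = [Γ.opp e] := rfl

variable {Γ e} in
theorem contraction_path_of_ne {d : Γ.Flag} (h : d ≠ e) (h' : d ≠ Γ.opp e) :
    (contraction Γ e).path (Γ.old e d) = [d] :=
  subdivideLift_path_of_ne _ _ h h'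

theorem contraction_path_eq_nil {x : (Γ.subdivide e).Flag} :
    (contraction Γ e).path x = [] ↔ x = Γ.new e ∨ x = Γ.old e (Γ.opp e) := by
  constructor
  · rcases Γ.subdivide_cases e x with ⟨d, rfl⟩ | rfl | rfl
    · rcases edge_cases e d with rfl | rfl | ⟨h, h'⟩
      · simp [contraction_path_self]
      · exact fun _ => Or.inr rfl
      · simp [contraction_path_of_ne h h']
    · exact fun _ => Or.inl rfl
    · simp [contraction_path_new']
  · rintro (rfl | rfl)
    · exact contraction_path_new Γ e
    · exact contraction_path_opp Γ e

theorem isGenerated_contraction : (contraction Γ e).IsGenerated := by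
  refine .shrink _ (Γ.new e) (fun h => ?_) rfl fun x h h' => ?_
  · rcases (Γ.bivalent_new e).eq_or_eq h with h | h
    · exact (Γ.subdivide e).opp_ne _ h
    · exact old_ne_new' _ _ _ h
  · rcases Γ.subdivide_cases e x with ⟨d, rfl⟩ | rfl | rfl
    · rcases edge_cases e d with rfl | rfl | ⟨h, h'⟩
      · simp [contraction_path_self]
      · exact absurd rfl h'
      · simp [contraction_path_of_ne h h']
    · exact absurd rfl h
    · rfl

theorem insertion_comp_contraction : (insertion Γ e).comp (contraction Γ e) = CellMap.id Γ :=
  insertion_comp_subdivideLift _ _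

-- A map that shrinks the half `Γ.new e` of the subdivided edge factors through the contraction. As
-- the insertion is a section, the other factor has to be the restriction along the insertion.
variable {Γ e} in
theorem contraction_comp_insertion_comp {Δ : FatGraph g n} (h : CellMap (Γ.subdivide e) Δ)
    (hh : h.path (Γ.new e) = []) :
    (contraction Γ e).comp ((insertion Γ e).comp h) = h := by
  have hh' : h.path (Γ.old e (Γ.opp e)) = [] := by
    have := h.path_opp_eq_nil hh
    rwa [opp_new] at this
  refine ext_path fun x => ?_
  rw [comp_path]
  rcases Γ.subdivide_cases e x with ⟨d, rfl⟩ | rfl | rfl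
  · rcases edge_cases e d with rfl | rfl | ⟨h1, h2⟩
    · simp [contraction_path_self, comp_path, insertion_path_self, hh]
    · simp [contraction_path_opp, hh']
    · simp [contraction_path_of_ne h1 h2, comp_path, insertion_path_of_ne h1 h2]
  · simp [contraction_path_new, hh]
  · simp [contraction_path_new', comp_path, insertion_path_opp, hh']

end CellMap

end FatGraph

/-! ### Rigidity of maps of polygons -/

theorem IsWalk.exists_append {Y : Type} {t : Equiv.Perm Y} {l l' : List Y} {x z z' : Y}
    (h : IsWalk t x l z) (h' : IsWalk t x l' z') (hl : l.length ≤ l'.length) :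
    ∃ r, l' = l ++ r := by
  induction l generalizing x l' with
  | nil => exact ⟨l', rfl⟩
  | cons a l ih =>
    cases l' with
    | nil => simp at hl
    | cons a' l' =>
      obtain ⟨rfl, h⟩ := h
      obtain ⟨rfl, h'⟩ := h'
      obtain ⟨r, rfl⟩ := ih h h' (by simpa using hl)
      exact ⟨r, rfl⟩

namespace PolygonMap

variable {X Y Z W M : Type} {s : Equiv.Perm X} {t : Equiv.Perm Y} {u : Equiv.Perm Z}
  {w : Equiv.Perm W}

theorem comp_assoc (f : PolygonMap s t) (g : PolygonMap t u) (h : PolygonMap u w) :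
    (f.comp g).comp h = f.comp (g.comp h) :=
  PolygonMap.ext rfl (funext fun _ => List.flatMap_assoc)

theorem comp_id (f : PolygonMap s t) : f.comp (PolygonMap.id t) = f :=
  PolygonMap.ext rfl (funext fun x => by simp [PolygonMap.comp, PolygonMap.id])

theorem id_comp (f : PolygonMap s t) : (PolygonMap.id s).comp f = f :=
  PolygonMap.ext rfl (funext fun x => by simp [PolygonMap.comp, PolygonMap.id])

/-- The shorter of two walks with the same start is a prefix of the longer one. If it were proper,
the next edge `a` would start at the image of `s x`, where under `f`, hence also under `h`, the next
nonconstant path begins. This path has to be the path `x` of `h`, which would then contain `a`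
twice. -/
theorem ext_path_of_length_le [Finite X] {m : Y → M} (hm : ∀ y, m (t y) = m y)
    {f h : PolygonMap s t}
    (hs : ∀ x x', m (f.onVertex x) = m (f.onVertex x') → s.SameCycle x x')
    (hv : ∀ x, f.onVertex x = h.onVertex x) (hn : ∀ x, h.path x = [] → f.path x = [])
    (hn' : ∀ x, f.path x = [] → h.path x = [])
    {x : X} (hl : (f.path x).length ≤ (h.path x).length) : f.path x = h.path x := by
  obtain ⟨r, hr⟩ := (f.walk x).exists_append (by rw [hv]; exact h.walk x) hl
  cases r with
  | nil => rw [hr, List.append_nil]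
  | cons a r =>
    have ha : a = f.onVertex (s x) := by
      have h1 := h.walk x
      rw [hr, ← hv] at h1
      obtain ⟨y, h1, h2, -⟩ := isWalk_append_iff.1 h1
      exact h2.trans (h1.unique (f.walk x))
    obtain ⟨x', hx', -⟩ := f.cover a
    have hsc : s.SameCycle (s x) x' := hs _ _ (by
      rw [← ha]
      exact ((f.walk x').const hm).2 a hx')
    obtain ⟨k, hk, hk', -⟩ := f.exists_pow_of_mem hsc (ha ▸ hx')
    have h2 := h.onVertex_pow fun j hj => hn' _ (hk' j hj)
    rw [hk, ← hv, ← hv, ← ha] at h2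
    have h3 : a ∈ h.path x' := by
      rw [← h2, hv]
      exact h.onVertex_mem fun h' => List.ne_nil_of_mem hx' (hn _ h')
    have h4 : x' = x := h.eq_of_mem h3 (by rw [hr]; simp)
    subst h4
    obtain ⟨c, l, hc⟩ := List.exists_cons_of_ne_nil fun h' => List.ne_nil_of_mem h3 (hn' _ h')
    have h5 := f.head_eq hc
    have h6 := h.nodup x'
    rw [hr, hc, ← h5, h2] at h6
    simp at h6

/-- A map of polygons is determined by the images of the vertices and by the set of the edges that
are shrunk to a vertex. -/
theorem ext_of_onVertex [Finite X] {m : Y → M} (hm : ∀ y, m (t y) = m y) {f h : PolygonMap s t}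
    (hs : ∀ x x', m (f.onVertex x) = m (f.onVertex x') → s.SameCycle x x')
    (hv : ∀ x, f.onVertex x = h.onVertex x) (hn : ∀ x, f.path x = [] ↔ h.path x = []) :
    f = h := by
  refine PolygonMap.ext (funext hv) (funext fun x => ?_)
  rcases le_total (f.path x).length (h.path x).length with hl | hl
  · exact ext_path_of_length_le hm hs hv (fun x => (hn x).2) (fun x => (hn x).1) hl
  · refine (ext_path_of_length_le hm ?_ (fun x => (hv x).symm) (fun x => (hn x).1)
      (fun x => (hn x).2) hl).symm
    intro x x'
    rw [← hv, ← hv]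
    exact hs x x'

end PolygonMap

/-! ### Lifting maps to subdivisions -/

namespace FatGraph

open CellMap

variable {g n : ℕ} {Γ : FatGraph g n} {e : Γ.Flag}

/-- The path `x` of `h` could only consist of the two orientations of the shrunk half edge. Arriving
by one of them means ending at the excluded corner `Γ.new' e`; following only the other one changes
the corner, whereas `f` has the same corner at both ends. -/
theorem path_eq_nil_of_comp_contraction {X : Type} {s : Equiv.Perm X}
    {f h : PolygonMap s (Γ.subdivide e).boundary} (hv : ∀ x, f.onVertex x = h.onVertex x)
    (hz : ∀ x, f.onVertex x ≠ Γ.new' e)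
    (hq : f.comp (contraction Γ e).toPolygonMap = h.comp (contraction Γ e).toPolygonMap)
    {x : X} (hx : f.path x = []) : h.path x = [] := by
  have h1 : ∀ a ∈ h.path x, a = Γ.new e ∨ a = Γ.old e (Γ.opp e) := by
    intro a ha
    have h2 := congrArg (fun k => k.path x) hq
    simp only [PolygonMap.comp_path, hx, List.flatMap_nil] at h2
    exact (contraction_path_eq_nil Γ e).1 (List.flatMap_eq_nil_iff.1 h2.symm a ha)
  by_contra hne
  obtain ⟨l, a, hl⟩ := List.eq_nil_or_concat'  (h.path x) |>.resolve_left hne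
  have h2 := h.apply_last hl
  rcases h1 a (by rw [hl]; simp) with rfl | rfl
  · rcases List.eq_nil_or_concat' l with rfl | ⟨l, b, rfl⟩
    · have h3 := h.head_eq hl
      rw [← hv] at h3 h2
      have h4 := f.onVertex_of_nil hx
      rw [h3, ← h2, boundary_new] at h4
      exact old_ne_new _ _ _ h4
    · rw [List.append_assoc] at hl
      have h3 := h.apply_of_append hl
      rcases h1 b (by rw [hl]; simp) with rfl | rfl
      · exact old_ne_new _ _ _ ((boundary_new Γ e).symm.trans h3)
      · exact new_ne_new' Γ e (h3.symm.trans (boundary_old_opp Γ e))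
  · rw [boundary_old_opp, ← hv] at h2
    exact hz _ h2.symm

/-- Maps of polygons to a subdivision which do not meet one of the two new corners. -/
theorem ext_of_comp_contraction {X : Type} [Finite X] {s : Equiv.Perm X}
    {f h : PolygonMap s (Γ.subdivide e).boundary}
    (hs : ∀ x x', (Γ.subdivide e).mark (f.onVertex x) = (Γ.subdivide e).mark (f.onVertex x') →
      s.SameCycle x x') (hv : ∀ x, f.onVertex x = h.onVertex x)
    (hz : ∀ x, f.onVertex x ≠ Γ.new' e)
    (hq : f.comp (contraction Γ e).toPolygonMap = h.comp (contraction Γ e).toPolygonMap) :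
    f = h :=
  PolygonMap.ext_of_onVertex (Γ.subdivide e).mark_boundary hs hv fun _ =>
    ⟨path_eq_nil_of_comp_contraction hv hz hq,
      path_eq_nil_of_comp_contraction (fun x => (hv x).symm) (fun x => hv x ▸ hz x) hq.symm⟩

/-- If no corner goes to the inserted vertex, this vertex can be removed and reinserted: both maps
agree on corners, avoid `Γ.new' e`, and agree after the contraction. -/
theorem comp_contraction_comp_insertion {X : Type} [Finite X] {s : Equiv.Perm X}
    {f : PolygonMap s (Γ.subdivide e).boundary}
    (hs : ∀ x x', (Γ.subdivide e).mark (f.onVertex x) = (Γ.subdivide e).mark (f.onVertex x') →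
      s.SameCycle x x')
    (hz : ∀ x, f.onVertex x ≠ Γ.new e) (hz' : ∀ x, f.onVertex x ≠ Γ.new' e) :
    (f.comp (contraction Γ e).toPolygonMap).comp (insertion Γ e).toPolygonMap = f := by
  refine (ext_of_comp_contraction hs (fun x => ?_) hz' ?_).symm
  · rcases Γ.subdivide_cases e (f.onVertex x) with ⟨d, hd⟩ | hd | hd
    · simp only [PolygonMap.comp_onVertex, hd, contraction_old, insertion_onVertex]
    · exact absurd hd (hz x)
    · exact absurd hd (hz' x)
  · have h1 : (insertion Γ e).toPolygonMap.comp (contraction Γ e).toPolygonMap =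
        PolygonMap.id _ := congrArg CellMap.toPolygonMap (insertion_comp_contraction Γ e)
    rw [PolygonMap.comp_assoc _ _ (contraction Γ e).toPolygonMap, h1, PolygonMap.comp_id]

namespace CellMap

variable {Δ : FatGraph g n}

theorem length_flatMap_insertion {ε : Δ.Flag} {l : List Δ.Flag}
    (hl : ∀ c ∈ l, c ≠ ε ∧ c ≠ Δ.opp ε) :
    (l.flatMap (insertion Δ ε).path).length = l.length := by
  induction l with
  | nil => rfl
  | cons a l ih =>
    have ha := hl a List.mem_cons_self
    rw [List.flatMap_cons, List.length_append, insertion_path_of_ne ha.1 ha.2,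
      ih fun c hc => hl c (List.mem_cons_of_mem _ hc)]
    simp [add_comm]

/-- The new vertex of the source is sent to the new vertex on `ε`. The lengths decide later that `k`
is a generator of the same kind as `f`; here `i` and `j` count the edges of the path before and
after `ε`. -/
theorem exists_subdivide_of_length_le (f : CellMap Γ Δ) {ε : Δ.Flag} (hε : ε ∈ f.path e)
    (hle : (f.path e).length ≤ 2) : ∃ k : CellMap (Γ.subdivide e) (Δ.subdivide ε),
      (insertion Γ e).comp k = f.comp (insertion Δ ε) ∧ k.onVertex (Γ.new e) = Δ.new ε ∧
      k.onVertex (Γ.new' e) = Δ.new' ε ∧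
      (∀ d, d ≠ e → d ≠ Γ.opp e → (k.path (Γ.old e d)).length = (f.path d).length) ∧
      ∃ i j, i + j + 1 = (f.path e).length ∧ (k.path (Γ.old e e)).length = i + 1 ∧
        (k.path (Γ.new e)).length = j + 1 := by
  obtain ⟨l, l', hl⟩ := List.append_of_mem hε
  -- If the path of `e` passed `ε` in both directions, the subdivision would lengthen it twice. For
  -- length two that would be a turn, and `rot` would have a fixed flag.
  have hbar : Δ.opp ε ∉ f.path e := by
    intro h
    rcases hp : f.path e with _ | ⟨a, _ | ⟨b, _ | ⟨c, r⟩⟩⟩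
    · simp [hp] at h
    · rw [hp, List.mem_singleton] at h hε
      exact Δ.opp_ne ε (h.trans hε.symm)
    · have hb := (f.bivalent_of_append (l := []) hp).1
      rw [hp, List.mem_pair] at h hε
      rcases hε with rfl | rfl
      · rcases h with h | h
        · exact Δ.opp_ne _ h
        · exact Δ.rot_ne b (hb.trans h)
      · rcases h with h | h
        · exact Δ.rot_ne ε (hb.trans (by rw [← h, Δ.opp_opp]))
        · exact Δ.opp_ne _ h
    · rw [hp] at hle
      simp at hle
  have hnd := f.nodup e
  rw [hl] at hnd hbar
  have h1 : ∀ c ∈ l, c ≠ ε ∧ c ≠ Δ.opp ε := fun c hc => ⟨fun h =>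
    List.disjoint_of_nodup_append hnd hc (h ▸ List.mem_cons_self),
    fun h => hbar (List.mem_append_left _ (h ▸ hc))⟩
  have h2 : ∀ c ∈ l', c ≠ ε ∧ c ≠ Δ.opp ε := fun c hc => ⟨fun h =>
    (List.nodup_cons.1 hnd.of_append_right).1 (h ▸ hc),
    fun h => hbar (List.mem_append_right _ (List.mem_cons_of_mem _ (h ▸ hc)))⟩
  have hl' : (f.comp (insertion Δ ε)).path e = l.flatMap (insertion Δ ε).path ++
      Δ.old ε ε :: (Δ.new ε :: l'.flatMap (insertion Δ ε).path) := by
    rw [comp_path, hl, List.flatMap_append, List.flatMap_cons, insertion_path_self]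
    rfl
  refine ⟨(f.comp (insertion Δ ε)).subdivideLift hl', insertion_comp_subdivideLift _ hl', ?_, ?_,
    fun d h3 h4 => ?_, l.length, l'.length, ?_, ?_, ?_⟩
  · rw [subdivideLift_new, boundary_old_self]
  · rw [subdivideLift_new', opp_old_self]
  · rw [subdivideLift_path_of_ne _ hl' h3 h4, comp_path, length_flatMap_insertion]
    refine fun c hc => ⟨?_, ?_⟩
    · rintro rfl
      exact h3 (f.eq_of_mem hc hε)
    · rintro rfl
      exact h4 (f.eq_of_mem hc (f.opp_mem_path_opp hε))
  · rw [hl]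
    simp
    omega
  · rw [subdivideLift_path_self, List.length_append, length_flatMap_insertion h1]
    rfl
  · rw [subdivideLift_path_new, List.length_cons, length_flatMap_insertion h2]

/-- The subdivision of the source and of the target of a cellular map. -/
theorem IsGenerated.exists_subdivide {f : CellMap Γ Δ} (hf : f.IsGenerated) {ε : Δ.Flag}
    (hε : ε ∈ f.path e) : ∃ k : CellMap (Γ.subdivide e) (Δ.subdivide ε), k.IsGenerated ∧
      (insertion Γ e).comp k = f.comp (insertion Δ ε) ∧ k.onVertex (Γ.new e) = Δ.new ε ∧
      k.onVertex (Γ.new' e) = Δ.new' ε := by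
  have hpos : ∀ {Γ Δ : FatGraph g n} {f : CellMap Γ Δ} {e : Γ.Flag} {ε : Δ.Flag},
      ε ∈ f.path e → 1 ≤ (f.path e).length := fun h => List.length_pos_of_mem h
  have hopp : ∀ {Γ Δ : FatGraph g n} {e : Γ.Flag} {k : CellMap (Γ.subdivide e) Δ},
      (k.path (Γ.new' e)).length = (k.path (Γ.old e e)).length ∧
      (k.path (Γ.old e (Γ.opp e))).length = (k.path (Γ.new e)).length := by
    intro Γ Δ e k
    have h1 := k.length_path_opp (Γ.old e e)
    have h2 := k.length_path_opp (Γ.new e)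
    rw [opp_old_self] at h1
    rw [opp_new] at h2
    exact ⟨h1, h2⟩
  induction hf with
  | iso f h =>
    obtain ⟨k, h1, h2, h3, h4, i, j, h5, h6, h7⟩ :=
      f.exists_subdivide_of_length_le hε (by rw [h]; omega)
    refine ⟨k, .iso k fun x => ?_, h1, h2, h3⟩
    have h8 := h e
    rcases subdivide_cases _ e x with ⟨d, rfl⟩ | rfl | rfl
    · rcases edge_cases e d with rfl | rfl | ⟨h', h''⟩
      · omega
      · rw [hopp.2]
        omega
      · rw [h4 d h' h'', h]
    · omega
    · rw [hopp.1]
      omega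
  | @shrink Γ Δ f e₀ hloop he h =>
    have hp := hpos hε
    have hne : e ≠ e₀ := by
      rintro rfl
      omega
    have hne' : e ≠ Γ.opp e₀ := by
      rintro rfl
      rw [f.length_path_opp] at hp
      omega
    have hne1 : e₀ ≠ Γ.opp e := by
      rintro rfl
      exact hne' (Γ.opp_opp e).symm
    have h8 := h e hne hne'
    obtain ⟨k, h1, h2, h3, h4, i, j, h5, h6, h7⟩ :=
      f.exists_subdivide_of_length_le hε (by omega)
    refine ⟨k, .shrink k (Γ.old e e₀) (fun hl => hloop ?_) ?_ fun x hx hx' => ?_, h1, h2, h3⟩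
    · rw [opp_old_of_ne hne.symm hne1] at hl
      exact (contraction Γ e).sameCycle hl
    · rw [h4 _ hne.symm hne1, he]
    · rcases subdivide_cases _ e x with ⟨d, rfl⟩ | rfl | rfl
      · rcases edge_cases e d with rfl | rfl | ⟨h', h''⟩
        · omega
        · rw [hopp.2]
          omega
        · rw [h4 d h' h'']
          refine h d (fun hd => hx (by rw [hd])) fun hd => hx' ?_
          rw [opp_old_of_ne hne.symm hne1, hd]
      · omega
      · rw [hopp.1]
        omega
  | @insert Γ Δ f e₀ he h =>
    by_cases hee : e = e₀ ∨ e = Γ.opp e₀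
    · have h8 : (f.path e).length = 2 := by
        rcases hee with rfl | rfl
        · exact he
        · rw [f.length_path_opp, he]
      have h9 : ∀ d, d ≠ e → d ≠ Γ.opp e → (f.path d).length = 1 := by
        rcases hee with rfl | rfl
        · exact h
        · rw [Γ.opp_opp]
          exact fun d h1 h2 => h d h2 h1
      obtain ⟨k, h1, h2, h3, h4, i, j, h5, h6, h7⟩ :=
        f.exists_subdivide_of_length_le hε (by omega)
      refine ⟨k, ?_, h1, h2, h3⟩
      -- The vertex inserted by `f` lies before the middle of `ε` if `ε` is the second edge of the
      -- path, and after it otherwise; accordingly `k` inserts it into the first or the second half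
      -- of `e`.
      by_cases hi : i = 1
      · refine .insert k (Γ.old e e) (by omega) fun x hx hx' => ?_
        rcases subdivide_cases _ e x with ⟨d, rfl⟩ | rfl | rfl
        · rcases edge_cases e d with rfl | rfl | ⟨h', h''⟩
          · exact absurd rfl hx
          · rw [hopp.2]
            omega
          · rw [h4 d h' h'', h9 d h' h'']
        · omega
        · exact absurd (opp_old_self Γ e).symm hx'
      · refine .insert k (Γ.new e) (by omega) fun x hx hx' => ?_
        rcases subdivide_cases _ e x with ⟨d, rfl⟩ | rfl | rfl
        · rcases edge_cases e d with rfl | rfl | ⟨h', h''⟩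
          · omega
          · exact absurd rfl hx'
          · rw [h4 d h' h'', h9 d h' h'']
        · exact absurd rfl hx
        · rw [hopp.1]
          omega
    · push Not at hee
      obtain ⟨hne, hne'⟩ := hee
      have hne1 : e₀ ≠ Γ.opp e := by
        rintro rfl
        exact hne' (Γ.opp_opp e).symm
      have h8 := h e hne hne'
      obtain ⟨k, h1, h2, h3, h4, i, j, h5, h6, h7⟩ :=
        f.exists_subdivide_of_length_le hε (by omega)
      refine ⟨k, .insert k (Γ.old e e₀) ?_ fun x hx hx' => ?_, h1, h2, h3⟩
      · rw [h4 _ hne.symm hne1, he]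
      · rcases subdivide_cases _ e x with ⟨d, rfl⟩ | rfl | rfl
        · rcases edge_cases e d with rfl | rfl | ⟨h', h''⟩
          · omega
          · rw [hopp.2]
            omega
          · rw [h4 d h' h'']
            refine h d (fun hd => hx (by rw [hd])) fun hd => hx' ?_
            rw [opp_old_of_ne hne.symm hne1, hd]
        · omega
        · rw [hopp.1]
          omega
  | comp f f' hf hf' ih ih' =>
    obtain ⟨a, ha, ha'⟩ := List.mem_flatMap.1 hε
    obtain ⟨k, h1, h2, h3, h4⟩ := ih ha
    obtain ⟨k', h1', h2', h3', h4'⟩ := ih' ha'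
    refine ⟨k.comp k', .comp _ _ h1 h1', ?_, ?_, ?_⟩
    · rw [← comp_assoc, h2, comp_assoc, h2', comp_assoc]
    · rw [comp_onVertex, h3, h3']
    · rw [comp_onVertex, h4, h4']

end CellMap

/-- A presentation of a fat graph as a subdivision with the new flag `b`. -/
structure Contraction (Γ : FatGraph g n) (b : Γ.Flag) where
  graph : FatGraph g n
  edge : graph.Flag
  equiv : (graph.subdivide edge).Flag ≃ Γ.Flag
  rot_equiv : ∀ d, Γ.rot (equiv d) = equiv ((graph.subdivide edge).rot d)
  opp_equiv : ∀ d, Γ.opp (equiv d) = equiv ((graph.subdivide edge).opp d)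
  mark_equiv : ∀ d, Γ.mark (equiv d) = (graph.subdivide edge).mark d
  equiv_new : equiv (graph.new edge) = b

theorem nonempty_contraction {b : Γ.Flag} (hb : Γ.Bivalent b) (hb' : Γ.opp b ≠ Γ.rot b) :
    Nonempty (Contraction Γ b) := by
  obtain ⟨Δ, e, θ, h1, h2, h3, h4⟩ := Γ.exists_subdivide b hb hb'
  exact ⟨⟨Δ, e, θ, h1, h2, h3, h4⟩⟩

namespace Contraction

variable {b : Γ.Flag} (C : Contraction Γ b)

theorem equiv_new' : C.equiv (C.graph.new' C.edge) = Γ.rot b :=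
  ((congrArg Γ.rot C.equiv_new).symm.trans (C.rot_equiv _)).symm

/-- The isomorphism from the subdivision. -/
noncomputable def hom : CellMap (C.graph.subdivide C.edge) Γ :=
  CellMap.ofEquiv C.equiv C.rot_equiv C.opp_equiv C.mark_equiv

/-- The isomorphism to the subdivision. -/
noncomputable def inv : CellMap Γ (C.graph.subdivide C.edge) :=
  CellMap.ofEquiv C.equiv.symm
    (fun d => C.equiv.injective (by rw [← C.rot_equiv]; simp))
    (fun d => C.equiv.injective (by rw [← C.opp_equiv]; simp))
    (fun d => by rw [← C.mark_equiv]; simp)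

theorem hom_comp_inv : C.hom.comp C.inv = CellMap.id _ :=
  ext_path fun d => by simp [comp_path, hom, inv, CellMap.ofEquiv, CellMap.id_path]

theorem inv_comp_hom : C.inv.comp C.hom = CellMap.id _ :=
  ext_path fun d => by simp [comp_path, hom, inv, CellMap.ofEquiv, CellMap.id_path]

theorem inv_path (d : Γ.Flag) : C.inv.path d = [C.equiv.symm d] := rfl

theorem hom_path (d : (C.graph.subdivide C.edge).Flag) : C.hom.path d = [C.equiv d] := rfl

theorem inv_onVertex (d : Γ.Flag) : C.inv.onVertex d = C.equiv.symm d := rfl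

theorem isGenerated_hom : C.hom.IsGenerated := isGenerated_ofEquiv _ _ _ _

theorem isGenerated_inv : C.inv.IsGenerated := isGenerated_ofEquiv _ _ _ _

theorem equiv_symm_eq_new {d : Γ.Flag} : C.equiv.symm d = C.graph.new C.edge ↔ d = b := by
  rw [Equiv.symm_apply_eq, C.equiv_new]

theorem equiv_symm_eq_new' {d : Γ.Flag} :
    C.equiv.symm d = C.graph.new' C.edge ↔ d = Γ.rot b := by
  rw [Equiv.symm_apply_eq, C.equiv_new']

/-- The shrinking of the edge of `b`. -/
noncomputable def shrink : CellMap Γ C.graph := C.inv.comp (contraction C.graph C.edge)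

/-- The insertion of the vertex of `b`. -/
noncomputable def insert : CellMap C.graph Γ := (insertion C.graph C.edge).comp C.hom

theorem isGenerated_shrink : C.shrink.IsGenerated :=
  .comp _ _ C.isGenerated_inv (isGenerated_contraction _ _)

theorem isGenerated_insert : C.insert.IsGenerated :=
  .comp _ _ (isGenerated_insertion _ _) C.isGenerated_hom

theorem insert_comp_shrink : C.insert.comp C.shrink = CellMap.id _ := by
  rw [insert, shrink, CellMap.comp_assoc, ← CellMap.comp_assoc C.hom, hom_comp_inv,
    CellMap.id_comp, insertion_comp_contraction]

theorem shrink_path_eq_nil {d : Γ.Flag} : C.shrink.path d = [] ↔ d = b ∨ d = Γ.opp b := by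
  have h : C.shrink.path d = (contraction C.graph C.edge).path (C.equiv.symm d) := by
    rw [shrink, comp_path, inv_path]
    simp
  have h' : C.equiv (C.graph.old C.edge (C.graph.opp C.edge)) = Γ.opp b := by
    rw [← opp_new, ← C.opp_equiv, C.equiv_new]
  rw [h, contraction_path_eq_nil, equiv_symm_eq_new, Equiv.symm_apply_eq, h']

theorem shrink_comp_insert_comp {Δ : FatGraph g n} (h : CellMap Γ Δ) (hb : h.path b = []) :
    C.shrink.comp (C.insert.comp h) = h := by
  have h1 := contraction_comp_insertion_comp (C.hom.comp h) (by
    rw [comp_path, hom_path, C.equiv_new]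
    simpa using hb)
  rw [insert, shrink, CellMap.comp_assoc, CellMap.comp_assoc, h1, ← CellMap.comp_assoc,
    inv_comp_hom, CellMap.id_comp]

theorem exists_eq_insert {d : Γ.Flag} (h : d ≠ b) (h' : d ≠ Γ.rot b) :
    ∃ d', d = C.insert.onVertex d' := by
  obtain ⟨x, rfl⟩ := C.equiv.surjective d
  rcases subdivide_cases _ _ x with ⟨d', rfl⟩ | rfl | rfl
  · exact ⟨d', rfl⟩
  · exact absurd C.equiv_new h
  · exact absurd C.equiv_new' h'

theorem shrink_insert (d : C.graph.Flag) : C.shrink.onVertex (C.insert.onVertex d) = d := by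
  change (C.insert.comp C.shrink).onVertex d = d
  rw [insert_comp_shrink]
  rfl

theorem insert_path_ne_nil (d : C.graph.Flag) : C.insert.path d ≠ [] := by
  rw [insert, comp_path]
  intro h
  obtain ⟨a, l, hl⟩ := List.exists_cons_of_ne_nil (insertion_path_ne_nil C.graph C.edge d)
  have := List.flatMap_eq_nil_iff.1 h a (by rw [hl]; exact List.mem_cons_self)
  simp [hom_path] at this

theorem rot_insert (d : C.graph.Flag) :
    Γ.rot (C.insert.onVertex d) = C.insert.onVertex (C.graph.rot d) :=
  C.insert.rot_onVertex (C.insert_path_ne_nil d)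

theorem bivalent_insert {d : C.graph.Flag} (h : C.graph.Bivalent d) :
    Γ.Bivalent (C.insert.onVertex d) := by
  rw [Bivalent, rot_insert, rot_insert, h]

theorem card_flag : Nat.card Γ.Flag = Nat.card C.graph.Flag + 2 := by
  rw [← Nat.card_congr C.equiv]
  change Nat.card (C.graph.Flag ⊕ Bool) = _
  rw [Nat.card_sum]
  simp

theorem comp_shrink_comp_insert {X : Type} [Finite X] {s : Equiv.Perm X}
    {f : PolygonMap s Γ.boundary}
    (hs : ∀ x x', Γ.mark (f.onVertex x) = Γ.mark (f.onVertex x') → s.SameCycle x x')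
    (hz : ∀ x, f.onVertex x ≠ b) (hz' : ∀ x, f.onVertex x ≠ Γ.rot b) :
    (f.comp C.shrink.toPolygonMap).comp C.insert.toPolygonMap = f := by
  have h1 := comp_contraction_comp_insertion (f := f.comp C.inv.toPolygonMap)
    (fun x x' h => hs x x' (by
      rw [← C.inv.mark_onVertex, ← C.inv.mark_onVertex (f.onVertex x')]
      exact h))
    (fun x h => hz x (C.equiv_symm_eq_new.1 h)) (fun x h => hz' x (C.equiv_symm_eq_new'.1 h))
  have h2 : C.inv.toPolygonMap.comp C.hom.toPolygonMap = PolygonMap.id _ :=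
    congrArg CellMap.toPolygonMap C.inv_comp_hom
  have h3 : C.shrink.toPolygonMap =
      C.inv.toPolygonMap.comp (contraction C.graph C.edge).toPolygonMap := rfl
  have h4 : C.insert.toPolygonMap =
      (insertion C.graph C.edge).toPolygonMap.comp C.hom.toPolygonMap := rfl
  calc _ = (((f.comp C.inv.toPolygonMap).comp (contraction C.graph C.edge).toPolygonMap).comp
        (insertion C.graph C.edge).toPolygonMap).comp C.hom.toPolygonMap := by
        simp only [h3, h4, PolygonMap.comp_assoc]
    _ = _ := by
        rw [h1, PolygonMap.comp_assoc f, h2, PolygonMap.comp_id]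

/-- A cellular map that shrinks the edge of `b` factors through a subdivision of the target. -/
theorem exists_lift (C : Contraction Γ b) {Δ : FatGraph g n} {f : CellMap Γ Δ} (hf : f.IsGenerated)
    (hb : f.path b = []) {ε : Δ.Flag} (hε : f.path (Γ.opp (Γ.rot b)) = [ε]) :
    ∃ k : CellMap Γ (Δ.subdivide ε), k.IsGenerated ∧ k.comp (contraction Δ ε) = f ∧
      k.onVertex b = Δ.new ε ∧ k.onVertex (Γ.rot b) = Δ.new' ε ∧
      ∀ d, d ≠ b → d ≠ Γ.rot b → k.onVertex d = Δ.old ε (f.onVertex d) := by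
  set F : CellMap (C.graph.subdivide C.edge) Δ := C.hom.comp f with hF
  have hFnew : F.path (C.graph.new C.edge) = [] := by
    rw [hF, comp_path, hom_path, C.equiv_new]
    simpa using hb
  have hFold : F.path (C.graph.old C.edge C.edge) = [ε] := by
    rw [← opp_new', hF, comp_path, hom_path, ← C.opp_equiv, C.equiv_new']
    simpa using hε
  -- After the vertex of `b` has been removed, the merged edge runs exactly once along `ε`, so
  -- subdividing both edges is possible.
  set h : CellMap C.graph Δ := (insertion C.graph C.edge).comp F with hh
  have hpath : h.path C.edge = [ε] := by
    rw [hh, comp_path, insertion_path_self]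
    simp [hFold, hFnew]
  have hgen : h.IsGenerated := .comp _ _ (isGenerated_insertion _ _) (.comp _ _ C.isGenerated_hom hf)
  obtain ⟨k, h1, h2, h3, h4⟩ := hgen.exists_subdivide (e := C.edge) (ε := ε) (by simp [hpath])
  have hold : ∀ d, k.onVertex (C.graph.old C.edge d) = Δ.old ε (h.onVertex d) := fun d =>
    congrArg (fun k => k.onVertex d) h2
  -- The second half is not shrunk, since its ends go to a new and an old corner. The first half
  -- cannot be empty, since the combined path starts with the old flag; as the combined length is
  -- two, one edge remains for the second half.
  have hkz : k.path (C.graph.new C.edge) = [Δ.new ε] := by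
    have e1 := congrArg (fun k => k.path C.edge) h2
    simp only [comp_path, insertion_path_self, hpath, List.flatMap_cons, List.flatMap_nil,
      List.append_nil] at e1
    rcases hk : k.path (C.graph.new C.edge) with _ | ⟨a, r⟩
    · have e2 := k.onVertex_of_nil hk
      rw [boundary_new, hold, h3] at e2
      exact absurd e2 (old_ne_new _ _ _)
    · have e3 := k.head_eq hk
      rw [h3] at e3
      subst e3
      rw [hk] at e1
      rcases hk1 : k.path (C.graph.old C.edge C.edge) with _ | ⟨c, m⟩
      · rw [hk1, List.nil_append, List.cons.injEq] at e1
        exact absurd e1.1.symm (old_ne_new _ _ _)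
      · have e4 := congrArg List.length e1
        rw [hk1] at e4
        simp at e4
        rw [List.length_eq_zero_iff.1 (by omega : r.length = 0)]
  -- Both sides shrink the second half, so they are determined by their restrictions along the
  -- insertion, which agree.
  have hkq : k.comp (contraction Δ ε) = F := by
    have e1 := contraction_comp_insertion_comp (k.comp (contraction Δ ε)) (by
      rw [comp_path, hkz]
      simp [contraction_path_new])
    have e2 := contraction_comp_insertion_comp F hFnew
    rw [← e1, ← e2, ← CellMap.comp_assoc (insertion C.graph C.edge) k, h2, CellMap.comp_assoc,
      insertion_comp_contraction, CellMap.comp_id]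
  refine ⟨C.inv.comp k, .comp _ _ C.isGenerated_inv h1, ?_, ?_, ?_, fun d hd hd' => ?_⟩
  · rw [CellMap.comp_assoc, hkq, hF, ← CellMap.comp_assoc, inv_comp_hom, CellMap.id_comp]
  · rw [comp_onVertex, inv_onVertex, C.equiv_symm_eq_new.2 rfl, h3]
  · rw [comp_onVertex, inv_onVertex, C.equiv_symm_eq_new'.2 rfl, h4]
  · obtain ⟨d', rfl⟩ := C.exists_eq_insert hd hd'
    rw [comp_onVertex, inv_onVertex]
    have e1 : C.insert.onVertex d' = C.equiv (C.graph.old C.edge d') := rfl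
    rw [e1, Equiv.symm_apply_apply, hold]
    rfl

end Contraction

end FatGraph

/-! ### Sliding the image of a vertex backwards -/

namespace PolygonMap

variable {X Y Z : Type} {s : Equiv.Perm X} {t : Equiv.Perm Y} {u : Equiv.Perm Z}

open Classical in
/-- Move the image of the vertex `s x` backwards along the last edge of the path `x`. -/
noncomputable def slide (f : PolygonMap s t) {x : X} (hx : s x ≠ x) {l : List Y} {a : Y}
    (hl : f.path x = l ++ [a]) : PolygonMap s t where
  onVertex z := if z = s x then a else f.onVertex z
  path z := if z = x then l else if z = s x then a :: f.path z else f.path z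
  walk z := by
    by_cases h1 : z = x
    · subst h1
      rw [if_pos rfl, if_neg hx.symm, if_pos rfl]
      have := f.walk z
      rw [hl] at this
      obtain ⟨y, h2, rfl, -⟩ := isWalk_append_iff.1 this
      exact h2
    · rw [if_neg h1, if_neg (fun h => h1 (s.injective h))]
      by_cases h2 : z = s x
      · rw [if_pos h2, if_pos h2]
        refine ⟨rfl, ?_⟩
        rw [f.apply_last hl, ← h2]
        exact f.walk z
      · rw [if_neg h2, if_neg h2]
        exact f.walk z
  nodup z := by
    have hn := f.nodup x
    rw [hl] at hn
    split_ifs with h1 h2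
    · exact hn.of_append_left
    · refine List.nodup_cons.2 ⟨fun h => ?_, f.nodup z⟩
      exact h1 (f.eq_of_mem h (by rw [hl]; simp))
    · exact f.nodup z
  cover y := by
    have hn := f.nodup x
    rw [hl] at hn
    have ha : a ∈ f.path x := by rw [hl]; simp
    obtain ⟨z, hz, hz'⟩ := f.cover y
    by_cases h1 : y = a
    · subst h1
      refine ⟨s x, ?_, fun w hw => ?_⟩
      · simp [hx]
      · by_contra hw'
        by_cases h2 : w = x
        · simp only [h2, if_true] at hw
          exact List.disjoint_of_nodup_append hn hw List.mem_cons_self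
        · simp only [h2, if_false, hw'] at hw
          exact h2 (f.eq_of_mem hw ha)
    · have hmem : ∀ w, y ∈ (if w = x then l else if w = s x then a :: f.path w else f.path w) ↔
          y ∈ f.path w := by
        intro w
        by_cases h2 : w = x
        · rw [if_pos h2, h2, hl]
          simp [h1]
        · rw [if_neg h2]
          split_ifs <;> simp [h1]
      exact ⟨z, (hmem z).2 hz, fun w hw => hz' w ((hmem w).1 hw)⟩

variable (f : PolygonMap s t) {x : X} (hx : s x ≠ x) {l : List Y} {a : Y}
    (hl : f.path x = l ++ [a])

theorem slide_onVertex_self : (f.slide hx hl).onVertex (s x) = a := if_pos rfl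

theorem slide_onVertex_of_ne {z : X} (hz : z ≠ s x) :
    (f.slide hx hl).onVertex z = f.onVertex z := if_neg hz

theorem slide_path_self : (f.slide hx hl).path x = l := if_pos rfl

theorem slide_comp (h : PolygonMap t u) (ha : h.path a = []) :
    (f.slide hx hl).comp h = f.comp h := by
  refine PolygonMap.ext (funext fun z => ?_) (funext fun z => ?_)
  · rw [comp_onVertex, comp_onVertex]
    by_cases hz : z = s x
    · rw [hz, slide_onVertex_self, ← f.apply_last hl, h.onVertex_of_nil ha]
    · rw [slide_onVertex_of_ne _ _ _ hz]
  · rw [comp_path, comp_path]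
    simp only [slide]
    split_ifs with h1 h2
    · rw [h1, hl]
      simp [ha]
    · simp [ha]
    · rfl

end PolygonMap

/-! ### Isomorphisms of fat graphs -/

namespace FatGraph.CellMap

variable {g n : ℕ} {Γ Δ : FatGraph g n}

theorem opp_onVertex (f : CellMap Γ Δ) {d : Γ.Flag} (h : (f.path d).length ≤ 1)
    (h' : f.path d ≠ []) : Δ.opp (f.onVertex d) = f.onVertex (Γ.opp d) := by
  have h1 := f.path_opp d
  rw [f.path_eq_singleton h h'] at h1
  exact (f.head_eq h1).symm

theorem boundary_onVertex (f : CellMap Γ Δ) {d : Γ.Flag} (h : (f.path d).length ≤ 1)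
    (h' : f.path d ≠ []) : Δ.boundary (f.onVertex d) = f.onVertex (Γ.boundary d) :=
  f.apply_last (l := []) (f.path_eq_singleton h h')

theorem exists_inverse (f : CellMap Γ Δ) (hf : ∀ d, (f.path d).length = 1) :
    ∃ k : CellMap Δ Γ, k.IsGenerated ∧ f.comp k = CellMap.id Γ ∧ k.comp f = CellMap.id Δ := by
  have hne : ∀ d, f.path d ≠ [] := fun d h => by simpa [h] using hf d
  have hp : ∀ d, f.path d = [f.onVertex d] := fun d => f.path_eq_singleton (hf d).le (hne d)
  let θ : Γ.Flag ≃ Δ.Flag := Equiv.ofBijective f.onVertex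
    ⟨fun d d' h => f.injective_of_path_ne_nil h (hne d) (hne d'), fun e =>
      let ⟨d, _, hd⟩ := f.exists_path_eq_singleton (fun d => (hf d).le) e
      ⟨d, hd⟩⟩
  have hθ : ∀ d, θ d = f.onVertex d := fun _ => rfl
  refine ⟨CellMap.ofEquiv θ.symm (fun e => ?_) (fun e => ?_) (fun e => ?_),
    isGenerated_ofEquiv _ _ _ _, ext_path fun d => ?_, ext_path fun e => ?_⟩
  · obtain ⟨d, rfl⟩ := θ.surjective e
    rw [Equiv.symm_apply_apply, eq_comm, Equiv.symm_apply_eq]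
    exact f.rot_onVertex (hne d)
  · obtain ⟨d, rfl⟩ := θ.surjective e
    rw [Equiv.symm_apply_apply, eq_comm, Equiv.symm_apply_eq]
    exact f.opp_onVertex (hf d).le (hne d)
  · obtain ⟨d, rfl⟩ := θ.surjective e
    rw [Equiv.symm_apply_apply]
    exact (f.mark_onVertex d).symm
  · rw [comp_path, hp]
    simp [CellMap.ofEquiv, ← hθ, id_path]
  · have : θ.symm e = θ.symm e := rfl
    rw [comp_path]
    simp [CellMap.ofEquiv, hp, ← hθ, id_path]

/-- Isomorphisms that agree at one corner are equal. -/
theorem eq_of_onVertex_eq {f f' : CellMap Γ Δ} (hf : ∀ d, (f.path d).length = 1)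
    (hf' : ∀ d, (f'.path d).length = 1) {d : Γ.Flag} (hd : f.onVertex d = f'.onVertex d) :
    f = f' := by
  have hne : ∀ d, f.path d ≠ [] := fun d h => by simpa [h] using hf d
  have hne' : ∀ d, f'.path d ≠ [] := fun d h => by simpa [h] using hf' d
  refine ext_path fun e => ?_
  rw [f.path_eq_singleton (hf e).le (hne e), f'.path_eq_singleton (hf' e).le (hne' e)]
  refine congrArg (fun a => [a])
    (Γ.induction_on_flags (P := fun e => f.onVertex e = f'.onVertex e) hd ?_ ?_ e)
  · intro d hd
    rw [← f.rot_onVertex (hne d), ← f'.rot_onVertex (hne' d), hd]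
  · intro d hd
    rw [← f.opp_onVertex (hf d).le (hne d), ← f'.opp_onVertex (hf' d).le (hne' d), hd]

end FatGraph.CellMap

/-! ### Fat graphs with marked points on the boundary components -/

/-- A collection of `n` oriented polygons. -/
structure PolygonSystem (n : ℕ) where
  Vertex : Type
  [finite : Finite Vertex]
  next : Equiv.Perm Vertex
  mark : Vertex → Fin n
  mark_surjective : Function.Surjective mark
  mark_eq_iff : ∀ x y, mark x = mark y ↔ next.SameCycle x y

instance {n : ℕ} (P : PolygonSystem n) : Finite P.Vertex := P.finite

theorem PolygonSystem.mark_next {n : ℕ} (P : PolygonSystem n) (x : P.Vertex) :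
    P.mark (P.next x) = P.mark x :=
  (P.mark_eq_iff _ _).2 (Equiv.Perm.sameCycle_apply_left.2 (Equiv.Perm.SameCycle.refl _ _))

/-- A fat graph together with a map from a collection of polygons to its boundary components. -/
structure Filling {n : ℕ} (P : PolygonSystem n) (g : ℕ) where
  graph : FatGraph g n
  map : PolygonMap P.next graph.boundary
  mark_map : ∀ x, graph.mark (map.onVertex x) = P.mark x

namespace Filling

open FatGraph

variable {g n : ℕ} {P : PolygonSystem n}

/-- A morphism of fat graphs which is compatible with the maps from the polygons. -/
@[ext]
structure Hom (a b : Filling P g) where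
  map : CellMap a.graph b.graph
  isGenerated : map.IsGenerated
  comm : a.map.comp map.toPolygonMap = b.map

instance : Category.{0} (Filling P g) where
  Hom := Hom
  id a := ⟨CellMap.id _, .iso _ fun _ => rfl, PolygonMap.comp_id _⟩
  comp f h := ⟨f.map.comp h.map, .comp _ _ f.isGenerated h.isGenerated, by
    rw [← h.comm, ← f.comm, PolygonMap.comp_assoc]
    rfl⟩
  id_comp f := Hom.ext (CellMap.id_comp _)
  comp_id f := Hom.ext (CellMap.comp_id _)
  assoc f h k := Hom.ext (CellMap.comp_assoc _ _ _)

theorem hom_ext {a b : Filling P g} {f h : a ⟶ b} (e : Hom.map f = Hom.map h) : f = h := Hom.ext e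

theorem comp_map {a b c : Filling P g} (f : a ⟶ b) (h : b ⟶ c) :
    Hom.map (f ≫ h) = (Hom.map f).comp (Hom.map h) := rfl

theorem onVertex_eq {a b : Filling P g} (f : a ⟶ b) (t : P.Vertex) :
    f.map.onVertex (a.map.onVertex t) = b.map.onVertex t :=
  congrArg (fun k => k.onVertex t) f.comm

theorem path_eq {a b : Filling P g} (f : a ⟶ b) (t : P.Vertex) :
    b.map.path t = (a.map.path t).flatMap f.map.path :=
  (congrArg (fun k => k.path t) f.comm).symm

theorem sameCycle {a : Filling P g} (t t' : P.Vertex)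
    (h : a.graph.mark (a.map.onVertex t) = a.graph.mark (a.map.onVertex t')) :
    P.next.SameCycle t t' := by
  rw [a.mark_map, a.mark_map] at h
  exact (P.mark_eq_iff _ _).1 h

/-- Every vertex of valence two contains a marked corner. -/
def Minimal (a : Filling P g) : Prop :=
  ∀ d, a.graph.Bivalent d → ∃ t, a.map.onVertex t = d ∨ a.map.onVertex t = a.graph.rot d

/-- Every bivalent vertex of the target contains a marked corner, which is the image of a marked
corner of the source. Hence no vertex is inserted. -/
theorem Minimal.length_path_le_one {a b : Filling P g} (hb : b.Minimal) (f : a ⟶ b)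
    (d : a.graph.Flag) : (f.map.path d).length ≤ 1 :=
  f.map.length_path_le_one (fun e he => by
    obtain ⟨t, ht⟩ := hb e he
    exact ⟨a.map.onVertex t, by rwa [onVertex_eq]⟩) d

/-- Unmarked bivalent vertices are removed one after another. The universal property makes minimal
fillings coreflective; the clause about constant paths gives the same within the fillings whose path
`x` is constant. -/
theorem exists_minimal (a : Filling P g) : ∃ (a' : Filling P g) (s : a' ⟶ a), a'.Minimal ∧
    (∀ x, a.map.path x = [] → a'.map.path x = []) ∧
    ∀ m : Filling P g, m.Minimal → ∀ f : m ⟶ a, ∃! h : m ⟶ a', h ≫ s = f := by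
  induction hN : Nat.card a.graph.Flag using Nat.strong_induction_on generalizing a with
  | _ N ih =>
  subst hN
  by_cases ha : a.Minimal
  · exact ⟨a, 𝟙 a, ha, fun _ h => h, fun m _ f => ⟨f, Category.comp_id f, fun h hh =>
      (Category.comp_id h).symm.trans hh⟩⟩
  · simp only [Minimal, not_forall, not_exists, not_or] at ha
    obtain ⟨d, hd, hd'⟩ := ha
    -- If the two flags at this vertex formed one edge, the corner `rot d` would be a whole boundary
    -- component. But every boundary component contains a marked corner.
    have hloop : a.graph.opp d ≠ a.graph.rot d := by
      intro h
      have h1 : a.graph.boundary (a.graph.rot d) = a.graph.rot d := by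
        rw [← h, boundary_opp, ← h]
      obtain ⟨t, ht⟩ := P.mark_surjective (a.graph.mark (a.graph.rot d))
      rw [← a.mark_map] at ht
      have h2 := a.graph.sameCycle_of_mark_eq ht
      have h3 := Function.IsFixedPt.perm_zpow (e := a.graph.boundary) h1
      obtain ⟨i, hi⟩ := h2.symm
      exact (hd' t).2 (hi.symm.trans (h3 i))
    obtain ⟨C⟩ := nonempty_contraction hd hloop
    let a₁ : Filling P g := ⟨C.graph, a.map.comp C.shrink.toPolygonMap, fun t =>
      (C.shrink.mark_onVertex _).trans (a.mark_map t)⟩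
    let s₁ : a₁ ⟶ a := ⟨C.insert, C.isGenerated_insert,
      C.comp_shrink_comp_insert a.sameCycle (fun t => (hd' t).1) (fun t => (hd' t).2)⟩
    obtain ⟨a', s, h1, h2, h3⟩ := ih (Nat.card C.graph.Flag) (by rw [C.card_flag]; omega) a₁ rfl
    refine ⟨a', s ≫ s₁, h1, fun x hx => h2 x ?_, fun m hm f => ?_⟩
    · rw [PolygonMap.comp_path, hx]
      rfl
    · have havoid : ∀ c, f.map.onVertex c ≠ d ∧ f.map.onVertex c ≠ a.graph.rot d := by
        refine fun c => not_or.1 fun hc => ?_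
        have hc' : a.graph.rot.SameCycle (f.map.onVertex c) d := by
          rcases hc with hc | hc
          · rw [hc]
          · rw [hc]
            exact (a.graph.sameCycle_rot d).symm
        obtain ⟨t, ht⟩ := hm c (f.isGenerated.bivalent (hd.of_sameCycle hc'.symm))
        have ht' : m.graph.rot.SameCycle (m.map.onVertex t) c := by
          rcases ht with ht | ht
          · rw [ht]
          · rw [ht]
            exact (m.graph.sameCycle_rot c).symm
        have h4 := (f.map.sameCycle ht').trans hc'
        rw [onVertex_eq] at h4
        rcases hd.eq_or_eq h4.symm with h5 | h5
        · exact (hd' t).1 h5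
        · exact (hd' t).2 h5
      have hfac : (f.map.comp C.shrink).comp C.insert = f.map := by
        have h4 := C.comp_shrink_comp_insert (f := f.map.toPolygonMap) (fun x x' h => by
          rw [f.map.mark_onVertex, f.map.mark_onVertex] at h
          exact m.graph.sameCycle_of_mark_eq h) (fun c => (havoid c).1) (fun c => (havoid c).2)
        exact CellMap.ext (congrArg PolygonMap.onVertex h4) (congrArg PolygonMap.path h4)
      let f₁ : m ⟶ a₁ := ⟨f.map.comp C.shrink, .comp _ _ f.isGenerated C.isGenerated_shrink, by
        change _ = a.map.comp C.shrink.toPolygonMap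
        rw [← f.comm, PolygonMap.comp_assoc]
        rfl⟩
      have hf₁ : f₁ ≫ s₁ = f := hom_ext hfac
      obtain ⟨k, hk, hk'⟩ := h3 m hm f₁
      refine ⟨k, ?_, fun k' hk'' => hk' k' ?_⟩
      · exact (Category.assoc _ _ _).symm.trans ((congrArg (· ≫ s₁) hk).trans hf₁)
      have h5 := congrArg Hom.map (((Category.assoc _ _ _).trans hk'').trans hf₁.symm)
      simp only [comp_map] at h5
      have h6 := congrArg (fun z => CellMap.comp z C.shrink) h5
      refine hom_ext ?_
      simp only [CellMap.comp_assoc] at h6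
      have h7 : (Hom.map s₁).comp C.shrink = CellMap.id C.graph := C.insert_comp_shrink
      rw [h7] at h6
      rw [comp_map]
      exact (CellMap.comp_id _).symm.trans
        ((CellMap.comp_assoc _ _ _).trans (h6.trans (CellMap.comp_id _)))

section Free

variable (x : P.Vertex)

/-- The end of the image of the edge `x`. -/
def tip (a : Filling P g) : a.graph.Flag := a.map.onVertex (P.next x)

/-- The image of the edge `x` ends at a vertex of valence two which contains no other marked
corner. -/
def Free (a : Filling P g) : Prop :=
  a.map.path x ≠ [] ∧ a.graph.Bivalent (a.tip x) ∧
    ∀ t, (a.map.onVertex t = a.tip x ∨ a.map.onVertex t = a.graph.rot (a.tip x)) → t = P.next x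

/-- The last edge of the image of the edge `x`. -/
def lastEdge (a : Filling P g) : a.graph.Flag := a.graph.opp (a.graph.rot (a.tip x))

variable {x} {a b : Filling P g}

theorem tip_eq (f : a ⟶ b) : f.map.onVertex (a.tip x) = b.tip x := onVertex_eq f _

theorem Free.rot_tip (ha : a.Free x) : a.graph.rot (a.graph.rot (a.tip x)) = a.tip x := ha.2.1

theorem Free.boundary_lastEdge (ha : a.Free x) : a.graph.boundary (a.lastEdge x) = a.tip x := by
  rw [lastEdge, boundary_opp]
  exact ha.rot_tip

theorem opp_lastEdge : a.graph.opp (a.lastEdge x) = a.graph.rot (a.tip x) := a.graph.opp_opp _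

theorem Free.exists_path_eq (ha : a.Free x) : ∃ l, a.map.path x = l ++ [a.lastEdge x] := by
  obtain ⟨l, c, hl⟩ := (List.eq_nil_or_concat' _).resolve_left ha.1
  refine ⟨l, ?_⟩
  rw [hl, a.graph.boundary.injective ((a.map.apply_last hl).trans ha.boundary_lastEdge.symm)]

theorem Free.lastEdge_mem (ha : a.Free x) : a.lastEdge x ∈ a.map.path x := by
  obtain ⟨l, hl⟩ := ha.exists_path_eq
  rw [hl]
  simp

theorem Free.tip_mem (hx : P.next x ≠ x) (ha : a.Free x) :
    a.tip x ∈ a.map.path (P.next x) := by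
  refine a.map.onVertex_mem fun h => hx ?_
  exact P.next.injective (ha.2.2 _ (Or.inl (a.map.onVertex_of_nil h)))

theorem Free.tip_notMem (hx : P.next x ≠ x) (ha : a.Free x) : a.tip x ∉ a.map.path x :=
  fun h => hx (a.map.eq_of_mem (ha.tip_mem hx) h)

theorem Free.lastEdge_ne_tip (hx : P.next x ≠ x) (ha : a.Free x) : a.lastEdge x ≠ a.tip x :=
  fun h => ha.tip_notMem hx (h ▸ ha.lastEdge_mem)

theorem Free.opp_tip_ne (hx : P.next x ≠ x) (ha : a.Free x) :
    a.graph.opp (a.tip x) ≠ a.graph.rot (a.tip x) :=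
  fun h => ha.lastEdge_ne_tip hx (by rw [lastEdge, ← h, a.graph.opp_opp])

theorem lastEdge_ne_opp_tip : a.lastEdge x ≠ a.graph.opp (a.tip x) :=
  fun h => a.graph.rot_ne _ (a.graph.opp.injective h)

/-- As long as the two edges at the free vertex survive, no other vertex is merged with it, so it
stays bivalent and no marked corner arrives there. -/
theorem Free.of_hom (ha : a.Free x) (f : a ⟶ b) (h : f.map.path (a.tip x) ≠ [])
    (h' : f.map.path (a.lastEdge x) ≠ []) : b.Free x := by
  have h'' : f.map.path (a.graph.rot (a.tip x)) ≠ [] := by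
    rw [← opp_lastEdge, Ne, f.map.path_opp_eq_nil_iff]
    exact h'
  have hr : b.graph.rot (b.tip x) = f.map.onVertex (a.graph.rot (a.tip x)) := by
    rw [← tip_eq f, f.map.rot_onVertex h]
  -- A corner other than `c` could only be moved to the image of `c` along shrunk boundary edges,
  -- the last of which would be `c'`.
  have key : ∀ (t : P.Vertex) (c c' : a.graph.Flag), f.map.path c ≠ [] → f.map.path c' ≠ [] →
      a.graph.boundary c' = c → f.map.onVertex (a.map.onVertex t) = f.map.onVertex c →
      a.map.onVertex t = c := by
    intro t c c' hc hc' hcc ht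
    have hmem : f.map.onVertex (a.map.onVertex t) ∈ f.map.path c := by
      rw [ht]
      exact f.map.onVertex_mem hc
    obtain ⟨k, hk, hk', -⟩ := f.map.exists_pow_of_mem (f.map.sameCycle_of_onVertex_eq hmem) hmem
    cases k with
    | zero => exact hk
    | succ k =>
      rw [pow_succ', Equiv.Perm.mul_apply, ← hcc] at hk
      have := a.graph.boundary.injective hk
      exact absurd (this ▸ hk' k k.lt_succ_self) hc'
  refine ⟨fun h0 => h' ?_, ?_, fun t ht => ha.2.2 t ?_⟩
  · rw [path_eq f] at h0
    exact List.flatMap_eq_nil_iff.1 h0 _ ha.lastEdge_mem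
  · rw [Bivalent, hr, f.map.rot_onVertex h'', ha.rot_tip, tip_eq]
  · refine ht.imp (fun ht => ?_) fun ht => ?_
    · refine key t _ _ h h' ha.boundary_lastEdge ?_
      rw [onVertex_eq, ht, tip_eq]
    · refine key t _ (a.graph.opp (a.tip x)) h'' ?_ (a.graph.boundary_opp _) ?_
      · rwa [Ne, f.map.path_opp_eq_nil_iff]
      · rw [onVertex_eq, ht, hr]

/-- Shrinking the edge of the tip identifies the free vertex with the other end of this edge. If the
result were free, that end would be bivalent too, and minimality would give it a marked corner,
which could only be that of `P.next x`. Then the edge would be a loop at a bivalent vertex, which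
`hx` excludes. -/
theorem Free.not_free_of_hom (hx : P.next x ≠ x) (ha : a.Free x) (hm : a.Minimal) (f : a ⟶ b)
    (h : f.map.path (a.tip x) = []) : ¬ b.Free x := by
  intro hb
  have h1 : f.map.onVertex (a.graph.boundary (a.tip x)) = b.tip x := by
    rw [f.map.onVertex_of_nil h, tip_eq]
  have h2 : a.graph.Bivalent (a.graph.boundary (a.tip x)) :=
    f.isGenerated.bivalent (h1 ▸ hb.2.1)
  have hsc : a.graph.rot.SameCycle (a.tip x) (a.graph.boundary (a.tip x)) := by
    obtain ⟨t, ht⟩ := hm _ h2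
    have ht1 : a.graph.rot.SameCycle (a.graph.boundary (a.tip x)) (a.map.onVertex t) := by
      rcases ht with ht | ht <;> rw [ht]
      exact a.graph.sameCycle_rot _
    have ht2 := f.map.sameCycle ht1
    rw [h1, onVertex_eq] at ht2
    have : t = P.next x := hb.2.2 t (hb.2.1.eq_or_eq ht2)
    rw [this] at ht1
    exact ht1.symm
  have hsc' : a.graph.rot.SameCycle (a.tip x) (a.graph.opp (a.tip x)) :=
    hsc.trans (a.graph.sameCycle_rot _).symm
  rcases ha.2.1.eq_or_eq hsc' with h3 | h3
  · exact a.graph.opp_ne _ h3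
  · exact ha.opp_tip_ne hx h3

/-- The universal morphism that shrinks the last edge of the path `x`. -/
theorem Free.exists_shrink (hx : P.next x ≠ x) (ha : a.Free x) (hm : a.Minimal) :
    ∃ (c : Filling P g) (κ : a ⟶ c), c.Minimal ∧ κ.map.path (a.lastEdge x) = [] ∧
      ∀ (b : Filling P g) (f : a ⟶ b), f.map.path (a.lastEdge x) = [] →
        ∃ j : c ⟶ b, κ ≫ j = f := by
  -- The contraction is taken at `rot` of the tip, since the edge of this flag is the last edge of
  -- the path.
  obtain ⟨C⟩ := nonempty_contraction ha.2.1.rot (by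
    rw [ha.rot_tip]
    exact ha.lastEdge_ne_tip hx)
  let c : Filling P g := ⟨C.graph, a.map.comp C.shrink.toPolygonMap, fun t =>
    (C.shrink.mark_onVertex _).trans (a.mark_map t)⟩
  refine ⟨c, ⟨C.shrink, C.isGenerated_shrink, rfl⟩, fun d hd => ?_, ?_, fun b f hf => ?_⟩
  · obtain ⟨t, ht⟩ := hm _ (C.bivalent_insert hd)
    refine ⟨t, ht.imp (fun ht => ?_) fun ht => ?_⟩
    · change C.shrink.onVertex _ = _
      rw [ht, C.shrink_insert]
    · change C.shrink.onVertex _ = _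
      rw [ht, C.rot_insert, C.shrink_insert]
  · exact C.shrink_path_eq_nil.2 (Or.inr rfl)
  · have h1 := C.shrink_comp_insert_comp f.map (by
      rwa [← opp_lastEdge, f.map.path_opp_eq_nil_iff])
    refine ⟨⟨C.insert.comp f.map, .comp _ _ C.isGenerated_insert f.isGenerated, ?_⟩, hom_ext h1⟩
    change (a.map.comp C.shrink.toPolygonMap).comp _ = _
    rw [PolygonMap.comp_assoc, ← f.comm]
    exact congrArg (fun k => PolygonMap.comp a.map k) (congrArg CellMap.toPolygonMap h1)

end Free

end Filling

/-! ### Coverings by free fillings -/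

namespace Filling

open FatGraph FatGraph.CellMap

variable {g n : ℕ} {P : PolygonSystem n} {x : P.Vertex} {a b : Filling P g}

/-- The covering of a filling by a free one. -/
theorem exists_cover (hx : P.next x ≠ x) {c : Filling P g} (hm : c.Minimal)
    (hp : c.map.path x ≠ []) (hc : ¬ c.Free x) :
    ∃ (i : Filling P g) (q : i ⟶ c), i.Minimal ∧ i.Free x ∧
      (∀ d, q.map.path d = [] ↔ d = i.tip x ∨ d = i.graph.opp (i.tip x)) ∧
      ∀ b : Filling P g, b.Minimal → b.Free x → ∀ f : b ⟶ c, f.map.path (b.tip x) = [] →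
        f.map.path (b.lastEdge x) ≠ [] → ∃! h : b ⟶ i, h ≫ q = f := by
  -- The last edge `ε` of the path is subdivided and the end of the path slides back to the new
  -- vertex. The remaining half of `ε` becomes the edge of the tip, and `q` shrinks it again.
  obtain ⟨l, ε, hl⟩ := (List.eq_nil_or_concat' _).resolve_left hp
  have hl' : (c.map.comp (insertion c.graph ε).toPolygonMap).path x =
      (l.flatMap (insertion c.graph ε).path ++ [c.graph.old ε ε]) ++ [c.graph.new ε] := by
    rw [PolygonMap.comp_path, hl, List.flatMap_append, List.append_assoc]
    simp [insertion_path_self]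
  set w := (c.map.comp (insertion c.graph ε).toPolygonMap).slide hx hl' with hw
  have hwx : w.onVertex (P.next x) = c.graph.new ε := PolygonMap.slide_onVertex_self _ _ _
  have hwt : ∀ t, t ≠ P.next x → w.onVertex t = c.graph.old ε (c.map.onVertex t) := fun t ht =>
    PolygonMap.slide_onVertex_of_ne _ _ _ ht
  have hwq : w.comp (contraction c.graph ε).toPolygonMap = c.map := by
    rw [hw, PolygonMap.slide_comp _ _ _ _ (contraction_path_new c.graph ε), PolygonMap.comp_assoc]
    have h1 : (insertion c.graph ε).toPolygonMap.comp (contraction c.graph ε).toPolygonMap =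
        PolygonMap.id _ := congrArg CellMap.toPolygonMap (insertion_comp_contraction c.graph ε)
    rw [h1, PolygonMap.comp_id]
  let i : Filling P g := ⟨c.graph.subdivide ε, w, fun t => by
    rw [← (contraction c.graph ε).mark_onVertex, ← c.mark_map]
    exact congrArg (fun k => c.graph.mark (PolygonMap.onVertex k t)) hwq⟩
  let q : i ⟶ c := ⟨contraction c.graph ε, isGenerated_contraction _ _, hwq⟩
  have htip : i.tip x = c.graph.new ε := hwx
  have hne : ∀ t, (w.onVertex t = c.graph.new ε ∨ w.onVertex t = c.graph.new' ε) →
      t = P.next x := by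
    intro t ht
    by_contra h
    rw [hwt t h] at ht
    rcases ht with ht | ht
    · exact old_ne_new _ _ _ ht
    · exact old_ne_new' _ _ _ ht
  have hfree : i.Free x := by
    refine ⟨?_, ?_, fun t ht => hne t ?_⟩
    · change w.path x ≠ []
      rw [hw, PolygonMap.slide_path_self]
      simp
    · rw [htip]
      exact c.graph.bivalent_new ε
    · rw [htip] at ht
      exact ht
  have hmin : i.Minimal := by
    intro d hd
    rcases subdivide_cases _ _ d with ⟨d, rfl⟩ | rfl | rfl
    · have hd' : c.graph.Bivalent d := old_injective _ _ hd
      -- An old bivalent vertex that is now unmarked can only have lost the corner of `P.next x`. So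
      -- this was its only marked corner, and `c` would be free.
      by_contra! h
      refine hc ⟨hp, ?_⟩
      have hall : ∀ t, (c.map.onVertex t = d ∨ c.map.onVertex t = c.graph.rot d) →
          t = P.next x := by
        intro t ht
        by_contra hte
        have h1 := h t
        change w.onVertex t ≠ _ ∧ w.onVertex t ≠ _ at h1
        rw [hwt t hte] at h1
        rcases ht with ht | ht
        · exact h1.1 (by rw [ht])
        · exact h1.2 (by rw [ht]; rfl)
      obtain ⟨t, ht⟩ := hm d hd'
      have := hall t ht
      subst this
      change c.tip x = d ∨ c.tip x = c.graph.rot d at ht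
      rcases ht with ht | ht
      · rw [ht]
        exact ⟨hd', hall⟩
      · rw [ht]
        refine ⟨hd'.rot, fun t ht => hall t (ht.symm.imp (fun h => ?_) id)⟩
        rw [h]
        exact hd'
    · exact ⟨P.next x, Or.inl hwx⟩
    · exact ⟨P.next x, Or.inr hwx⟩
  refine ⟨i, q, hmin, hfree, ?_, fun b hb hbf f hf hf' => ?_⟩
  · rw [htip]
    exact fun d => contraction_path_eq_nil c.graph ε
  · have hlast : f.map.path (b.lastEdge x) = [ε] := by
      have h1 := f.map.path_eq_singleton (hm.length_path_le_one f _) hf'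
      obtain ⟨l', hl''⟩ := hbf.exists_path_eq
      have h2 := path_eq f x
      rw [hl'', List.flatMap_append, hl, List.flatMap_singleton, h1] at h2
      rw [h1, (List.append_inj' h2 rfl).2]
    -- Instead of shrinking the edge of the tip of `b`, the lift subdivides `ε` and keeps that edge.
    obtain ⟨C⟩ := nonempty_contraction hbf.2.1 (hbf.opp_tip_ne hx)
    obtain ⟨k, hk1, hk2, hk3, hk4, hk5⟩ := C.exists_lift f.isGenerated hf hlast
    have hkv : ∀ t, (b.map.comp k.toPolygonMap).onVertex t = w.onVertex t := by
      intro t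
      rw [PolygonMap.comp_onVertex]
      by_cases ht : t = P.next x
      · rw [ht, hwx]
        exact hk3
      · rw [hwt t ht, ← onVertex_eq f]
        exact hk5 _ (fun h => ht (hbf.2.2 t (Or.inl h))) fun h => ht (hbf.2.2 t (Or.inr h))
    have hkw : b.map.comp k.toPolygonMap = w := by
      refine ext_of_comp_contraction (fun t t' h => ?_) hkv (fun t => ?_) ?_
      · rw [hkv, hkv] at h
        exact i.sameCycle t t' h
      · rw [hkv]
        by_cases ht : t = P.next x
        · rw [ht, hwx]
          exact c.graph.new_ne_new' ε
        · rw [hwt t ht]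
          exact old_ne_new' _ _ _
      · rw [hwq, ← f.comm, PolygonMap.comp_assoc, ← hk2]
        rfl
    refine ⟨⟨k, hk1, hkw⟩, hom_ext hk2, ?_⟩
    -- Two lifts could differ only over the new vertex. A corner over it is bivalent and shares its
    -- vertex with the tip of `b`, where both lifts are determined.
    have key : ∀ h h' : b ⟶ i, h ≫ q = f → h' ≫ q = f → h = h' := by
      intro h h' hh hh'
      have hq : ∀ d, (contraction c.graph ε).onVertex (h.map.onVertex d) = f.map.onVertex d :=
        fun d => congrArg (fun k => (Hom.map k).onVertex d) hh
      have hq' : ∀ d, (contraction c.graph ε).onVertex (h'.map.onVertex d) = f.map.onVertex d :=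
        fun d => congrArg (fun k => (Hom.map k).onVertex d) hh'
      have hnew : ∀ h h' : b ⟶ i, ∀ d, (h.map.onVertex d = c.graph.new ε ∨
          h.map.onVertex d = c.graph.new' ε) → h.map.onVertex d = h'.map.onVertex d := by
        intro h h' d hd
        have hbiv : i.graph.Bivalent (h.map.onVertex d) := by
          rcases hd with hd | hd <;> rw [hd]
          · exact c.graph.bivalent_new ε
          · exact (c.graph.bivalent_new ε).rot
        obtain ⟨t, ht⟩ := hb d (h.isGenerated.bivalent hbiv)
        have hsc : b.graph.rot.SameCycle d (b.map.onVertex t) := by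
          rcases ht with ht | ht <;> rw [ht]
          exact b.graph.sameCycle_rot _
        have hsc' := h.map.sameCycle hsc
        rw [onVertex_eq] at hsc'
        have hte : t = P.next x := by
          refine hne t ?_
          rcases hbiv.eq_or_eq hsc' with h1 | h1 <;> rcases hd with h2 | h2 <;> rw [h2] at h1
          · exact Or.inl h1
          · exact Or.inr h1
          · exact Or.inr h1
          · exact Or.inl h1
        subst hte
        change b.tip x = d ∨ b.tip x = b.graph.rot d at ht
        rcases ht with ht | ht
        · rw [← ht, tip_eq, tip_eq]
        · have hd' : d = b.graph.rot (b.tip x) := by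
            rw [ht]
            exact ((h.isGenerated.bivalent hbiv)).symm
          have hnil : ∀ h : b ⟶ i, h.map.path (b.tip x) ≠ [] := fun h h0 =>
            hbf.not_free_of_hom hx hb h h0 hfree
          rw [hd', ← h.map.rot_onVertex (hnil h), ← h'.map.rot_onVertex (hnil h'), tip_eq, tip_eq]
      have hv : ∀ d, h.map.onVertex d = h'.map.onVertex d := by
        intro d
        rcases subdivide_cases c.graph ε (h.map.onVertex d) with ⟨e, he⟩ | h1
        · rcases subdivide_cases c.graph ε (h'.map.onVertex d) with ⟨e', he'⟩ | h2
          · have h3 := (hq d).trans (hq' d).symm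
            rw [he, he', contraction_old, contraction_old] at h3
            rw [he, he', h3]
          · exact (hnew h' h d h2).symm
        · exact hnew h h' d h1
      -- An edge shrunk by `h` but not by `h'` would be sent by `h'` to the edge shrunk by `q`; the
      -- ends of that edge are different corners, whereas `h` gives them the same image.
      have hnil : ∀ h h' : b ⟶ i, h ≫ q = f → h' ≫ q = f →
          (∀ d, h.map.onVertex d = h'.map.onVertex d) → ∀ d, h.map.path d = [] →
          h'.map.path d = [] := by
        intro h h' hh hh' hv d hd
        by_contra hd'
        have hs := hmin.length_path_le_one h' d
        have h1 := h'.map.boundary_onVertex hs hd'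
        rw [← hv, ← hv, h.map.onVertex_of_nil hd] at h1
        have h2 : f.map.path d = [] := by
          rw [← hh, comp_map, comp_path, hd]
          rfl
        rw [← hh', comp_map, comp_path, h'.map.path_eq_singleton hs hd', List.flatMap_singleton]
          at h2
        rw [hv] at h1
        rcases (contraction_path_eq_nil c.graph ε).1 h2 with h3 | h3 <;> rw [h3] at h1
        · exact old_ne_new _ _ _ ((c.graph.boundary_new ε).symm.trans h1)
        · exact old_ne_new' _ _ _ (h1.symm.trans (c.graph.boundary_old_opp ε))
      refine hom_ext (ext_path fun d => ?_)
      by_cases hd : h.map.path d = []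
      · rw [hd, hnil h h' hh hh' hv d hd]
      · have hd' : h'.map.path d ≠ [] := fun h0 =>
          hd (hnil h' h hh' hh (fun d => (hv d).symm) d h0)
        rw [h.map.path_eq_singleton (hmin.length_path_le_one h d) hd,
          h'.map.path_eq_singleton (hmin.length_path_le_one h' d) hd', hv]
    exact fun h hh => key h _ hh (hom_ext hk2)

theorem isIso_of_length_path (f : a ⟶ b) (h : ∀ d, (f.map.path d).length = 1) : IsIso f := by
  obtain ⟨k, hk, h1, h2⟩ := f.map.exists_inverse h
  refine ⟨⟨k, hk, ?_⟩, hom_ext h1, hom_ext h2⟩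
  rw [← f.comm, PolygonMap.comp_assoc]
  exact (congrArg (PolygonMap.comp a.map) (congrArg CellMap.toPolygonMap h1)).trans
    (PolygonMap.comp_id _)

/-! ### The rank of a filling -/

/-- The edges that are not incident with the free vertex in front of which the path `x` ends. -/
def residue (x : P.Vertex) (a : Filling P g) : Set a.graph.Flag :=
  -- If the filling is not free, the condition is void and all flags are counted.
  {d | a.Free x → d ≠ a.tip x ∧ d ≠ a.graph.opp (a.tip x)}

/-- The part of the path `x` that belongs to the residue. -/
def residualPath (x : P.Vertex) (a : Filling P g) : Set a.graph.Flag :=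
  {d | d ∈ a.residue x ∧ d ∈ a.map.path x}

/-- The lexicographically ordered numbers of edges in the residue and in its part on the path. -/
noncomputable def rank (x : P.Vertex) (a : Filling P g) : ℕ :=
  (a.residue x).ncard ^ 2 + (a.residualPath x).ncard

theorem rank_le_of_injOn {φ : b.graph.Flag → a.graph.Flag}
    (h : ∀ d ∈ b.residue x, φ d ∈ a.residue x) (hi : Set.InjOn φ (b.residue x))
    (hp : ∀ d ∈ b.residue x, d ∈ b.map.path x → φ d ∈ a.map.path x) : b.rank x ≤ a.rank x := by
  refine Nat.add_le_add (Nat.pow_le_pow_left ?_ 2) ?_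
  · exact Set.ncard_le_ncard_of_injOn φ h hi (Set.toFinite _)
  · exact Set.ncard_le_ncard_of_injOn φ (fun d hd => ⟨h d hd.1, hp d hd.1 hd.2⟩)
      (hi.mono fun d hd => hd.1) (Set.toFinite _)

theorem rank_lt_of_notMem_path {φ : b.graph.Flag → a.graph.Flag}
    (h : ∀ d ∈ b.residue x, φ d ∈ a.residue x) (hi : Set.InjOn φ (b.residue x))
    (hp : ∀ d ∈ b.residue x, d ∈ b.map.path x → φ d ∈ a.map.path x)
    {e : a.graph.Flag} (he : e ∈ a.residualPath x)
    (hne : ∀ d ∈ b.residue x, d ∈ b.map.path x → φ d ≠ e) : b.rank x < a.rank x := by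
  refine Nat.add_lt_add_of_le_of_lt (Nat.pow_le_pow_left ?_ 2) ?_
  · exact Set.ncard_le_ncard_of_injOn φ h hi (Set.toFinite _)
  · refine lt_of_le_of_lt (Set.ncard_le_ncard_of_injOn (t := a.residualPath x \ {e}) φ
      (fun d hd => ⟨⟨h d hd.1, hp d hd.1 hd.2⟩, hne d hd.1 hd.2⟩)
      (hi.mono fun d hd => hd.1) (Set.toFinite _)) ?_
    exact Set.ncard_sdiff_singleton_lt_of_mem he (Set.toFinite _)

/-- The second summand of the rank is at most the cardinality `N` of the residue, and `N ^ 2 + N <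
(N + 1) ^ 2`; hence the residue dominates. -/
theorem rank_lt_of_notMem {φ : b.graph.Flag → a.graph.Flag}
    (h : ∀ d ∈ b.residue x, φ d ∈ a.residue x) (hi : Set.InjOn φ (b.residue x))
    {e : a.graph.Flag} (he : e ∈ a.residue x) (hne : ∀ d ∈ b.residue x, φ d ≠ e) :
    b.rank x < a.rank x := by
  have h1 : (b.residue x).ncard < (a.residue x).ncard :=
    lt_of_le_of_lt (Set.ncard_le_ncard_of_injOn (t := a.residue x \ {e}) φ
      (fun d hd => ⟨h d hd, hne d hd⟩) hi (Set.toFinite _))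
      (Set.ncard_sdiff_singleton_lt_of_mem he (Set.toFinite _))
  have h2 : (b.residualPath x).ncard ≤ (b.residue x).ncard :=
    Set.ncard_le_ncard (fun d hd => hd.1) (Set.toFinite _)
  have h3 : ((b.residue x).ncard + 1) ^ 2 ≤ (a.residue x).ncard ^ 2 := Nat.pow_le_pow_left h1 2
  unfold rank
  nlinarith

/-- The lifting of edges along a morphism. -/
theorem exists_lift_flag (hb : b.Minimal) (f : a ⟶ b) : ∃ φ : b.graph.Flag → a.graph.Flag,
    (∀ d, f.map.path (φ d) = [d]) ∧ (∀ d, f.map.onVertex (φ d) = d) ∧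
    (∀ c d, d ∈ f.map.path c → c = φ d) ∧
    ∀ d t, d ∈ b.map.path t → φ d ∈ a.map.path t := by
  choose φ h1 h2 using f.map.exists_path_eq_singleton (hb.length_path_le_one f)
  have h3 : ∀ c d, d ∈ f.map.path c → c = φ d := fun c d h =>
    f.map.eq_of_mem h (by rw [h1]; exact List.mem_cons_self)
  refine ⟨φ, h1, h2, h3, fun d t hd => ?_⟩
  rw [path_eq f] at hd
  obtain ⟨c, hc, hc'⟩ := List.mem_flatMap.1 hd
  rwa [← h3 c d hc']

/-- Edges of the target lift to unshrunk edges of the source. The lift can be the uncounted edge of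
the tip only in the one case where the target loses freeness without shrinking that edge, namely
when the last edge is shrunk; then the last edge, which is not used by any lift, takes its place. -/
theorem exists_residue_map (hx : P.next x ≠ x) (hb : b.Minimal) (f : a ⟶ b) :
    ∃ φ : b.graph.Flag → a.graph.Flag, (∀ d ∈ b.residue x, φ d ∈ a.residue x) ∧
      Set.InjOn φ (b.residue x) ∧ (∀ d ∈ b.residue x, d ∈ b.map.path x → φ d ∈ a.map.path x) ∧
      (a.Free x → f.map.path (a.lastEdge x) = [] →
        ∀ d ∈ b.residue x, d ∈ b.map.path x → φ d ≠ a.lastEdge x) ∧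
      ∀ e, f.map.path e = [] → e ≠ a.lastEdge x → e ≠ a.graph.opp (a.lastEdge x) →
        ∀ d ∈ b.residue x, φ d ≠ e := by
  classical
  obtain ⟨φ, h1, h2, h3, h4⟩ := exists_lift_flag hb f
  have hinj : Function.Injective φ := fun d d' h => by rw [← h2 d, h, h2]
  have hkill : ∀ e, f.map.path e = [] → ∀ d, φ d ≠ e := by
    rintro e he d rfl
    rw [h1] at he
    simp at he
  by_cases hcase : a.Free x ∧ f.map.path (a.tip x) ≠ [] ∧ f.map.path (a.lastEdge x) = []
  · obtain ⟨hf, hk, hk'⟩ := hcase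
    set y := a.tip x with hy
    have hlast : a.lastEdge x = a.graph.opp (a.graph.rot y) := rfl
    have hr : a.graph.opp (a.lastEdge x) = a.graph.rot y := opp_lastEdge
    have e1 : a.graph.rot y ≠ y := a.graph.rot_ne y
    have e2 : a.graph.opp y ≠ a.graph.rot y := hf.opp_tip_ne hx
    have e3 : a.graph.opp y ≠ y := a.graph.opp_ne y
    have e4 : a.lastEdge x ≠ y := hf.lastEdge_ne_tip hx
    have e5 : a.lastEdge x ≠ a.graph.opp y := lastEdge_ne_opp_tip
    have e6 : a.lastEdge x ≠ a.graph.rot y := a.graph.opp_ne _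
    have hkr : f.map.path (a.graph.rot y) = [] := by
      rwa [← hr, f.map.path_opp_eq_nil_iff]
    have n1 : ∀ d, φ d ≠ a.lastEdge x := hkill _ hk'
    have n2 : ∀ d, φ d ≠ a.graph.rot y := hkill _ hkr
    let ψ : b.graph.Flag → a.graph.Flag := fun d => if φ d = y then a.lastEdge x else
      if φ d = a.graph.opp y then a.graph.rot y else φ d
    have p1 : ∀ d, φ d = y → ψ d = a.lastEdge x := fun d h => if_pos h
    have p2 : ∀ d, φ d = a.graph.opp y → ψ d = a.graph.rot y := fun d h =>
      (if_neg (by rw [h]; exact e3)).trans (if_pos h)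
    have p3 : ∀ d, φ d ≠ y → φ d ≠ a.graph.opp y → ψ d = φ d := fun d h h' =>
      (if_neg h).trans (if_neg h')
    have cases : ∀ d, φ d = y ∨ φ d = a.graph.opp y ∨ (φ d ≠ y ∧ φ d ≠ a.graph.opp y) :=
      fun d => by tauto
    have hψ : ∀ d ∈ b.residue x, d ∈ b.map.path x → ψ d ∈ a.map.path x ∧ ψ d ≠ a.lastEdge x := by
      intro d _ hd
      have hd' := h4 d x hd
      rcases cases d with h | h | ⟨h, h'⟩
      · rw [h] at hd'
        exact absurd hd' (hf.tip_notMem hx)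
      -- The reversed tip edge leads back to the free vertex. If it lies on the path, it is not the
      -- last edge, and the next edge of the path is `rot` of the tip, its replacement.
      · rw [p2 d h]
        refine ⟨?_, e6.symm⟩
        rw [h] at hd'
        obtain ⟨l, hl⟩ := hf.exists_path_eq
        have hd'' := hd'
        rw [hl, List.mem_append, List.mem_singleton] at hd''
        obtain ⟨l₁, l₂, rfl⟩ := List.append_of_mem (hd''.resolve_right e5.symm)
        rw [List.append_assoc, List.cons_append] at hl
        rcases l₂ with _ | ⟨c, l₂⟩
        · have := a.map.apply_of_append hl
          rw [boundary_opp] at this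
          exact absurd this.symm e6
        · have := a.map.apply_of_append hl
          rw [boundary_opp] at this
          rw [hl, this]
          simp
      · rw [p3 d h h']
        exact ⟨hd', n1 d⟩
    refine ⟨ψ, fun d hd _ => ?_, fun d _ d' _ h => ?_, fun d hd h => (hψ d hd h).1,
      fun _ _ d hd h => (hψ d hd h).2, fun e he he1 he2 d hd => ?_⟩
    · rcases cases d with h | h | ⟨h, h'⟩
      · rw [p1 d h]
        exact ⟨e4, e5⟩
      · rw [p2 d h]
        exact ⟨e1, e2.symm⟩
      · rw [p3 d h h']
        exact ⟨h, h'⟩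
    · refine hinj ?_
      rcases cases d with k | k | ⟨k, k'⟩ <;> rcases cases d' with m | m | ⟨m, m'⟩
      · rw [k, m]
      · rw [p1 d k, p2 d' m] at h
        exact absurd h e6
      · rw [p1 d k, p3 d' m m'] at h
        exact absurd h.symm (n1 _)
      · rw [p2 d k, p1 d' m] at h
        exact absurd h.symm e6
      · rw [k, m]
      · rw [p2 d k, p3 d' m m'] at h
        exact absurd h.symm (n2 _)
      · rw [p3 d k k', p1 d' m] at h
        exact absurd h (n1 _)
      · rw [p3 d k k', p2 d' m] at h
        exact absurd h (n2 _)
      · rwa [p3 d k k', p3 d' m m'] at h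
    · rcases cases d with h | h | ⟨h, h'⟩
      · rw [p1 d h]
        exact he1.symm
      · rw [p2 d h, ← hr]
        exact he2.symm
      · rw [p3 d h h']
        exact hkill e he d
  · refine ⟨φ, fun d hd hf => ?_, hinj.injOn, fun d _ hd => h4 d x hd,
      fun _ h d _ _ => hkill _ h d, fun e he _ _ d _ => hkill e he d⟩
    by_cases hk : f.map.path (a.tip x) = []
    · exact ⟨hkill _ hk d, hkill _ (f.map.path_opp_eq_nil hk) d⟩
    · have hk' : f.map.path (a.lastEdge x) ≠ [] := fun h => hcase ⟨hf, hk, h⟩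
      have hbf := hd (hf.of_hom f hk hk')
      refine ⟨fun h => hbf.1 ?_, fun h => hbf.2 ?_⟩
      · rw [← tip_eq f, ← h, h2]
      · rw [← tip_eq f, f.map.opp_onVertex (hb.length_path_le_one f _) hk, ← h, h2]

theorem rank_le (hx : P.next x ≠ x) (hb : b.Minimal) (f : a ⟶ b) :
    b.rank x ≤ a.rank x := by
  obtain ⟨φ, h1, h2, h3, -⟩ := exists_residue_map hx hb f
  exact rank_le_of_injOn h1 h2 h3

theorem Free.rank_lt_of_lastEdge (hx : P.next x ≠ x) (hf : a.Free x)
    (hb : b.Minimal) (f : a ⟶ b) (h : f.map.path (a.lastEdge x) = []) : b.rank x < a.rank x := by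
  obtain ⟨φ, h1, h2, h3, h4, -⟩ := exists_residue_map hx hb f
  exact rank_lt_of_notMem_path h1 h2 h3 (e := a.lastEdge x)
    ⟨fun _ => ⟨hf.lastEdge_ne_tip hx, lastEdge_ne_opp_tip⟩, hf.lastEdge_mem⟩ (h4 hf h)

theorem rank_lt_of_path_eq_nil (hx : P.next x ≠ x) (hb : b.Minimal) (f : a ⟶ b)
    {e : a.graph.Flag} (he : f.map.path e = []) (h1 : e ≠ a.tip x)
    (h2 : e ≠ a.graph.opp (a.tip x)) (h3 : e ≠ a.lastEdge x)
    (h4 : e ≠ a.graph.opp (a.lastEdge x)) : b.rank x < a.rank x := by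
  obtain ⟨φ, k1, k2, -, -, k3⟩ := exists_residue_map hx hb f
  exact rank_lt_of_notMem k1 k2 (fun _ => ⟨h1, h2⟩) (k3 e he h3 h4)

/-- The only edge that may be shrunk is not counted in the source. If the target is free too, its
own uncounted edge is the image of the uncounted edge of the source. -/
theorem Free.le_rank (hx : P.next x ≠ x) (hf : a.Free x) (ha : a.Minimal) (hb : b.Minimal)
    (f : a ⟶ b) (h : ∀ d, f.map.path d = [] → d = a.tip x ∨ d = a.graph.opp (a.tip x)) :
    a.rank x ≤ b.rank x := by
  have hne : ∀ d ∈ a.residue x, f.map.path d ≠ [] := fun d hd h0 => by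
    have := hd hf
    rcases h d h0 with h1 | h1
    · exact this.1 h1
    · exact this.2 h1
  refine rank_le_of_injOn (φ := f.map.onVertex) (fun d hd hbf => ?_) (fun d hd d' hd' e => ?_)
    fun d hd hd' => ?_
  · have hk : f.map.path (a.tip x) ≠ [] := fun h0 => hf.not_free_of_hom hx ha f h0 hbf
    have hko : f.map.path (a.graph.opp (a.tip x)) ≠ [] := by
      rwa [Ne, f.map.path_opp_eq_nil_iff]
    rw [← tip_eq f, f.map.opp_onVertex (hb.length_path_le_one f _) hk]
    exact ⟨fun e => (hd hf).1 (f.map.injective_of_path_ne_nil e (hne d hd) hk),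
      fun e => (hd hf).2 (f.map.injective_of_path_ne_nil e (hne d hd) hko)⟩
  · exact f.map.injective_of_path_ne_nil e (hne d hd) (hne d' hd')
  · rw [path_eq f]
    exact List.mem_flatMap.2 ⟨d, hd', f.map.onVertex_mem (hne d hd)⟩

theorem Free.path_ne_nil (hf : a.Free x) (f : a ⟶ b)
    (h : f.map.path (a.lastEdge x) ≠ []) : b.map.path x ≠ [] := by
  rw [path_eq f]
  exact fun h0 => h (List.flatMap_eq_nil_iff.1 h0 _ hf.lastEdge_mem)

/-- Free fillings of the same rank. -/
theorem Free.isIso (hx : P.next x ≠ x) (hf : a.Free x) (ha : a.Minimal) (hb : b.Minimal)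
    (hbf : b.Free x) (f : a ⟶ b) (h : a.rank x ≤ b.rank x) (d : a.graph.Flag) :
    (f.map.path d).length = 1 := by
  have h1 : f.map.path (a.tip x) ≠ [] := fun h0 => hf.not_free_of_hom hx ha f h0 hbf
  have h2 : f.map.path (a.lastEdge x) ≠ [] := fun h0 =>
    absurd (hf.rank_lt_of_lastEdge hx hb f h0) h.not_gt
  have h3 : f.map.path d ≠ [] := by
    intro h0
    refine absurd (rank_lt_of_path_eq_nil hx hb f h0 ?_ ?_ ?_ ?_) h.not_gt
    · rintro rfl
      exact h1 h0
    · rintro rfl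
      exact h1 (f.map.path_opp_eq_nil_iff.1 h0)
    · rintro rfl
      exact h2 h0
    · rintro rfl
      exact h2 (f.map.path_opp_eq_nil_iff.1 h0)
  exact le_antisymm (hb.length_path_le_one f d) (List.length_pos_iff.2 h3)

/-- Every filling in which the path `x` is not constant is covered by a free one of the same
rank. -/
theorem exists_free_cover (hx : P.next x ≠ x) {c : Filling P g} (hm : c.Minimal)
    (hp : c.map.path x ≠ []) : ∃ (i : Filling P g) (q : i ⟶ c), i.Minimal ∧ i.Free x ∧
      i.rank x = c.rank x ∧ ∀ b : Filling P g, b.Minimal → b.Free x → b.rank x = c.rank x →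
        ∀ f : b ⟶ c, ∃ h : b ⟶ i, h ≫ q = f := by
  by_cases hc : c.Free x
  · exact ⟨c, 𝟙 c, hm, hc, rfl, fun b _ _ _ f => ⟨f, Category.comp_id f⟩⟩
  · obtain ⟨i, q, hi, hif, hq, hu⟩ := exists_cover hx hm hp hc
    refine ⟨i, q, hi, hif, le_antisymm ?_ (rank_le hx hm q), fun b hb hbf hr f => ?_⟩
    · exact hif.le_rank hx hi hm q fun d => (hq d).1
    · have h2 : f.map.path (b.lastEdge x) ≠ [] := fun h0 =>
        absurd (hbf.rank_lt_of_lastEdge hx hm f h0) hr.le.not_gt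
      have h1 : f.map.path (b.tip x) = [] := by
        by_contra h0
        exact hc (hbf.of_hom f h0 h2)
      exact (hu b hb hbf f h1 h2).exists

end Filling

/-! ### The filtration by rank -/

namespace Filling

open FatGraph FatGraph.CellMap

variable {g n : ℕ} {P : PolygonSystem n} {x : P.Vertex} {a b c : Filling P g}

theorem Free.onVertex_lastEdge (hb : b.Minimal) (f : a ⟶ b)
    (h : f.map.path (a.tip x) ≠ []) (h' : f.map.path (a.lastEdge x) ≠ []) :
    f.map.onVertex (a.lastEdge x) = b.lastEdge x := by
  have h'' : f.map.path (a.graph.rot (a.tip x)) ≠ [] := by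
    rwa [← opp_lastEdge, Ne, f.map.path_opp_eq_nil_iff]
  rw [lastEdge, ← f.map.opp_onVertex (hb.length_path_le_one f _) h'', ← f.map.rot_onVertex h,
    tip_eq]
  rfl

theorem path_comp_eq (hb : b.Minimal) (f : a ⟶ b) (h : b ⟶ c) {d : a.graph.Flag}
    (hd : f.map.path d ≠ []) : (Hom.map (f ≫ h)).path d = h.map.path (f.map.onVertex d) := by
  rw [comp_map, comp_path, f.map.path_eq_singleton (hb.length_path_le_one f d) hd,
    List.flatMap_singleton]

/-- The category of the fillings in which every vertex of valence two contains a marked corner. -/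
abbrev MinimalFilling {n : ℕ} (P : PolygonSystem n) (g : ℕ) :=
  ObjectProperty.FullSubcategory (Filling.Minimal (P := P) (g := g))

/-- The structure morphism of an object of the coslice only shrinks edges, so it is an epimorphism.
-/
instance isThin_under (b : MinimalFilling P g) : Quiver.IsThin (Under b) := fun y z => ⟨fun p q => by
  refine Under.UnderMorphism.ext (ObjectProperty.hom_ext _ (hom_ext ?_))
  refine y.hom.hom.map.cancel_left (y.right.property.length_path_le_one y.hom.hom) ?_
  have h1 := congrArg (fun f : b ⟶ z.right => f.hom) ((Under.w p).trans (Under.w q).symm)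
  exact congrArg Hom.map h1⟩

section Coslice

variable (x) in
/-- The fillings for which the path `x` is constant or whose rank is less than `k`. -/
def rankFiltration (k : ℕ) : Set (MinimalFilling P g) :=
  fun c => c.obj.map.path x = [] ∨ c.obj.rank x < k

/-- The objects are distinguished by the edges of `b` that they shrink: the last edge of the path
(`Z`), neither this nor the edge of the tip (`E`), or some edge other than these two (`Q`). The rank
is unchanged exactly if at most the edge of the tip is shrunk, so the part of lower rank is `Z ∪ Q`,
and `union_univ` applies. -/
theorem trivialExtension_coslice (hx : P.next x ≠ x) {b : MinimalFilling P g} (hb : b.obj.Free x) :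
    TrivialExtension ((Under.forget b).obj ⁻¹' rankFiltration x (b.obj.rank x))
      ((Under.forget b).obj ⁻¹' rankFiltration x (b.obj.rank x + 1)) := by
  classical
  let Z : Set (Under b) := fun y => y.hom.hom.map.path (b.obj.lastEdge x) = []
  let E : Set (Under b) := fun y => y.hom.hom.map.path (b.obj.lastEdge x) ≠ [] ∧
    y.hom.hom.map.path (b.obj.tip x) ≠ []
  let Q : Set (Under b) := fun y => ∃ d, y.hom.hom.map.path d = [] ∧ d ≠ b.obj.tip x ∧
    d ≠ b.obj.graph.opp (b.obj.tip x) ∧ d ≠ b.obj.lastEdge x ∧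
    d ≠ b.obj.graph.opp (b.obj.lastEdge x)
  have h1 : (Under.forget b).obj ⁻¹' rankFiltration x (b.obj.rank x) = Z ∪ Q := by
    ext y
    constructor
    · intro hy
      by_contra hn
      have hz : y.hom.hom.map.path (b.obj.lastEdge x) ≠ [] := fun h => hn (Or.inl h)
      rcases hy with hy | hy
      · exact hb.path_ne_nil y.hom.hom hz hy
      · refine absurd (hb.le_rank hx b.property y.right.property y.hom.hom fun d hd => ?_) hy.not_ge
        by_contra! hd'
        refine hn (Or.inr ⟨d, hd, hd'.1, hd'.2, ?_, ?_⟩)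
        · rintro rfl
          exact hz hd
        · rintro rfl
          exact hz (y.hom.hom.map.path_opp_eq_nil_iff.1 hd)
    · rintro (hy | ⟨d, hd, h1, h2, h3, h4⟩)
      · exact Or.inr (hb.rank_lt_of_lastEdge hx y.right.property y.hom.hom hy)
      · exact Or.inr (rank_lt_of_path_eq_nil hx y.right.property y.hom.hom hd h1 h2 h3 h4)
  have h2 : (Under.forget b).obj ⁻¹' rankFiltration x (b.obj.rank x + 1) = Set.univ := by
    refine Set.eq_univ_of_forall fun y => Or.inr ?_
    exact Nat.lt_succ_of_le (rank_le hx y.right.property y.hom.hom)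
  rw [h1, h2]
  obtain ⟨m, κ, hm, hκ, hκu⟩ := hb.exists_shrink hx b.property
  have hfreeE : ∀ y ∈ E, y.right.obj.Free x := fun y hy => hb.of_hom y.hom.hom hy.2 hy.1
  -- For an object that shrinks the edge of the tip but not the last edge, the covering by a free
  -- filling is the largest member of `E` below it. The covering shrinks only the edge of the tip,
  -- so any other shrunk edge has been shrunk before, which preserves `Q`.
  have hl : ∀ y : Under b, ∃ z : Under b, y ∉ Z → y ∉ E → Nonempty (z ⟶ y) ∧ z ∈ E ∧
      (y ∈ Q → z ∈ Q) ∧ ∀ w ∈ E, (w ⟶ y) → Nonempty (w ⟶ z) := by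
    intro y
    by_cases hyZ : y ∈ Z
    · exact ⟨y, fun h => absurd hyZ h⟩
    by_cases hyE : y ∈ E
    · exact ⟨y, fun _ h => absurd hyE h⟩
    have hlast : y.hom.hom.map.path (b.obj.lastEdge x) ≠ [] := hyZ
    have htip : y.hom.hom.map.path (b.obj.tip x) = [] := by
      by_contra h
      exact hyE ⟨hyZ, h⟩
    obtain ⟨i, q, hi, hif, hq, hu⟩ := exists_cover hx y.right.property
      (hb.path_ne_nil y.hom.hom hlast) (hb.not_free_of_hom hx b.property y.hom.hom htip)
    obtain ⟨h, hh, hh'⟩ := hu b.obj b.property hb y.hom.hom htip hlast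
    have hh0 : h ≫ q = y.hom.hom := hh
    let i' : MinimalFilling P g := ⟨i, hi⟩
    let h₁ : b ⟶ i' := ObjectProperty.homMk h
    let q₁ : i' ⟶ y.right := ObjectProperty.homMk q
    have hlast' : h.map.path (b.obj.lastEdge x) ≠ [] := fun h0 => hlast (by
      rw [← hh0, comp_map, comp_path, h0]
      rfl)
    have htip' : h.map.path (b.obj.tip x) ≠ [] := fun h0 =>
      hb.not_free_of_hom hx b.property h h0 hif
    refine ⟨Under.mk h₁, fun _ _ => ⟨⟨Under.homMk q₁ (ObjectProperty.hom_ext _ hh0)⟩,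
      ⟨hlast', htip'⟩, ?_, fun w hw p => ?_⟩⟩
    · rintro ⟨d, hd, hd1, hd2, hd3, hd4⟩
      refine ⟨d, ?_, hd1, hd2, hd3, hd4⟩
      change h.map.path d = []
      by_contra hd0
      rw [← hh0, path_comp_eq hi h q hd0, hq, ← tip_eq h,
        h.map.opp_onVertex (hi.length_path_le_one h _) htip'] at hd
      rcases hd with hd | hd
      · exact hd1 (h.map.injective_of_path_ne_nil hd hd0 htip')
      · refine hd2 (h.map.injective_of_path_ne_nil hd hd0 ?_)
        rwa [Ne, h.map.path_opp_eq_nil_iff]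
    · have hp : w.hom.hom ≫ p.right.hom = y.hom.hom :=
        congrArg (fun f : b ⟶ y.right => f.hom) (Under.w p)
      have k1 : p.right.hom.map.path (w.right.obj.tip x) = [] := by
        rw [← tip_eq w.hom.hom, ← path_comp_eq w.right.property w.hom.hom p.right.hom hw.2, hp]
        exact htip
      have k2 : p.right.hom.map.path (w.right.obj.lastEdge x) ≠ [] := by
        rw [← Free.onVertex_lastEdge w.right.property w.hom.hom hw.2 hw.1,
          ← path_comp_eq w.right.property w.hom.hom p.right.hom hw.1, hp]
        exact hlast
      obtain ⟨k, hk, -⟩ := hu w.right.obj w.right.property (hfreeE w hw) p.right.hom k1 k2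
      have hk0 : k ≫ q = p.right.hom := hk
      let k₁ : w.right ⟶ i' := ObjectProperty.homMk k
      refine ⟨Under.homMk k₁ (ObjectProperty.hom_ext _ (hh' _ ?_))⟩
      change (w.hom.hom ≫ k) ≫ q = _
      rw [Category.assoc, hk0, hp]
  choose l hl using hl
  -- Shrinking the last edge gives the least member of `Z` above an object of `E`.
  have hd : ∀ y : Under b, ∃ z : Under b, y ∈ E → Nonempty (y ⟶ z) ∧ z ∈ Z ∧
      ∀ w ∈ Z, (y ⟶ w) → Nonempty (z ⟶ w) := by
    intro y
    by_cases hy : y ∈ E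
    · obtain ⟨c, k, hc, hk, hku⟩ := (hfreeE y hy).exists_shrink hx y.right.property
      let c' : MinimalFilling P g := ⟨c, hc⟩
      let k₁ : y.right ⟶ c' := ObjectProperty.homMk k
      refine ⟨Under.mk (y.hom ≫ k₁), fun _ => ⟨⟨Under.homMk k₁ rfl⟩, ?_, fun w hw p => ?_⟩⟩
      · change (Hom.map (y.hom.hom ≫ k)).path _ = []
        rw [path_comp_eq y.right.property y.hom.hom k hy.1,
          Free.onVertex_lastEdge y.right.property y.hom.hom hy.2 hy.1]
        exact hk
      · have hp : y.hom.hom ≫ p.right.hom = w.hom.hom :=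
          congrArg (fun f : b ⟶ w.right => f.hom) (Under.w p)
        obtain ⟨j, hj⟩ := hku w.right.obj p.right.hom (by
          rw [← Free.onVertex_lastEdge y.right.property y.hom.hom hy.2 hy.1,
            ← path_comp_eq y.right.property y.hom.hom p.right.hom hy.1, hp]
          exact hw)
        let j₁ : c' ⟶ w.right := ObjectProperty.homMk j
        refine ⟨Under.homMk j₁ (ObjectProperty.hom_ext _ ?_)⟩
        change (y.hom.hom ≫ k) ≫ j = w.hom.hom
        rw [Category.assoc, hj, hp]
    · exact ⟨y, fun h => absurd h hy⟩
  choose d hd using hd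
  let m' : MinimalFilling P g := ⟨m, hm⟩
  let κ₁ : b ⟶ m' := ObjectProperty.homMk κ
  refine TrivialExtension.union_univ Z Q E (Under.mk (𝟙 b)) (Under.mk κ₁) ?_ hκ
    (fun y => ⟨Under.homMk y.hom (Category.id_comp _)⟩) (fun y hy => ?_) ?_ ?_ l hl d hd
  · intro h
    have h : (CellMap.id b.obj.graph).path (b.obj.lastEdge x) = [] := h
    simp [id_path] at h
  · obtain ⟨j, hj⟩ := hκu y.right.obj y.hom.hom hy
    let j₁ : m' ⟶ y.right := ObjectProperty.homMk j
    exact ⟨Under.homMk j₁ (ObjectProperty.hom_ext _ hj)⟩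
  · intro y hy z p
    change z.hom.hom.map.path _ = []
    rw [← Under.w p]
    change List.flatMap _ (y.hom.hom.map.path _) = []
    have hy' : y.hom.hom.map.path (b.obj.lastEdge x) = [] := hy
    rw [hy']
    rfl
  · rintro y ⟨e, he, he'⟩ z p
    refine ⟨e, ?_, he'⟩
    rw [← Under.w p]
    change List.flatMap _ (y.hom.hom.map.path _) = []
    rw [he]
    rfl

end Coslice

theorem isIso_iff_length_path (a b : MinimalFilling P g) (f : a ⟶ b)
    (h : ∀ d, (f.hom.map.path d).length = 1) : IsIso f :=
  (ObjectProperty.isIso_hom_iff f).1 (isIso_of_length_path f.hom h)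

theorem path_ne_nil_of_isIso {a b : MinimalFilling P g} (f : a ≅ b) (d : a.obj.graph.Flag) :
    f.hom.hom.map.path d ≠ [] := by
  intro h
  have h1 : (Hom.map (f.hom ≫ f.inv).hom).path d = [] := by
    change List.flatMap _ (f.hom.hom.map.path d) = []
    rw [h]
    rfl
  rw [f.hom_inv_id] at h1
  have h1 : (CellMap.id a.obj.graph).path d = [] := h1
  simp [id_path] at h1

theorem length_path_of_isIso {a b : MinimalFilling P g} (f : a ≅ b) (d : a.obj.graph.Flag) :
    (f.hom.hom.map.path d).length = 1 :=
  le_antisymm (b.property.length_path_le_one f.hom.hom d)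
    (List.length_pos_iff.2 (path_ne_nil_of_isIso f d))

/-- The new objects are the fillings of rank `k` with nonconstant path, and each is covered by a
free filling of the same rank through which all morphisms from such free fillings factor. Morphisms
between free fillings of the same rank are isomorphisms, so the covering is unique once
representatives are fixed. -/
theorem trivialExtension_rankFiltration (hx : P.next x ≠ x) (k : ℕ) :
    TrivialExtension (rankFiltration (P := P) (g := g) x k) (rankFiltration x (k + 1)) := by
  -- `r` chooses one filling in each isomorphism class, so that the index set contains each free
  -- filling once.
  let r : MinimalFilling P g → MinimalFilling P g := fun b =>
    Quotient.out (Quotient.mk (isIsomorphicSetoid (MinimalFilling P g)) b)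
  have hr : ∀ b, Nonempty (r b ≅ b) := fun b => Quotient.mk_out (s := isIsomorphicSetoid _) b
  have hrr : ∀ b c, Nonempty (b ≅ c) → r b = r c := fun b c h =>
    congrArg Quotient.out (Quotient.sound (s := isIsomorphicSetoid (MinimalFilling P g)) h)
  let ι := {b : MinimalFilling P g // b.obj.Free x ∧ b.obj.rank x = k ∧ r b = b}
  refine TrivialExtension.of_under (ι := ι) (β := fun i => i.1) (fun c hc => ?_) (fun c hc hc' => ?_)
    (fun c hc d hd hd' => ⟨fun f => hd' ?_⟩) fun i => ?_
  · exact hc.imp id fun h => h.trans k.lt_succ_self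
  · have hp : c.obj.map.path x ≠ [] := fun h => hc' (Or.inl h)
    have hk : c.obj.rank x = k := by
      have h1 : ¬ c.obj.rank x < k := fun h => hc' (Or.inr h)
      have h2 : c.obj.rank x < k + 1 := hc.resolve_left hp
      omega
    obtain ⟨i, q, hi, hif, hir, hu⟩ := exists_free_cover hx c.property hp
    let i' : MinimalFilling P g := ⟨i, hi⟩
    let q₁ : i' ⟶ c := ObjectProperty.homMk q
    obtain ⟨e⟩ := hr i'
    have hef : (r i').obj.Free x := hif.of_hom e.inv.hom (path_ne_nil_of_isIso e.symm _)
      (path_ne_nil_of_isIso e.symm _)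
    have hek : (r i').obj.rank x = k := by
      rw [← hk, ← hir]
      exact le_antisymm (rank_le hx (r i').property e.inv.hom) (rank_le hx hi e.hom.hom)
    let i₀ : ι := ⟨r i', hef, hek, hrr _ _ (hr i')⟩
    refine ⟨⟨⟨⟨i₀, e.hom ≫ q₁⟩⟩, ?_⟩⟩
    rintro ⟨⟨b, hbf, hbk, hbr⟩, f⟩
    obtain ⟨h, hh⟩ := hu b.obj b.property hbf (hbk.trans hk.symm) f.hom
    let h₁ : b ⟶ i' := ObjectProperty.homMk h
    have hiso : ∀ d, (h.map.path d).length = 1 := hbf.isIso hx b.property hi hif h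
      (by rw [hbk, hir, hk])
    have : IsIso h₁ := isIso_iff_length_path b i' h₁ hiso
    have hbi : b = r i' := hbr.symm.trans (hrr _ _ ⟨asIso h₁⟩)
    subst hbi
    -- Isomorphisms of fillings preserve the tip, and isomorphisms of fat graphs that agree at one
    -- corner are equal.
    have he : h₁ = e.hom := ObjectProperty.hom_ext _ (hom_ext
      (eq_of_onVertex_eq hiso (length_path_of_isIso e) ((tip_eq (x := x) h).trans (tip_eq e.hom.hom).symm)))
    have hf : f = e.hom ≫ q₁ := by
      rw [← he]
      exact ObjectProperty.hom_ext _ hh.symm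
    exact congrArg (Sigma.mk i₀) hf
  · rcases hc with hc | hc
    · refine Or.inl ?_
      rw [path_eq f.hom, hc]
      rfl
    · exact Or.inr ((rank_le hx d.property f.hom).trans_lt hc)
  · obtain ⟨b, hbf, hbk, -⟩ := i
    subst hbk
    exact trivialExtension_coslice hx hbf

theorem trivialExtension_univ (hx : P.next x ≠ x) :
    TrivialExtension (fun c : MinimalFilling P g => c.obj.map.path x = []) Set.univ := by
  have h1 := TrivialExtension.iUnion (S := rankFiltration (P := P) (g := g) x)
    (trivialExtension_rankFiltration hx)
  have h2 : rankFiltration (P := P) (g := g) x 0 = fun c => c.obj.map.path x = [] := by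
    funext c
    simp [rankFiltration]
  have h3 : ⋃ k, rankFiltration (P := P) (g := g) x k = Set.univ :=
    Set.eq_univ_of_forall fun c => Set.mem_iUnion.2 ⟨c.obj.rank x + 1, Or.inr (Nat.lt_succ_self _)⟩
  rwa [h2, h3] at h1

end Filling

/-- The universal arrows are the counit of a right adjoint of `F`. -/
theorem IsHomotopyEquivalence.of_universal_arrows {C D : Type u} [Category.{v} C] [Category.{v} D]
    (F : D ⥤ C) (h : ∀ c : C, ∃ (d : D) (s : F.obj d ⟶ c), ∀ (d' : D) (f : F.obj d' ⟶ c),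
      ∃! k : d' ⟶ d, F.map k ≫ s = f) : IsHomotopyEquivalence F := by
  have : ∀ c, Limits.HasTerminal (CostructuredArrow F c) := by
    intro c
    obtain ⟨d, s, hs⟩ := h c
    refine (Limits.IsTerminal.ofUniqueHom (Y := CostructuredArrow.mk s)
      (fun y => CostructuredArrow.homMk (hs y.left y.hom).choose
        (hs y.left y.hom).choose_spec.1) fun y m => ?_).hasTerminal
    refine CostructuredArrow.hom_ext _ _ ?_
    exact (hs y.left y.hom).choose_spec.2 _ (CostructuredArrow.w m)
  have := isLeftAdjoint_of_costructuredArrowTerminals F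
  exact IsHomotopyEquivalence.of_isLeftAdjoint F

/-! ### Fillings with a constant path -/

namespace Filling

open FatGraph

variable {g n : ℕ} {P : PolygonSystem n}

variable (g) in
/-- The fillings for which the path `x` is constant. -/
def PathConstant (x : P.Vertex) : ObjectProperty (Filling P g) := fun a => a.map.path x = []

theorem isHomotopyEquivalence_minimal :
    IsHomotopyEquivalence (ObjectProperty.ι (Filling.Minimal (P := P) (g := g))) := by
  refine IsHomotopyEquivalence.of_universal_arrows _ fun a => ?_
  obtain ⟨a', s, h, -, hu⟩ := a.exists_minimal
  refine ⟨⟨a', h⟩, s, fun m f => ?_⟩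
  obtain ⟨k, hk, hk'⟩ := hu m.obj m.property f
  exact ⟨ObjectProperty.homMk k, hk, fun k' hk'' => ObjectProperty.hom_ext _ (hk' k'.hom hk'')⟩

/-- Removing unmarked bivalent vertices keeps the path `x` constant, so minimal fillings are also
coreflective among the fillings with constant path `x`. The rest is two out of three in the square
of inclusions. -/
theorem isHomotopyEquivalence_pathConstant {x : P.Vertex} (hx : P.next x ≠ x) :
    IsHomotopyEquivalence (PathConstant g x).ι := by
  let M : ObjectProperty (Filling P g) := Filling.Minimal
  let S : ObjectProperty (MinimalFilling P g) := fun c => c.obj.map.path x = []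
  have h1 : IsHomotopyEquivalence S.ι :=
    TrivialExtension.isHomotopyEquivalence (trivialExtension_univ hx)
  let J : S.FullSubcategory ⥤ (PathConstant g x).FullSubcategory :=
    (PathConstant g x).lift (S.ι ⋙ M.ι) fun c => c.property
  have h2 : IsHomotopyEquivalence J := by
    refine IsHomotopyEquivalence.of_universal_arrows _ fun a => ?_
    obtain ⟨a', s, h, h', hu⟩ := a.obj.exists_minimal
    refine ⟨⟨⟨a', h⟩, h' x a.property⟩, ObjectProperty.homMk s, fun m f => ?_⟩
    obtain ⟨k, hk, hk'⟩ := hu m.obj.obj m.obj.property f.hom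
    refine ⟨ObjectProperty.homMk (ObjectProperty.homMk k), ObjectProperty.hom_ext _ hk,
      fun k' hk'' => ?_⟩
    exact ObjectProperty.hom_ext _ (ObjectProperty.hom_ext _
      (hk' k'.hom.hom (congrArg (fun z => z.hom) hk'')))
  exact h2.of_comp_left (h1.comp isHomotopyEquivalence_minimal)

/-- Fillings of the same fat graph by the same map are isomorphic. -/
def isoOfEq {Γ : FatGraph g n} {w w' : PolygonMap P.next Γ.boundary}
    (h : ∀ x, Γ.mark (w.onVertex x) = P.mark x) (h' : ∀ x, Γ.mark (w'.onVertex x) = P.mark x)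
    (e : w = w') : (⟨Γ, w, h⟩ : Filling P g) ≅ ⟨Γ, w', h'⟩ where
  hom := ⟨CellMap.id Γ, .iso _ fun _ => rfl, (PolygonMap.comp_id w).trans e⟩
  inv := ⟨CellMap.id Γ, .iso _ fun _ => rfl, (PolygonMap.comp_id w').trans e.symm⟩
  hom_inv_id := hom_ext (CellMap.comp_id _)
  inv_hom_id := hom_ext (CellMap.comp_id _)

end Filling

/-! ### Change of the polygons -/

namespace PolygonSystem

variable {n : ℕ}

/-- A map between collections of polygons. -/
@[ext]
structure Hom (P Q : PolygonSystem n) where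
  map : PolygonMap P.next Q.next
  mark_onVertex : ∀ x, Q.mark (map.onVertex x) = P.mark x

namespace Hom

variable {P Q R : PolygonSystem n}

/-- The identity map. -/
def id (P : PolygonSystem n) : Hom P P := ⟨PolygonMap.id _, fun _ => rfl⟩

/-- The composition of maps (in diagrammatic order). -/
def comp (f : Hom P Q) (h : Hom Q R) : Hom P R :=
  ⟨f.map.comp h.map, fun x => (h.mark_onVertex _).trans (f.mark_onVertex x)⟩

theorem mark_path (f : Hom P Q) {x : P.Vertex} {y : Q.Vertex} (h : y ∈ f.map.path x) :
    Q.mark y = P.mark x :=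
  (((f.map.walk x).const Q.mark_next).2 y h).trans (f.mark_onVertex x)

/-- The composition of the maps to the boundary components with a map of polygons. -/
def pullback (g : ℕ) (f : Hom P Q) : Filling Q g ⥤ Filling P g where
  obj a := ⟨a.graph, f.map.comp a.map, fun x => (a.mark_map _).trans (f.mark_onVertex x)⟩
  map k := ⟨k.map, k.isGenerated, by
    rw [PolygonMap.comp_assoc]
    exact congrArg f.map.comp k.comm⟩

/-- The pullback along a composition. -/
def pullbackComp (g : ℕ) (f : Hom P Q) (h : Hom Q R) :
    h.pullback g ⋙ f.pullback g ≅ (f.comp h).pullback g :=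
  NatIso.ofComponents (fun _ => Filling.isoOfEq _ _ (PolygonMap.comp_assoc _ _ _).symm)
    fun _ => Filling.hom_ext ((FatGraph.CellMap.comp_id _).trans (FatGraph.CellMap.id_comp _).symm)

/-- The pullback along the identity. -/
def pullbackId (g : ℕ) (P : PolygonSystem n) : (Hom.id P).pullback g ≅ 𝟭 (Filling P g) :=
  NatIso.ofComponents (fun a => Filling.isoOfEq _ a.mark_map (PolygonMap.id_comp _))
    fun _ => Filling.hom_ext ((FatGraph.CellMap.comp_id _).trans (FatGraph.CellMap.id_comp _).symm)

theorem isHomotopyEquivalence_of_inverse (g : ℕ) (f : Hom P Q) (h : Hom Q P)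
    (h1 : f.comp h = Hom.id P) (h2 : h.comp f = Hom.id Q) :
    IsHomotopyEquivalence (f.pullback g) := by
  let e := CategoryTheory.Equivalence.mk (f.pullback g) (h.pullback g)
    ((pullbackId g Q).symm ≪≫ eqToIso (by rw [h2]) ≪≫ (pullbackComp g h f).symm)
    (pullbackComp g f h ≪≫ eqToIso (by rw [h1]) ≪≫ pullbackId g P)
  have : (f.pullback g).IsEquivalence := e.isEquivalence_functor
  exact IsHomotopyEquivalence.of_isEquivalence _

end Hom

open Classical in
/-- The successor of a vertex after the removal of the vertex `x`. -/
noncomputable def removeNext (P : PolygonSystem n) (x : P.Vertex) : Equiv.Perm {t // t ≠ x} :=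
  (Equiv.swap x (P.next x) * P.next).subtypePerm fun t => by
    have h : (Equiv.swap x (P.next x) * P.next) x = x := Equiv.swap_apply_right _ _
    exact not_congr ⟨fun h' => (Equiv.injective _) (h'.trans h.symm), fun h' => by rw [h', h]⟩

theorem removeNext_of_eq (P : PolygonSystem n) {x : P.Vertex} (t : {t // t ≠ x})
    (h : P.next t.1 = x) : (P.removeNext x t).1 = P.next x := by
  classical
  change Equiv.swap x (P.next x) (P.next t.1) = _
  rw [h, Equiv.swap_apply_left]

theorem removeNext_of_ne (P : PolygonSystem n) {x : P.Vertex} (t : {t // t ≠ x})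
    (h : P.next t.1 ≠ x) : (P.removeNext x t).1 = P.next t.1 := by
  classical
  exact Equiv.swap_apply_of_ne_of_ne h fun h' => t.2 (P.next.injective h')

open Classical in
/-- The vertex that replaces a given vertex after the removal of `x`. -/
noncomputable def removeVertex (P : PolygonSystem n) {x : P.Vertex} (hx : P.next x ≠ x)
    (t : P.Vertex) : {t // t ≠ x} := if h : t = x then ⟨P.next x, hx⟩ else ⟨t, h⟩

theorem removeVertex_self (P : PolygonSystem n) {x : P.Vertex} (hx : P.next x ≠ x) :
    P.removeVertex hx x = ⟨P.next x, hx⟩ := dif_pos rfl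

theorem removeVertex_of_ne (P : PolygonSystem n) {x : P.Vertex} (hx : P.next x ≠ x)
    {t : P.Vertex} (h : t ≠ x) : P.removeVertex hx t = ⟨t, h⟩ := dif_neg h

theorem removeVertex_next (P : PolygonSystem n) {x : P.Vertex} (hx : P.next x ≠ x)
    {t : P.Vertex} (h : t ≠ x) : P.removeVertex hx (P.next t) = P.removeNext x ⟨t, h⟩ := by
  by_cases h' : P.next t = x
  · rw [h', removeVertex_self]
    exact Subtype.ext (P.removeNext_of_eq ⟨t, h⟩ h').symm
  · rw [removeVertex_of_ne _ _ h']
    exact Subtype.ext (P.removeNext_of_ne ⟨t, h⟩ h').symm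

/-- The removal of a vertex, which merges two edges. -/
noncomputable def remove (P : PolygonSystem n) {x : P.Vertex} (hx : P.next x ≠ x) :
    PolygonSystem n where
  Vertex := {t // t ≠ x}
  next := P.removeNext x
  mark t := P.mark t.1
  mark_surjective i := by
    obtain ⟨t, ht⟩ := P.mark_surjective i
    by_cases h : t = x
    · exact ⟨⟨P.next x, hx⟩, (P.mark_next x).trans (h ▸ ht)⟩
    · exact ⟨⟨t, h⟩, ht⟩
  mark_eq_iff t t' := by
    rw [P.mark_eq_iff]
    constructor
    · intro h
      have := Equiv.Perm.SameCycle.map_of_step (t := P.removeNext x) (φ := P.removeVertex hx)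
        (fun t => ?_) h
      · rwa [P.removeVertex_of_ne hx t.2, P.removeVertex_of_ne hx t'.2] at this
      · by_cases h' : t = x
        · rw [h', removeVertex_self, removeVertex_of_ne _ _ hx]
        · rw [P.removeVertex_next hx h', P.removeVertex_of_ne hx h']
          exact Equiv.Perm.sameCycle_apply_right.2 (Equiv.Perm.SameCycle.refl _ _)
    · refine Equiv.Perm.SameCycle.map_of_step (φ := Subtype.val) fun t => ?_
      by_cases h' : P.next t.1 = x
      · rw [P.removeNext_of_eq t h']
        have h1 : P.next.SameCycle t.1 (P.next (P.next t.1)) :=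
          Equiv.Perm.sameCycle_apply_right.2 (Equiv.Perm.sameCycle_apply_right.2
            (Equiv.Perm.SameCycle.refl _ _))
        rwa [h'] at h1
      · rw [P.removeNext_of_ne t h']
        exact Equiv.Perm.sameCycle_apply_right.2 (Equiv.Perm.SameCycle.refl _ _)

variable (P : PolygonSystem n) {x : P.Vertex} (hx : P.next x ≠ x)

open Classical in
/-- The map that shrinks the edge `x`. -/
noncomputable def collapse : Hom P (P.remove hx) where
  map :=
    { onVertex := P.removeVertex hx
      path := fun t => if h : t = x then [] else [⟨t, h⟩]
      walk := fun t => by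
        by_cases h : t = x
        · rw [dif_pos h, h, removeVertex_self, removeVertex_of_ne _ _ hx]
          rfl
        · rw [dif_neg h, removeVertex_of_ne _ _ h, removeVertex_next _ _ h]
          exact ⟨rfl, rfl⟩
      nodup := fun t => by
        split_ifs
        · exact List.nodup_nil
        · exact List.nodup_singleton _
      cover := fun t => by
        refine ⟨t.1, ?_, fun t' ht' => ?_⟩
        · change t ∈ dite _ _ _
          rw [dif_neg t.2]
          exact List.mem_cons_self
        · change t ∈ dite _ _ _ at ht'
          by_cases h : t' = x
          · rw [dif_pos h] at ht'
            simp at ht'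
          · rw [dif_neg h] at ht'
            exact (congrArg Subtype.val (List.mem_singleton.1 ht')).symm }
  mark_onVertex t := by
    change P.mark (P.removeVertex hx t).1 = P.mark t
    by_cases h : t = x
    · rw [h, removeVertex_self]
      exact P.mark_next x
    · rw [removeVertex_of_ne _ _ h]

theorem collapse_onVertex {t : P.Vertex} (h : t ≠ x) : (P.collapse hx).map.onVertex t = ⟨t, h⟩ :=
  P.removeVertex_of_ne hx h

theorem collapse_path_self : (P.collapse hx).map.path x = [] := dif_pos rfl

theorem collapse_path {t : P.Vertex} (h : t ≠ x) : (P.collapse hx).map.path t = [⟨t, h⟩] :=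
  dif_neg h

variable {P} {Y : Type} {u : Equiv.Perm Y}

theorem collapse_comp_injective {f f' : PolygonMap (P.remove hx).next u}
    (h : (P.collapse hx).map.comp f = (P.collapse hx).map.comp f') : f = f' := by
  refine PolygonMap.ext (funext fun t => ?_) (funext fun t => ?_)
  · have := congrArg (fun k => k.onVertex t.1) h
    simp only [PolygonMap.comp_onVertex, collapse_onVertex P hx t.2] at this
    exact this
  · have := congrArg (fun k => k.path t.1) h
    simp only [PolygonMap.comp_path, collapse_path P hx t.2] at this
    exact (List.flatMap_singleton _ _).symm.trans (this.trans (List.flatMap_singleton _ _))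

theorem exists_collapse_comp_eq (f : PolygonMap P.next u) (hf : f.path x = []) :
    ∃ f' : PolygonMap (P.remove hx).next u, (P.collapse hx).map.comp f' = f := by
  refine ⟨⟨fun t => f.onVertex t.1, fun t => f.path t.1, fun t => ?_, fun t => f.nodup t.1,
    fun y => ?_⟩, PolygonMap.ext (funext fun t => ?_) (funext fun t => ?_)⟩
  · change IsWalk u _ _ (f.onVertex (P.removeNext x t).1)
    by_cases h : P.next t.1 = x
    · have h1 := f.walk t.1
      rw [P.removeNext_of_eq t h, f.onVertex_of_nil hf]
      rwa [h] at h1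
    · rw [P.removeNext_of_ne t h]
      exact f.walk t.1
  · obtain ⟨t, ht, ht'⟩ := f.cover y
    exact ⟨⟨t, by rintro rfl; simp [hf] at ht⟩, ht, fun t' h => Subtype.ext (ht' t'.1 h)⟩
  · by_cases h : t = x
    · rw [h]
      change f.onVertex (P.removeVertex hx x).1 = _
      rw [removeVertex_self]
      exact f.onVertex_of_nil hf
    · rw [PolygonMap.comp_onVertex, collapse_onVertex P hx h]
  · by_cases h : t = x
    · rw [h, PolygonMap.comp_path, collapse_path_self, hf]
      rfl
    · rw [PolygonMap.comp_path, collapse_path P hx h]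
      exact List.flatMap_singleton _ _

/-- A map that is constant on the edge `x` is the same as a map from the polygons in which `x` has
been collapsed. So the pullback is an equivalence onto the fillings with constant path `x`, followed
by their inclusion. -/
theorem isHomotopyEquivalence_collapse (g : ℕ) :
    IsHomotopyEquivalence ((P.collapse hx).pullback g) := by
  let L : Filling (P.remove hx) g ⥤ (Filling.PathConstant g x).FullSubcategory :=
    (Filling.PathConstant g x).lift ((P.collapse hx).pullback g) fun a => by
      change ((P.collapse hx).map.comp a.map).path x = []
      rw [PolygonMap.comp_path, collapse_path_self]
      rfl
  have h1 : L.Faithful := ⟨fun {a b} f f' h => Filling.hom_ext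
    (congrArg (fun k => Filling.Hom.map k.hom) h)⟩
  have h2 : L.Full := ⟨fun {a b} f => ⟨⟨f.hom.map, f.hom.isGenerated, by
    have h := f.hom.comm
    refine collapse_comp_injective hx ?_
    rw [← PolygonMap.comp_assoc]
    exact h⟩, rfl⟩⟩
  have h3 : L.EssSurj := ⟨fun a => by
    obtain ⟨f, hf⟩ := exists_collapse_comp_eq hx a.obj.map a.property
    refine ⟨⟨a.obj.graph, f, fun t => ?_⟩, ⟨ObjectProperty.isoMk _
      (Filling.isoOfEq _ a.obj.mark_map hf)⟩⟩
    have := a.obj.mark_map t.1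
    rw [← hf, PolygonMap.comp_onVertex, collapse_onVertex P hx t.2] at this
    exact this⟩
  have h4 : L.IsEquivalence := {}
  exact (IsHomotopyEquivalence.of_isEquivalence L).comp
    (Filling.isHomotopyEquivalence_pathConstant hx)

/-- Injectivity of `Q.mark` means that each polygon of `Q` has a single edge. The map collapses all
edges of each polygon of `P` except one, and these are collapsed one at a time. -/
theorem Hom.isHomotopyEquivalence_of_injective {Q : PolygonSystem n} (g : ℕ) (f : Hom P Q)
    (hQ : Function.Injective Q.mark) : IsHomotopyEquivalence (f.pullback g) := by
  induction hN : Nat.card P.Vertex using Nat.strong_induction_on generalizing P with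
  | _ N ih =>
  subst hN
  by_cases hex : ∃ x, f.map.path x = []
  · obtain ⟨x, hfx⟩ := hex
    -- The only edge of a polygon cannot be shrunk, because it has to cover the polygon of `Q`.
    have hx : P.next x ≠ x := by
      intro hx
      obtain ⟨t, ht, -⟩ := f.map.cover (f.map.onVertex x)
      have h1 : P.mark x = P.mark t := (f.mark_onVertex x).symm.trans (f.mark_path ht)
      obtain ⟨i, hi⟩ := (P.mark_eq_iff _ _).1 h1
      have h2 := Function.IsFixedPt.perm_zpow (e := P.next) hx i
      rw [← hi, h2, hfx] at ht
      simp at ht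
    obtain ⟨f', hf'⟩ := exists_collapse_comp_eq hx f.map hfx
    let f₁ : Hom (P.remove hx) Q := ⟨f', fun t => by
      have := f.mark_onVertex t.1
      rw [← hf', PolygonMap.comp_onVertex, collapse_onVertex P hx t.2] at this
      exact this⟩
    have hf₁ : (P.collapse hx).comp f₁ = f := by
      cases f
      cases hf'
      rfl
    have hcard : Nat.card (P.remove hx).Vertex < Nat.card P.Vertex :=
      Finite.card_subtype_lt (x := x) (not_not.2 rfl)
    rw [← hf₁]
    exact ((ih _ hcard f₁ rfl).comp (isHomotopyEquivalence_collapse hx g)).of_iso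
      (Hom.pullbackComp g _ _)
  -- If no edge is shrunk, each path is the single edge of its polygon in `Q`, and `f` is an
  -- isomorphism.
  · push Not at hex
    have hfix : ∀ y, Q.next y = y := fun y => hQ (Q.mark_next y)
    have hpath : ∀ x, f.map.path x = [f.map.onVertex x] := by
      intro x
      have hall : ∀ y ∈ f.map.path x, y = f.map.onVertex x := fun y hy =>
        hQ ((f.mark_path hy).trans (f.mark_onVertex x).symm)
      obtain ⟨y, l, hl⟩ := List.exists_cons_of_ne_nil (hex x)
      have hn := f.map.nodup x
      rw [hl] at hall hn
      cases l with
      | nil => rw [hl, hall y List.mem_cons_self]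
      | cons z l =>
        rw [hall y List.mem_cons_self, hall z (by simp)] at hn
        simp at hn
    have hbij : Function.Bijective f.map.onVertex := by
      refine ⟨fun x x' h => f.map.eq_of_mem (y := f.map.onVertex x) ?_ ?_, fun y => ?_⟩
      · rw [hpath]
        exact List.mem_cons_self
      · rw [hpath, h]
        exact List.mem_cons_self
      · obtain ⟨x, hx, -⟩ := f.map.cover y
        rw [hpath, List.mem_singleton] at hx
        exact ⟨x, hx.symm⟩
    let θ := Equiv.ofBijective _ hbij
    have hθ : ∀ x, θ x = f.map.onVertex x := fun _ => rfl
    have hnext : ∀ x, P.next x = x := fun x => hbij.1 (hQ (by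
      rw [f.mark_onVertex, f.mark_onVertex, P.mark_next]))
    let h : Hom Q P :=
      { map :=
          { onVertex := θ.symm
            path := fun y => [θ.symm y]
            walk := fun y => ⟨rfl, by rw [hnext, hfix]; rfl⟩
            nodup := fun y => List.nodup_singleton _
            cover := fun x => ⟨θ x, by simp, fun y hy => by
              rw [List.mem_singleton.1 hy, Equiv.apply_symm_apply]⟩ }
        mark_onVertex := fun y => by
          rw [← f.mark_onVertex, ← hθ, Equiv.apply_symm_apply] }
    refine Hom.isHomotopyEquivalence_of_inverse g f h ?_ ?_
    · refine Hom.ext (PolygonMap.ext (funext θ.symm_apply_apply) (funext fun x => ?_))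
      change List.flatMap (fun y => [θ.symm y]) (f.map.path x) = [x]
      rw [hpath, List.flatMap_singleton, ← hθ, Equiv.symm_apply_apply]
    · refine Hom.ext (PolygonMap.ext (funext θ.apply_symm_apply) (funext fun y => ?_))
      change List.flatMap f.map.path [θ.symm y] = [y]
      rw [List.flatMap_singleton, hpath, ← hθ, Equiv.apply_symm_apply]

/-- The collection of `n` polygons with one vertex each. -/
def point (n : ℕ) : PolygonSystem n where
  Vertex := Fin n
  next := 1
  mark := id
  mark_surjective := Function.surjective_id
  mark_eq_iff _ _ := Equiv.Perm.sameCycle_one.symm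

variable (P) in
open Classical in
/-- A map that shrinks all edges except one of each polygon. -/
noncomputable def toPoint : Hom P (point n) where
  map :=
    { onVertex := P.mark
      path := fun t => if t = Function.surjInv P.mark_surjective (P.mark t) then [P.mark t] else []
      walk := fun t => by
        rw [P.mark_next]
        split_ifs
        · exact ⟨rfl, rfl⟩
        · rfl
      nodup := fun t => by
        split_ifs
        · exact List.nodup_singleton _
        · exact List.nodup_nil
      cover := fun i => by
        have h := Function.surjInv_eq P.mark_surjective i
        refine ⟨Function.surjInv P.mark_surjective i, ?_, fun t ht => ?_⟩
        · change i ∈ ite _ _ _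
          rw [if_pos (by rw [h]), h]
          exact List.mem_cons_self
        · change i ∈ ite _ _ _ at ht
          split_ifs at ht with h'
          · rw [List.mem_singleton.1 ht]
            exact h'
          · simp at ht }
  mark_onVertex _ := rfl

theorem isHomotopyEquivalence_toPoint (g : ℕ) (P : PolygonSystem n) :
    IsHomotopyEquivalence (P.toPoint.pullback g) :=
  P.toPoint.isHomotopyEquivalence_of_injective g Function.injective_id

/-- Both `Q.toPoint` and its composition with `f` are covered by the case of one-vertex polygons;
`f` follows by two out of three. -/
theorem Hom.isHomotopyEquivalence {Q : PolygonSystem n} (g : ℕ) (f : Hom P Q) :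
    IsHomotopyEquivalence (f.pullback g) :=
  (isHomotopyEquivalence_toPoint g Q).of_comp_left
    (((f.comp Q.toPoint).isHomotopyEquivalence_of_injective g Function.injective_id).of_iso
      (Hom.pullbackComp g f Q.toPoint).symm)

end PolygonSystem

/-! ### Comparison with the comma categories -/

theorem map_flatMap_eq_flatMap_map {X Y Z W : Type} {p : X → List Y} {q : Z → List W}
    {φ : Y → W} {θ : X → Z} {l : List X} (h : ∀ x, (p x).map φ = q (θ x)) :
    (l.flatMap p).map φ = (l.map θ).flatMap q := by
  rw [List.map_flatMap, List.flatMap_map]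
  exact congrArg l.flatMap (funext h)

namespace PolygonSystem

open FatGraph

variable {g n : ℕ} {K K' : Fin n → CyclicSet}

/-- The disjoint union of a family of oriented polygons. -/
def total (K : Fin n → CyclicSet) : PolygonSystem n where
  Vertex := Σ i, (K i).carrier
  finite := by
    have := fun i => (K i).finite
    infer_instance
  next := Equiv.Perm.sigmaCongrRight fun i => (K i).next
  mark := Sigma.fst
  mark_surjective i := by
    obtain ⟨a⟩ := (K i).nonempty
    exact ⟨⟨i, a⟩, rfl⟩
  mark_eq_iff := by
    rintro ⟨i, a⟩ ⟨j, b⟩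
    refine ⟨fun h => ?_, fun h => ?_⟩
    · obtain rfl : i = j := h
      exact ((K i).transitive a b).map_of_step (φ := Sigma.mk i) fun _ =>
        Equiv.Perm.sameCycle_apply_right.2 (Equiv.Perm.SameCycle.refl _ _)
    · exact Equiv.Perm.sameCycle_one.1 (h.map_of_step (φ := Sigma.fst)
        (t := (1 : Equiv.Perm (Fin n))) fun _ => Equiv.Perm.sameCycle_one.2 rfl)

/-- The disjoint union of a family of maps of oriented polygons. -/
def totalHom (ψ : K ⟶ K') : Hom (total K) (total K') where
  map :=
    { onVertex := fun x => ⟨x.1, PolygonMap.onVertex (ψ x.1) x.2⟩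
      path := fun x => (PolygonMap.path (ψ x.1) x.2).map (Sigma.mk x.1)
      walk := fun x => (PolygonMap.walk (ψ x.1) x.2).map (φ := Sigma.mk x.1) fun _ => rfl
      nodup := fun x => (PolygonMap.nodup (ψ x.1) x.2).map sigma_mk_injective
      cover := fun ⟨i, b⟩ => by
        obtain ⟨a, ha, ha'⟩ := PolygonMap.cover (ψ i) b
        refine ⟨⟨i, a⟩, List.mem_map_of_mem ha, fun ⟨j, a'⟩ h => ?_⟩
        obtain ⟨b', hb, h⟩ := List.mem_map.1 h
        obtain ⟨rfl, h⟩ := Sigma.mk.inj h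
        cases h
        exact congrArg (Sigma.mk _) (ha' a' hb) }
  mark_onVertex _ := rfl

/-- A family of maps to the boundary components of a fat graph is a map from the disjoint union. -/
def assemble {Γ : FatGraph g n} (ψ : K ⟶ (boundaries g n).obj Γ) :
    PolygonMap (total K).next Γ.boundary where
  onVertex x := (PolygonMap.onVertex (ψ x.1) x.2).1
  path x := (PolygonMap.path (ψ x.1) x.2).map Subtype.val
  walk x := (PolygonMap.walk (ψ x.1) x.2).map (φ := Subtype.val) fun _ => rfl
  nodup x := (PolygonMap.nodup (ψ x.1) x.2).map Subtype.val_injective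
  cover y := by
    obtain ⟨a, ha, ha'⟩ := PolygonMap.cover (ψ (Γ.mark y)) ⟨y, rfl⟩
    refine ⟨⟨_, a⟩, List.mem_map.2 ⟨_, ha, rfl⟩, fun ⟨j, a'⟩ h => ?_⟩
    obtain ⟨⟨y', h'⟩, hb, rfl⟩ := List.mem_map.1 h
    change Γ.mark y' = j at h'
    subst h'
    exact congrArg (Sigma.mk _) (ha' a' hb)

theorem mark_assemble {Γ : FatGraph g n} (ψ : K ⟶ (boundaries g n).obj Γ) (x : (total K).Vertex) :
    Γ.mark ((assemble ψ).onVertex x) = (total K).mark x :=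
  (PolygonMap.onVertex (ψ x.1) x.2).2

theorem assemble_injective {Γ : FatGraph g n} {ψ φ : K ⟶ (boundaries g n).obj Γ}
    (h : assemble ψ = assemble φ) : ψ = φ := by
  funext i
  refine PolygonMap.ext (funext fun a => Subtype.ext ?_) (funext fun a => ?_)
  · exact congrArg (fun k => k.onVertex ⟨i, a⟩) h
  · exact List.map_injective_iff.2 Subtype.val_injective (congrArg (fun k => k.path ⟨i, a⟩) h)

theorem assemble_comp_map {Γ Δ : FatGraph g n} (ψ : K ⟶ (boundaries g n).obj Γ) (f : Γ ⟶ Δ) :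
    assemble (ψ ≫ (boundaries g n).map f) = (assemble ψ).comp f.1.toPolygonMap := by
  refine PolygonMap.ext rfl (funext fun x => ?_)
  exact map_flatMap_eq_flatMap_map fun _ => List.attachWith_map_subtype_val _

theorem assemble_comp {Γ : FatGraph g n} (ψ : K ⟶ K') (φ : K' ⟶ (boundaries g n).obj Γ) :
    assemble (ψ ≫ φ) = (totalHom ψ).map.comp (assemble φ) := by
  refine PolygonMap.ext (funext fun _ => rfl) (funext fun x => ?_)
  exact map_flatMap_eq_flatMap_map (φ := Subtype.val) (θ := fun b => (⟨x.1, b⟩ : (total K').Vertex))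
    (q := (assemble φ).path) (p := PolygonMap.path (φ x.1)) fun _ => rfl

theorem exists_assemble_eq {Γ : FatGraph g n} (w : PolygonMap (total K).next Γ.boundary)
    (hw : ∀ x, Γ.mark (w.onVertex x) = (total K).mark x) :
    ∃ ψ : K ⟶ (boundaries g n).obj Γ, assemble ψ = w := by
  have hp : ∀ (x : (total K).Vertex), ∀ e ∈ w.path x, Γ.mark e = x.1 := fun x e he =>
    (((w.walk x).const Γ.mark_boundary).2 e he).trans (hw x)
  let ψ (i : Fin n) : PolygonMap (K i).next (Γ.boundaryPolygon i).next :=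
    { onVertex := fun a => ⟨w.onVertex ⟨i, a⟩, hw _⟩
      path := fun a => (w.path ⟨i, a⟩).attachWith (fun e => Γ.mark e = i) (hp _)
      walk := fun a => isWalk_attachWith _ (w.walk ⟨i, a⟩)
      nodup := fun a => by
        refine List.Nodup.of_map Subtype.val ?_
        rw [List.attachWith_map_subtype_val]
        exact w.nodup _
      cover := fun y => by
        obtain ⟨⟨j, a⟩, ha, ha'⟩ := w.cover y.1
        obtain rfl : i = j := y.2.symm.trans (hp _ _ ha)
        refine ⟨a, (List.mem_attachWith ..).2 ha, fun a' h => ?_⟩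
        exact eq_of_heq (Sigma.mk.inj (ha' ⟨i, a'⟩ ((List.mem_attachWith ..).1 h))).2 }
  exact ⟨ψ, PolygonMap.ext rfl (funext fun x => List.attachWith_map_subtype_val _)⟩

/-- The comma categories of the boundary functors are categories of fillings. -/
def toFilling (g : ℕ) (K : Fin n → CyclicSet) :
    StructuredArrow K (boundaries g n) ⥤ Filling (total K) g where
  obj a := ⟨a.right, assemble a.hom, mark_assemble a.hom⟩
  map {a b} f := ⟨f.right.1, f.right.2, by
    rw [← assemble_comp_map, StructuredArrow.w f]⟩

instance (g : ℕ) (K : Fin n → CyclicSet) : (toFilling g K).Faithful where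
  map_injective e :=
    StructuredArrow.hom_ext _ _ (Subtype.ext (congrArg Filling.Hom.map e))

instance (g : ℕ) (K : Fin n → CyclicSet) : (toFilling g K).Full where
  map_surjective f :=
    ⟨StructuredArrow.homMk ⟨f.map, f.isGenerated⟩
      (assemble_injective ((assemble_comp_map _ _).trans f.comm)), rfl⟩

instance (g : ℕ) (K : Fin n → CyclicSet) : (toFilling g K).EssSurj where
  mem_essImage a := by
    obtain ⟨Γ, w, hw⟩ := a
    obtain ⟨ψ, rfl⟩ := exists_assemble_eq w hw
    exact ⟨StructuredArrow.mk ψ, ⟨Iso.refl _⟩⟩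

theorem isHomotopyEquivalence_toFilling (g : ℕ) (K : Fin n → CyclicSet) :
    IsHomotopyEquivalence (toFilling g K) :=
  have : (toFilling g K).IsEquivalence := {}
  IsHomotopyEquivalence.of_isEquivalence _

/-- Precomposition with a map of polygons is compatible with the comparison. -/
def toFillingMap (g : ℕ) (ψ : K ⟶ K') :
    toFilling g K' ⋙ (totalHom ψ).pullback g ≅ StructuredArrow.map ψ ⋙ toFilling g K :=
  NatIso.ofComponents (fun a => Filling.isoOfEq _ _ (assemble_comp ψ a.hom).symm)
    fun _ => Filling.hom_ext ((CellMap.comp_id _).trans (CellMap.id_comp _).symm)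

end PolygonSystem

open PolygonSystem in
-- The equivalences with the categories of fillings intertwine this functor with the pullback along
-- `totalHom ψ`, up to isomorphism.
theorem isHomotopyEquivalence_structuredArrowMap {g n : ℕ} {K K' : Fin n → CyclicSet}
    (ψ : K ⟶ K') :
    IsHomotopyEquivalence
      (StructuredArrow.map ψ :
        StructuredArrow K' (FatGraph.boundaries g n) ⥤
          StructuredArrow K (FatGraph.boundaries g n)) :=
  (isHomotopyEquivalence_toFilling g K).of_comp_right
    (((isHomotopyEquivalence_toFilling g K').comp ((totalHom ψ).isHomotopyEquivalence g)).of_iso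
      (toFillingMap g ψ))

open PolygonSystem in
theorem nonempty_homotopyEquiv_structuredArrow_point {n : ℕ} (g : ℕ) (K : Fin n → CyclicSet) :
    Nonempty (ContinuousMap.HomotopyEquiv
      (realizedNerve (StructuredArrow K (FatGraph.boundaries g n)))
      (realizedNerve (Filling (point n) g))) := by
  obtain ⟨e, -⟩ := isHomotopyEquivalence_toFilling g K
  obtain ⟨e', -⟩ := isHomotopyEquivalence_toPoint g (total K)
  exact ⟨e.trans e'.symm⟩

theorem theoremT (g n : ℕ) (hn : 1 ≤ n) :
    (∀ (K K' : Fin n → CyclicSet) (ψ : K ⟶ K'),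
      IsHomotopyEquivalence
        (StructuredArrow.map ψ :
          StructuredArrow K' (FatGraph.boundaries g n) ⥤
            StructuredArrow K (FatGraph.boundaries g n))) ∧
    (∀ K K' : Fin n → CyclicSet,
      Nonempty (ContinuousMap.HomotopyEquiv
        (realizedNerve (StructuredArrow K (FatGraph.boundaries g n)))
        (realizedNerve (StructuredArrow K' (FatGraph.boundaries g n))))) := by
  refine ⟨fun K K' ψ => isHomotopyEquivalence_structuredArrowMap ψ, fun K K' => ?_⟩
  obtain ⟨e⟩ := nonempty_homotopyEquiv_structuredArrow_point g K
  obtain ⟨e'⟩ := nonempty_homotopyEquiv_structuredArrow_point g K'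
  exact ⟨e.trans e'.symm⟩
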